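/- Let $c\in\mathbb R$, let $F:\mathbb R\to\mathbb R$ be real analytic in a neighbourhood of $-c$ with $F'(-c)>0$, and let $\gamma>0$ satisfy $F'(-c)<\gamma^2<4F'(-c)$. Let $w:\mathbb Z\to\mathbb R$ be an admissible weight, i.e. $w(m)\ge 1$ and $w(m)\le w(m-n)\,w(n)$ for all $m,n\in\mathbb Z$, and let $(b_m)_{m\in\mathbb Z}$ be complex numbers with $b_{-m}=\overline{b_m}$ and $\sum_{m} w(m)|b_m|=1$. For $\sigma\in\mathbb R$ let $\mathcal L_{\sigma,w}$ be the set of $u:\mathbb N_0\times\mathbb Z\to\mathbb C$ with $\sum_{m} w(m)\sup_{n\ge0}e^{\sigma n}|u(n,m)|<\infty$. Put $\delta_m=-2+\frac{(m\gamma)^2}{F'(-c)}$, let $m_0$ be the largest integer $m$ with $\frac{(m\gamma)^2}{F'(-c)}\le4$ (here $m_0=1$), let $z_m=-\frac{\delta_m}2+\sqrt{\frac{\delta_m^2}4-1}$ for $|m|>m_0$, and put $\sigma_0=\min\bigl(1,-\tfrac12\ln|z_{m_0+1}|\bigr)$. Then $\sigma_0>0$, and there are a neighbourhood $D$ of $0$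 in $\mathbb R$ and a constant $C$ such that for every $\epsilon\in D$ there exist $u=u(\epsilon)\in\mathcal L_{0,w}$ and $v=v(\epsilon)\in\mathcal L_{\sigma_0,w}$ with the following properties. (a) The functions $$x_n(t)=cn+\epsilon b_0-(u+v)(0,0)+\sum_{m\in\mathbb Z}(u+v)(n,m)\,e^{im\gamma t}\quad(n\ge1),\qquad x_0(t)=\epsilon\sum_{m\in\mathbb Z}b_m e^{im\gamma t},$$ are real valued and $\frac{2\pi}{\gamma}$-periodic in $t$, the functions $x_n$ with $n\ge 1$ are of class $C^2$ and solve the driven semi-infinite lattice $$\ddot x_n(t)=F(x_{n-1}(t)-x_n(t))-F(x_n(t)-x_{n+1}(t)),\qquad n\ge1,\ t\in\mathbb R,$$ and $|x_n(t)-cn|\le C|\epsilon|$ for all $n\ge0$ and $t\in\mathbb R$. (b) $u$ is a one-phase travelling wave: there are $\beta\in\mathbb R$ and $r:\mathbb Z\to\mathbb C$ with $u(n,m)=r(m)e^{i\beta mn}$ for all $n\ge 0$, $m\in\mathbb Z$, such that the functions $y_n(t)=cn+\sum_{m\in\mathbb Z}r(m)e^{im(\beta n+\gamma t)}$, $n\in\mathbb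 Z$, are real valued, of class $C^2$, and solve the doubly infinite lattice $\ddot y_n=F(y_{n-1}-y_n)-F(y_n-y_{n+1})$, $n\in\mathbb Z$. -/

import Mathlib

open Filter Topology

namespace DrivenLattice

/-- Admissible weight functions: `w ≥ 1` and `w` is submultiplicative. -/
structure AdmissibleWeight (w : ℤ → ℝ) : Prop where
  one_le : ∀ m : ℤ, 1 ≤ w m
  submul : ∀ m n : ℤ, w m ≤ w (m - n) * w n

/-- Membership in the weighted space `ℓ_{1,w}`. -/
def MemEll1 (w : ℤ → ℝ) (a : ℤ → ℂ) : Prop :=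
  Summable fun m : ℤ => w m * ‖a m‖

/-- The norm of `ℓ_{1,w}`. -/
noncomputable def ell1Norm (w : ℤ → ℝ) (a : ℤ → ℂ) : ℝ :=
  ∑' m : ℤ, w m * ‖a m‖

/-- Membership in the space `L_{σ,w}`: for each mode `m` the number
`sup_{n ≥ 0} e^{σ n} |u(n,m)|` is finite, and these numbers form a sequence in `ℓ_{1,w}`. -/
structure MemL (σ : ℝ) (w : ℤ → ℝ) (u : ℕ → ℤ → ℂ) : Prop where
  bdd : ∀ m : ℤ, BddAbove (Set.range fun n : ℕ => Real.exp (σ * n) * ‖u n m‖)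
  summable : Summable fun m : ℤ => w m * ⨆ n : ℕ, Real.exp (σ * n) * ‖u n m‖

/-- `δ_m = -2 + (m γ)² / F'(-c)`. -/
noncomputable def delta (F : ℝ → ℝ) (c γ : ℝ) (m : ℤ) : ℝ :=
  -2 + ((m : ℝ) * γ) ^ 2 / deriv F (-c)

/-- `m₀`, the largest integer `m` with `0 ≤ (m γ)² / F'(-c) ≤ 4`. -/
noncomputable def m0 (F : ℝ → ℝ) (c γ : ℝ) : ℤ :=
  sSup {m : ℤ | 0 ≤ ((m : ℝ) * γ) ^ 2 / deriv F (-c) ∧ ((m : ℝ) * γ) ^ 2 / deriv F (-c) ≤ 4}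

/-- For a nonresonant mode (`δ_m > 2`), the root of `z² + δ_m z + 1 = 0` with `|z| < 1`. -/
noncomputable def zRoot (F : ℝ → ℝ) (c γ : ℝ) (m : ℤ) : ℝ :=
  -(delta F c γ m) / 2 + Real.sqrt (delta F c γ m ^ 2 / 4 - 1)

/-- The decay rate `σ₀ = min (1, -½ ln |z_{m₀+1}|)`. -/
noncomputable def sigma0 (F : ℝ → ℝ) (c γ : ℝ) : ℝ :=
  min 1 (-(1 / 2) * Real.log |zRoot F c γ (m0 F c γ + 1)|)

/-- The `2π`-periodic function `θ ↦ ∑ₘ a(m) e^{i m θ}`. -/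
noncomputable def fourierSeries (a : ℤ → ℂ) (θ : ℝ) : ℂ :=
  ∑' m : ℤ, a m * Complex.exp (Complex.I * (m : ℂ) * (θ : ℂ))

/-- A particle with trajectory `x` and with left and right neighbours `xl` and `xr` satisfies
(classically) the equation of motion `x'' = F(xl - x) - F(x - xr)` at all times. -/
def EqOfMotion (F : ℝ → ℝ) (xl x xr : ℝ → ℝ) : Prop :=
  ContDiff ℝ 2 x ∧ ∀ t : ℝ, iteratedDeriv 2 x t = F (xl t - x t) - F (x t - xr t)

/-- `x` solves the semi-infinite lattice driven by the prescribed motion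
`x₀(t) = ε ∑ₘ b_m e^{i m γ t}` of the zeroth particle. -/
structure IsDrivenSolution (F : ℝ → ℝ) (γ ε : ℝ) (b : ℤ → ℂ) (x : ℕ → ℝ → ℝ) : Prop where
  driver : ∀ t : ℝ, (x 0 t : ℂ) = (ε : ℂ) * fourierSeries b (γ * t)
  motion : ∀ n : ℕ, EqOfMotion F (x n) (x (n + 1)) (x (n + 2))

/-- `u(n,m)`, `n ≥ 0`, are the Fourier coefficients of a one-phase travelling wave of the
doubly infinite lattice: `u(n,m) = r(m) e^{i β m n}`, where
`y_n(t) = c n + ∑ₘ r(m) e^{i m (β n + γ t)}`, `n ∈ ℤ`, is a real valued solution of the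
doubly infinite lattice. -/
def IsOnePhaseWave (F : ℝ → ℝ) (c γ : ℝ) (u : ℕ → ℤ → ℂ) : Prop :=
  ∃ (β : ℝ) (r : ℤ → ℂ) (y : ℤ → ℝ → ℝ),
    (∀ (n : ℕ) (m : ℤ),
      u n m = r m * Complex.exp (Complex.I * (m : ℂ) * ((β * n : ℝ) : ℂ))) ∧
    (∀ (n : ℤ) (t : ℝ),
      (y n t : ℂ) = ((c * n : ℝ) : ℂ) + fourierSeries r (β * n + γ * t)) ∧
    ∀ n : ℤ, EqOfMotion F (y (n - 1)) (y n) (y (n + 1))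

end DrivenLattice

set_option linter.unusedSectionVars false

namespace DrivenLattice

/-! Put `f₁ = F'(-c)`, `κ = γ²/f₁` and `F(-c+y) = F(-c) + f₁ y + g(y)` with `g(y) = y² k(y)`. If `u`
is a travelling wave and `u + V` is to solve the lattice, the Fourier coefficients of `V` must
satisfy `V(n) + δ_m V(n+1) + V(n+2) = f₁⁻¹ (G(n+1) - G(n))`, where `G` is the difference of the
nonlinear forces of `u + V` and `u`. Since `1 < κ < 4`, the modes `|m| ≥ 2` have `δ_m > 2`: decaying
solutions exist for every boundary value at `n = 0`. For `|m| ≤ 1` the characteristic roots lie on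
the unit circle, so a decaying solution is fixed by its source and its boundary value is not free.
The missing freedom comes from the wave: its amplitude and phase, a single complex number `z`, match
the modes `m = ±1`, and a constant shift of all particles absorbs `m = 0`.

Everything takes place in weighted Wiener algebras, with coefficients in `ℝ` for the waves and in
bounded sequences over the sites for the half line. Power series act there as functions, and
evaluation at a site and a time is an algebra homomorphism, so identities in the algebra become
pointwise equations of motion.

Waves (`exists_travelling_profile`, `travelling_wave_motion`): the unknown is the rescaled nonlinear
force `N = g(aP)/(f₁ a²)`, where `aP` is the profile of the neighbour differences and `a` the
amplitude. The modes `|m| ≥ 2` of `P` are `a` times a bounded multiplier of `N`, the mode `1` is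
normalized, and its equation determines the phase `β` through an arccosine. After the rescaling the
problem is a contraction whose dependence on `N` carries a factor `a`, so `N` and `β` are Lipschitz
in `a` down to `a = 0`.

Half line (`exists_halfLine_solution`): write `V = e^{-σn} v`. For `|m| ≥ 2` the recurrence is
divided by `δ_m`, and the neighbour coupling has norm at most `2 cosh σ / δ_2 < 1` by the choice of
`σ₀`; for `|m| ≤ 1` the source is summed from infinity. A contraction gives `v` for each `z`, and an
outer contraction on `ℂ` gives `z`. The obstacle is that `e^{iβmn}` is not Lipschitz in `β`
uniformly in `n`; dependence on `z` is therefore measured with the weaker extra weight `e^{-σn/2}`,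
which absorbs the factor `n`, while the `m²` gain of the dispersion relation absorbs the factor `m`.
This weight does no harm because the boundary value at `n = 0` is not affected by it, and because
`G` contains the decaying `v` as a factor. -/

/-- A symmetric submultiplicative weight on `ℤ`, normalized at `0`. -/
structure SymmWeight where
  toFun : ℤ → ℝ
  one_le : ∀ m, 1 ≤ toFun m
  submul : ∀ m n, toFun m ≤ toFun (m - n) * toFun n
  symm : ∀ m, toFun (-m) = toFun m
  zero : toFun 0 = 1

instance : CoeFun SymmWeight (fun _ => ℤ → ℝ) := ⟨SymmWeight.toFun⟩

lemma SymmWeight.pos (w : SymmWeight) (m : ℤ) : 0 < w m := one_pos.trans_le (w.one_le m)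

lemma SymmWeight.nonneg (w : SymmWeight) (m : ℤ) : 0 ≤ w m := (w.pos m).le

/-! ### Weighted Wiener algebras of star-symmetric sequences. -/

section Wiener

variable (w : SymmWeight) (B : Type*) [NormedCommRing B] [NormedAlgebra ℝ B] [StarRing B]
  [NormedStarGroup B] [StarModule ℝ B] [CompleteSpace B]

/-- The space of `B`-valued sequences `a` with `∑ w |a| < ∞` and `a (-m) = star (a m)`. -/
def wienerSubmodule : Submodule ℝ (ℤ → B) where
  carrier := {a | Summable (fun m => w m * ‖a m‖) ∧ ∀ m, a (-m) = star (a m)}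
  add_mem' := by
    rintro a b ⟨ha, ha'⟩ ⟨hb, hb'⟩
    refine ⟨Summable.of_nonneg_of_le (fun m => mul_nonneg (w.nonneg m) (norm_nonneg _))
      (fun m => ?_) (ha.add hb), fun m => by simp [ha', hb']⟩
    rw [← mul_add]
    exact mul_le_mul_of_nonneg_left (norm_add_le _ _) (w.nonneg m)
  zero_mem' := ⟨by simp, by simp⟩
  smul_mem' := by
    rintro c a ⟨ha, ha'⟩
    refine ⟨(ha.mul_left ‖c‖).congr fun m => ?_, fun m => by simp [ha']⟩
    rw [Pi.smul_apply, norm_smul]; ring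

/-- The weighted Wiener algebra of star-symmetric sequences. -/
def Wiener : Type _ := ↥(wienerSubmodule w B)

namespace Wiener

variable {w B}

noncomputable instance : AddCommGroup (Wiener w B) :=
  inferInstanceAs (AddCommGroup ↥(wienerSubmodule w B))

noncomputable instance : Module ℝ (Wiener w B) :=
  inferInstanceAs (Module ℝ ↥(wienerSubmodule w B))

instance : FunLike (Wiener w B) ℤ B where
  coe a := (show ↥(wienerSubmodule w B) from a).1
  coe_injective _ _ h := Subtype.ext h

/-- Constructor for elements of the Wiener algebra. -/
def mk (a : ℤ → B) (h : Summable (fun m => w m * ‖a m‖)) (h' : ∀ m, a (-m) = star (a m)) :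
    Wiener w B := ⟨a, h, h'⟩

@[simp] lemma mk_apply (a : ℤ → B) (h : Summable (fun m => w m * ‖a m‖))
    (h' : ∀ m, a (-m) = star (a m)) (m : ℤ) : mk a h h' m = a m := rfl

lemma ext {a b : Wiener w B} (h : ∀ m, a m = b m) : a = b := DFunLike.ext _ _ h

lemma summable (a : Wiener w B) : Summable (fun m => w m * ‖a m‖) := a.2.1

lemma apply_neg (a : Wiener w B) (m : ℤ) : a (-m) = star (a m) := a.2.2 m

@[simp] lemma add_apply (a b : Wiener w B) (m : ℤ) : (a + b) m = a m + b m := rfl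
@[simp] lemma sub_apply (a b : Wiener w B) (m : ℤ) : (a - b) m = a m - b m := rfl
@[simp] lemma neg_apply (a : Wiener w B) (m : ℤ) : (-a) m = -a m := rfl
@[simp] lemma zero_apply (m : ℤ) : (0 : Wiener w B) m = 0 := rfl
@[simp] lemma smul_apply (c : ℝ) (a : Wiener w B) (m : ℤ) : (c • a) m = c • a m := rfl

lemma summable_norm (a : Wiener w B) : Summable (fun m => ‖a m‖) :=
  Summable.of_nonneg_of_le (fun _ => norm_nonneg _)
    (fun m => le_mul_of_one_le_left (norm_nonneg _) (w.one_le m)) a.summable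

/-- The embedding into the unweighted `ℓ¹` space. -/
noncomputable def toLp : Wiener w B →ₗ[ℝ] lp (fun _ : ℤ => B) 1 where
  toFun a := ⟨fun m => w m • a m, by
    apply memℓp_gen
    simpa [norm_smul, abs_of_pos (w.pos _)] using a.summable⟩
  map_add' a b := lp.ext (funext fun m => smul_add _ _ _)
  map_smul' c a := lp.ext (funext fun m => smul_comm _ _ _)

lemma toLp_apply (a : Wiener w B) (m : ℤ) : toLp a m = w m • a m := rfl

lemma toLp_injective : Function.Injective (toLp : Wiener w B →ₗ[ℝ] lp (fun _ : ℤ => B) 1) := by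
  intro a b h
  refine ext fun m => ?_
  have := congrArg (fun f : lp (fun _ : ℤ => B) 1 => (w m)⁻¹ • f m) h
  simpa [toLp_apply, smul_smul, (w.pos m).ne'] using this

noncomputable instance : NormedAddCommGroup (Wiener w B) :=
  NormedAddCommGroup.induced _ _ toLp toLp_injective

lemma norm_eq (a : Wiener w B) : ‖a‖ = ∑' m, w m * ‖a m‖ := by
  change ‖toLp a‖ = _
  rw [lp.norm_eq_tsum_rpow (by simp)]
  simp [toLp_apply, norm_smul, abs_of_pos (w.pos _)]

noncomputable instance : NormedSpace ℝ (Wiener w B) where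
  norm_smul_le c a := by
    rw [norm_eq, norm_eq, ← tsum_mul_left]
    refine le_of_eq (tsum_congr fun m => ?_)
    rw [smul_apply, norm_smul]; ring

lemma weighted_norm_apply_le (a : Wiener w B) (m : ℤ) : w m * ‖a m‖ ≤ ‖a‖ := by
  rw [norm_eq]
  exact a.summable.le_tsum m fun _ _ => mul_nonneg (w.nonneg _) (norm_nonneg _)

lemma norm_apply_le (a : Wiener w B) (m : ℤ) : ‖a m‖ ≤ ‖a‖ :=
  (le_mul_of_one_le_left (norm_nonneg _) (w.one_le m)).trans (weighted_norm_apply_le a m)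

lemma tsum_norm_le (a : Wiener w B) : ∑' m, ‖a m‖ ≤ ‖a‖ := by
  rw [norm_eq]
  exact a.summable_norm.tsum_le_tsum
    (fun m => le_mul_of_one_le_left (norm_nonneg _) (w.one_le m)) a.summable

/-- Weighting is an isometry onto a subspace of `ℓ¹` cut out by the star symmetry, a closed
condition because coordinates are continuous. Symmetry of the weight makes the condition survive the
rescaling. -/
instance : CompleteSpace (Wiener w B) := by
  have hiso : Isometry (toLp : Wiener w B →ₗ[ℝ] lp (fun _ : ℤ => B) 1) :=
    AddMonoidHomClass.isometry_of_norm toLp fun _ => rfl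
  refine (completeSpace_iff_isComplete_range hiso.isUniformInducing).2 (IsClosed.isComplete ?_)
  have : Set.range (toLp : Wiener w B →ₗ[ℝ] lp (fun _ : ℤ => B) 1)
      = ⋂ m : ℤ, {f | f (-m) = star (f m)} := by
    ext f
    simp only [Set.mem_range, Set.mem_iInter, Set.mem_ofPred_eq]
    constructor
    · rintro ⟨a, rfl⟩ m
      rw [toLp_apply, toLp_apply, apply_neg, w.symm, star_smul]; simp
    · intro hf
      refine ⟨mk (fun m => (w m)⁻¹ • f m) ?_ fun m => ?_, ?_⟩
      · have := (lp.memℓp f).summable (by simp)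
        refine this.congr fun m => ?_
        rw [norm_smul, norm_inv, Real.norm_of_nonneg (w.nonneg m)]
        simp [(w.pos m).ne']
      · rw [hf, w.symm, star_smul]; simp
      · ext m : 2
        rw [toLp_apply, mk_apply, smul_smul, mul_inv_cancel₀ (w.pos m).ne', one_smul]
  rw [this]
  have hc : ∀ m : ℤ, Continuous fun f : lp (fun _ : ℤ => B) 1 => f m := fun m =>
    (lp.lipschitzWith_one_eval (E := fun _ : ℤ => B) 1 m).continuous
  exact isClosed_iInter fun m => isClosed_eq (hc _) (continuous_star.comp (hc m))

/-! ### Convolution -/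

lemma summable_conv (a b : Wiener w B) (m : ℤ) : Summable fun k => a k * b (m - k) :=
  Summable.of_norm_bounded (a.summable_norm.mul_right ‖b‖) fun _ =>
    (norm_mul_le _ _).trans (mul_le_mul_of_nonneg_left (b.norm_apply_le _) (norm_nonneg _))

lemma summable_norm_conv (a b : Wiener w B) (m : ℤ) : Summable fun k => ‖a k * b (m - k)‖ :=
  Summable.of_nonneg_of_le (fun _ => norm_nonneg _) (fun _ =>
    (norm_mul_le _ _).trans (mul_le_mul_of_nonneg_left (b.norm_apply_le _) (norm_nonneg _)))
    (a.summable_norm.mul_right ‖b‖)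

lemma hasSum_weighted_prod (a b : Wiener w B) :
    HasSum (fun p : ℤ × ℤ => (w p.2 * ‖a p.2‖) * (w (p.1 - p.2) * ‖b (p.1 - p.2)‖))
      (‖a‖ * ‖b‖) := by
  have h := HasSum.mul a.summable.hasSum b.summable.hasSum
    (a.summable.mul_of_nonneg b.summable
    (fun m => mul_nonneg (w.nonneg m) (norm_nonneg _))
    (fun m => mul_nonneg (w.nonneg m) (norm_nonneg _)))
  rw [← norm_eq, ← norm_eq] at h
  let e : ℤ × ℤ ≃ ℤ × ℤ :=
    { toFun := fun p => (p.2, p.1 - p.2)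
      invFun := fun p => (p.1 + p.2, p.1)
      left_inv := fun p => by simp
      right_inv := fun p => by simp }
  exact (e.hasSum_iff).2 h

/-- Submultiplicativity distributes `w m` over the two factors of the convolution. Summed over `m`,
this gives both closure under products and the norm inequality. -/
lemma norm_conv_le (a b : Wiener w B) (m : ℤ) :
    w m * ‖∑' k, a k * b (m - k)‖ ≤
      ∑' k, (w k * ‖a k‖) * (w (m - k) * ‖b (m - k)‖) := by
  calc w m * ‖∑' k, a k * b (m - k)‖ ≤ w m * ∑' k, ‖a k * b (m - k)‖ :=
        mul_le_mul_of_nonneg_left (norm_tsum_le_tsum_norm (summable_norm_conv a b m)) (w.nonneg m)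
    _ = ∑' k, w m * ‖a k * b (m - k)‖ := tsum_mul_left.symm
    _ ≤ _ := by
      refine Summable.tsum_le_tsum (fun k => ?_) ((summable_norm_conv a b m).mul_left _)
        ((hasSum_weighted_prod a b).summable.prod_factor m)
      calc w m * ‖a k * b (m - k)‖ ≤ (w (m - k) * w k) * (‖a k‖ * ‖b (m - k)‖) :=
            mul_le_mul (w.submul m k) (norm_mul_le _ _) (norm_nonneg _)
              (mul_nonneg (w.nonneg _) (w.nonneg _))
        _ = _ := by ring

noncomputable instance : Mul (Wiener w B) where
  mul a b := mk (fun m => ∑' k, a k * b (m - k))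
    (Summable.of_nonneg_of_le (fun m => mul_nonneg (w.nonneg m) (norm_nonneg _))
      (norm_conv_le a b) (hasSum_weighted_prod a b).summable.prod)
    (fun m => by
      rw [← (Equiv.neg ℤ).tsum_eq, ← (summable_conv a b m).hasSum.star.tsum_eq]
      refine tsum_congr fun k => ?_
      rw [Equiv.neg_apply, apply_neg, show -m - -k = -(m - k) by ring, apply_neg, star_mul'])

lemma mul_apply (a b : Wiener w B) (m : ℤ) : (a * b) m = ∑' k, a k * b (m - k) := rfl

protected lemma norm_mul_le (a b : Wiener w B) : ‖a * b‖ ≤ ‖a‖ * ‖b‖ := by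
  rw [norm_eq (a * b), ← (hasSum_weighted_prod a b).tsum_eq,
    (hasSum_weighted_prod a b).summable.tsum_prod]
  exact (a * b).summable.tsum_le_tsum (norm_conv_le a b) (hasSum_weighted_prod a b).summable.prod

noncomputable instance : One (Wiener w B) where
  one := mk (Pi.single 0 1) (summable_of_ne_finset_zero (s := {0}) fun m hm => by
      rw [Pi.single_eq_of_ne (by simpa using hm)]; simp) fun m => by
    by_cases hm : m = 0
    · simp [hm]
    · rw [Pi.single_eq_of_ne (by simpa using hm), Pi.single_eq_of_ne hm, star_zero]

lemma one_apply (m : ℤ) : (1 : Wiener w B) m = (Pi.single 0 1 : ℤ → B) m := rfl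

protected lemma mul_comm (a b : Wiener w B) : a * b = b * a := by
  refine ext fun m => ?_
  rw [mul_apply, mul_apply, ← (Equiv.subLeft m).tsum_eq]
  refine tsum_congr fun k => ?_
  simp [mul_comm]

protected lemma one_mul (a : Wiener w B) : 1 * a = a := by
  refine ext fun m => ?_
  rw [mul_apply, tsum_eq_single 0]
  · simp [one_apply]
  · intro k hk
    rw [one_apply, Pi.single_eq_of_ne hk, zero_mul]

protected lemma add_mul (a b c : Wiener w B) : (a + b) * c = a * c + b * c := by
  refine ext fun m => ?_
  rw [add_apply, mul_apply, mul_apply, mul_apply,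
    ← (summable_conv a c m).tsum_add (summable_conv b c m)]
  simp [add_mul]

protected lemma mul_assoc (a b c : Wiener w B) : a * b * c = a * (b * c) := by
  refine ext fun m => ?_
  have h1 : (a * b * c) m = ∑' k, ∑' j, a j * b (k - j) * c (m - k) := by
    rw [mul_apply]
    exact tsum_congr fun k => by rw [mul_apply, (summable_conv a b k).tsum_mul_right]
  have h2 : (a * (b * c)) m = ∑' j, ∑' k, a j * b (k - j) * c (m - k) := by
    rw [mul_apply]
    refine tsum_congr fun j => ?_
    rw [mul_apply, ← (summable_conv b c (m - j)).tsum_mul_left, ← (Equiv.subRight j).tsum_eq]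
    refine tsum_congr fun k => ?_
    simp [mul_assoc]
  rw [h1, h2]
  refine Summable.tsum_comm ?_
  have hs : Summable fun p : ℤ × ℤ => ‖a p.1‖ * ‖b (p.2 - p.1)‖ * ‖c‖ := by
    refine (Summable.of_nonneg_of_le (fun _ => by positivity) (fun p => ?_)
      ((Equiv.prodComm ℤ ℤ).summable_iff.2 (hasSum_weighted_prod a b).summable)).mul_right _
    exact mul_le_mul (le_mul_of_one_le_left (norm_nonneg _) (w.one_le _))
      (le_mul_of_one_le_left (norm_nonneg _) (w.one_le _)) (norm_nonneg _)
      (mul_nonneg (w.nonneg _) (norm_nonneg _))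
  refine Summable.of_norm_bounded hs fun p => ?_
  simp only [Function.uncurry]
  calc ‖a p.1 * b (p.2 - p.1) * c (m - p.2)‖ ≤ ‖a p.1 * b (p.2 - p.1)‖ * ‖c (m - p.2)‖ :=
        norm_mul_le _ _
    _ ≤ _ := mul_le_mul (norm_mul_le _ _) (c.norm_apply_le _) (norm_nonneg _) (by positivity)

noncomputable instance : CommRing (Wiener w B) :=
  { (inferInstance : AddCommGroup (Wiener w B)) with
    mul := (· * ·)
    one := 1
    mul_assoc := Wiener.mul_assoc
    mul_comm := Wiener.mul_comm
    one_mul := Wiener.one_mul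
    mul_one := fun a => by rw [Wiener.mul_comm, Wiener.one_mul]
    right_distrib := Wiener.add_mul
    left_distrib := fun a b c => by
      rw [Wiener.mul_comm, Wiener.add_mul, Wiener.mul_comm b, Wiener.mul_comm c]
    zero_mul := fun a => ext fun m => by simp [mul_apply]
    mul_zero := fun a => ext fun m => by simp [mul_apply] }

noncomputable instance : NormedCommRing (Wiener w B) :=
  { (inferInstance : NormedAddCommGroup (Wiener w B)),
    (inferInstance : CommRing (Wiener w B)) with
    norm_mul_le := Wiener.norm_mul_le }

instance [NormOneClass B] : NormOneClass (Wiener w B) where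
  norm_one := by
    rw [norm_eq, tsum_eq_single 0]
    · simp [one_apply, w.zero]
    · intro m hm
      rw [one_apply, Pi.single_eq_of_ne hm, norm_zero, mul_zero]

protected lemma smul_mul (c : ℝ) (a b : Wiener w B) : c • a * b = c • (a * b) := by
  refine ext fun m => ?_
  rw [smul_apply, mul_apply, mul_apply, ← (summable_conv a b m).tsum_const_smul]
  simp

noncomputable instance : Algebra ℝ (Wiener w B) :=
  Algebra.ofModule Wiener.smul_mul fun c a b => by
    rw [Wiener.mul_comm, Wiener.smul_mul, Wiener.mul_comm]

noncomputable instance : NormedAlgebra ℝ (Wiener w B) where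
  norm_smul_le := norm_smul_le

/-! ### Evaluation -/

lemma summable_eval (ψ : B →ₐ[ℝ] ℂ) (hψ : ∀ x, ‖ψ x‖ ≤ ‖x‖) (θ : ℝ) (a : Wiener w B) :
    Summable fun m : ℤ => ‖ψ (a m) * Complex.exp (Complex.I * (m : ℂ) * (θ : ℂ))‖ := by
  refine Summable.of_nonneg_of_le (fun _ => norm_nonneg _) (fun m => ?_) a.summable_norm
  have : Complex.I * (m : ℂ) * (θ : ℂ) = ((m * θ : ℝ) : ℂ) * Complex.I := by push_cast; ring
  rw [norm_mul, this, Complex.norm_exp_ofReal_mul_I, mul_one]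
  exact hψ _

/-- The value at `θ` of the Fourier series with coefficients `ψ (a m)`, as an algebra
homomorphism. -/
noncomputable def eval (ψ : B →ₐ[ℝ] ℂ) (hψ : ∀ x, ‖ψ x‖ ≤ ‖x‖) (θ : ℝ) :
    Wiener w B →ₐ[ℝ] ℂ :=
  AlgHom.ofLinearMap
    { toFun := fun a => fourierSeries (fun m => ψ (a m)) θ
      map_add' := fun a b => by
        simp only [fourierSeries, add_apply, map_add, add_mul]
        exact (summable_eval ψ hψ θ a).of_norm.tsum_add (summable_eval ψ hψ θ b).of_norm
      map_smul' := fun c a => by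
        simp only [fourierSeries, smul_apply, map_smul, smul_mul_assoc, RingHom.id_apply]
        exact (summable_eval ψ hψ θ a).of_norm.tsum_const_smul c }
    (by
      change fourierSeries (fun m => ψ ((1 : Wiener w B) m)) θ = 1
      rw [fourierSeries, tsum_eq_single 0]
      · simp [one_apply]
      · intro m hm
        rw [one_apply, Pi.single_eq_of_ne hm, map_zero, zero_mul])
    (fun a b => by
      change fourierSeries (fun m => ψ ((a * b) m)) θ = fourierSeries (fun m => ψ (a m)) θ *
        fourierSeries (fun m => ψ (b m)) θ
      simp only [fourierSeries]
      have hψc : Continuous ψ := AddMonoidHomClass.continuous_of_bound ψ 1 (by simpa using hψ)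
      rw [tsum_mul_tsum_of_summable_norm (summable_eval ψ hψ θ a) (summable_eval ψ hψ θ b)]
      have hs := summable_mul_of_summable_norm (summable_eval ψ hψ θ a) (summable_eval ψ hψ θ b)
      let e : ℤ × ℤ ≃ ℤ × ℤ :=
        { toFun := fun p => (p.2, p.1 - p.2)
          invFun := fun p => (p.1 + p.2, p.1)
          left_inv := fun p => by simp
          right_inv := fun p => by simp }
      rw [← e.tsum_eq]
      refine Eq.trans ?_ ((e.summable_iff).2 hs).tsum_prod.symm
      refine tsum_congr fun m => ?_
      rw [mul_apply, (summable_conv a b m).map_tsum ψ hψc, ← tsum_mul_right]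
      refine tsum_congr fun k => ?_
      change _ = ψ (a k) * _ * (ψ (b (m - k)) * _)
      rw [map_mul, mul_mul_mul_comm, ← Complex.exp_add]
      congr 2
      change Complex.I * (m : ℂ) * θ = Complex.I * (k : ℂ) * θ + Complex.I * ((m - k : ℤ) : ℂ) * θ
      push_cast; ring)

lemma eval_apply (ψ : B →ₐ[ℝ] ℂ) (hψ : ∀ x, ‖ψ x‖ ≤ ‖x‖) (θ : ℝ) (a : Wiener w B) :
    eval ψ hψ θ a = fourierSeries (fun m => ψ (a m)) θ := rfl

lemma norm_eval_le (ψ : B →ₐ[ℝ] ℂ) (hψ : ∀ x, ‖ψ x‖ ≤ ‖x‖) (θ : ℝ) (a : Wiener w B) :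
    ‖eval ψ hψ θ a‖ ≤ ‖a‖ := by
  rw [eval_apply, fourierSeries]
  refine (norm_tsum_le_tsum_norm (summable_eval ψ hψ θ a)).trans (le_trans ?_ a.tsum_norm_le)
  refine (summable_eval ψ hψ θ a).tsum_le_tsum (fun m => ?_) a.summable_norm
  have : Complex.I * (m : ℂ) * (θ : ℂ) = ((m * θ : ℝ) : ℂ) * Complex.I := by push_cast; ring
  rw [norm_mul, this, Complex.norm_exp_ofReal_mul_I, mul_one]
  exact hψ _

end Wiener
end Wiener

lemma fourierSeries_conj {a : ℤ → ℂ} (ha : ∀ m, a (-m) = (starRingEnd ℂ) (a m)) (θ : ℝ) :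
    (starRingEnd ℂ) (fourierSeries a θ) = fourierSeries a θ := by
  rw [fourierSeries, Complex.conj_tsum, ← (Equiv.neg ℤ).tsum_eq]
  refine tsum_congr fun m => ?_
  rw [Equiv.neg_apply, map_mul, ha, Complex.conj_conj, ← Complex.exp_conj]
  simp

lemma ofReal_re_fourierSeries {a : ℤ → ℂ} (ha : ∀ m, a (-m) = (starRingEnd ℂ) (a m)) (θ : ℝ) :
    ((fourierSeries a θ).re : ℂ) = fourierSeries a θ :=
  Complex.conj_eq_iff_re.1 (fourierSeries_conj ha θ)

/-! ### Power series in a Banach algebra and their first and second differences. -/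

section PowerSeries

variable {A : Type*} [NormedCommRing A]

/-- The quotient `(x ^ j - y ^ j) / (x - y)`. -/
def divDiff (x y : A) : ℕ → A
  | 0 => 0
  | j + 1 => x * divDiff x y j + y ^ j

lemma pow_sub_pow_eq_divDiff (x y : A) (j : ℕ) : x ^ j - y ^ j = (x - y) * divDiff x y j := by
  induction j with
  | zero => simp [divDiff]
  | succ j ih => rw [divDiff, mul_add, mul_left_comm, ← ih]; ring

/-- The second difference quotient
`((x + v) ^ j - x ^ j - (y + v) ^ j + y ^ j) / (v * (x - y))`. -/
def divDiff₂ (x y v : A) : ℕ → A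
  | 0 => 0
  | j + 1 => divDiff (x + v) x j + (y + v) * divDiff₂ x y v j + divDiff x y j

/-- An exact factorization is kept instead of a norm estimate: the factors `v` and `x - y` are later
cancelled against, or multiplied by, exponential weights. -/
lemma pow_second_difference (x y v : A) (j : ℕ) :
    (x + v) ^ j - x ^ j - ((y + v) ^ j - y ^ j) = v * (x - y) * divDiff₂ x y v j := by
  have key : divDiff (x + v) x j - divDiff (y + v) y j = (x - y) * divDiff₂ x y v j := by
    induction j with
    | zero => simp [divDiff, divDiff₂]
    | succ j ih =>
      simp only [divDiff, divDiff₂]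
      have h := pow_sub_pow_eq_divDiff x y j
      linear_combination (y + v) * ih + h
  rw [pow_sub_pow_eq_divDiff, pow_sub_pow_eq_divDiff, add_sub_cancel_left, add_sub_cancel_left,
    ← mul_sub, key, mul_assoc]

variable [NormOneClass A]

lemma norm_divDiff_le {x y : A} {M : ℝ} (hx : ‖x‖ ≤ M) (hy : ‖y‖ ≤ M) (j : ℕ) :
    ‖divDiff x y j‖ ≤ j * M ^ (j - 1) := by
  have hM : 0 ≤ M := (norm_nonneg x).trans hx
  induction j with
  | zero => simp [divDiff]
  | succ j ih =>
    have h1 : ‖y ^ j‖ ≤ M ^ j := (norm_pow_le y j).trans (pow_le_pow_left₀ (norm_nonneg _) hy j)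
    have h2 : ‖x * divDiff x y j‖ ≤ j * M ^ j := by
      refine (norm_mul_le _ _).trans ((mul_le_mul hx ih (norm_nonneg _) hM).trans (le_of_eq ?_))
      cases j with
      | zero => simp
      | succ i => simp only [add_tsub_cancel_right]; ring
    refine (norm_add_le _ _).trans ((add_le_add h2 h1).trans (le_of_eq ?_))
    push_cast [add_tsub_cancel_right]; ring

lemma norm_divDiff₂_le {x y v : A} {M : ℝ} (hx : ‖x‖ ≤ M) (hy : ‖y‖ ≤ M)
    (hxv : ‖x + v‖ ≤ M) (hyv : ‖y + v‖ ≤ M) (j : ℕ) :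
    ‖divDiff₂ x y v j‖ ≤ j * (j - 1) * M ^ (j - 2) := by
  have hM : 0 ≤ M := (norm_nonneg x).trans hx
  induction j with
  | zero => simp [divDiff₂]
  | succ j ih =>
    have h1 := norm_divDiff_le hxv hx j
    have h3 := norm_divDiff_le hx hy j
    have h2 : ‖(y + v) * divDiff₂ x y v j‖ ≤ j * (j - 1) * M ^ (j - 1) := by
      refine (norm_mul_le _ _).trans ((mul_le_mul hyv ih (norm_nonneg _) hM).trans (le_of_eq ?_))
      rcases j with _ | _ | i
      · simp
      · simp
      · simp only [show i + 1 + 1 - 2 = i by omega, show i + 1 + 1 - 1 = i + 1 by omega]; ring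
    refine (norm_add₃_le).trans ((add_le_add (add_le_add h1 h2) h3).trans (le_of_eq ?_))
    rw [show j + 1 - 2 = j - 1 by omega]
    push_cast; ring

variable [NormedAlgebra ℝ A] [CompleteSpace A]

/-- The power series `∑ cⱼ xʲ`. -/
noncomputable def powerSeries (c : ℕ → ℝ) (x : A) : A := ∑' j, c j • x ^ j

lemma summable_sq_geometric (C₀ R : ℝ) :
    Summable fun j : ℕ => C₀ * (R * ((j : ℝ) ^ 2 * (1 / 2) ^ j)) :=
  ((summable_pow_mul_geometric_of_norm_lt_one 2 (by norm_num)).mul_left R).mul_left C₀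

variable {c : ℕ → ℝ} {C₀ R : ℝ}

/-- On the ball where `M R ≤ 1/2` the coefficient growth `R ^ j` turns into the geometric factor
`(1/2) ^ j`; the `n` missing powers of `M` cost `(2R) ^ n`. The cases `n = 0, 1, 2` serve values,
differences and second differences. -/
lemma bound_term (hc : ∀ j, |c j| ≤ C₀ * R ^ j) (hR : 0 < R) {M : ℝ}
    (hM : 0 ≤ M) (hMR : M * R ≤ 1 / 2) {n : ℕ} {j : ℕ} {x : A} {b : ℝ} (hb : 0 ≤ b) (hnj : n ≤ j)
    (hx : ‖x‖ ≤ b * M ^ (j - n)) :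
    ‖c j • x‖ ≤ C₀ * ((2 * R) ^ n * (b * (1 / 2) ^ j)) := by
  have hC : 0 ≤ C₀ := by simpa using (abs_nonneg _).trans (hc 0)
  rw [norm_smul, Real.norm_eq_abs]
  obtain ⟨i, rfl⟩ := Nat.exists_eq_add_of_le hnj
  rw [add_tsub_cancel_left] at hx
  calc |c (n + i)| * ‖x‖ ≤ (C₀ * R ^ (n + i)) * (b * M ^ i) :=
        mul_le_mul (hc _) hx (norm_nonneg _) (by positivity)
    _ = C₀ * (R ^ n * (b * (M * R) ^ i)) := by rw [mul_pow]; ring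
    _ ≤ C₀ * (R ^ n * (b * (1 / 2) ^ i)) := by gcongr
    _ = _ := by
      rw [pow_add, mul_pow, one_div, inv_pow, inv_pow]; field_simp

lemma summable_powerSeries (hc : ∀ j, |c j| ≤ C₀ * R ^ j) (hR : 0 < R) {x : A}
    (hx : ‖x‖ * R ≤ 1 / 2) : Summable fun j => c j • x ^ j := by
  have hs : Summable fun j : ℕ => C₀ * ((2 * R) ^ 0 * (1 * (1 / 2 : ℝ) ^ j)) :=
    (((summable_geometric_of_lt_one (by norm_num) (by norm_num)).mul_left _).mul_left _).mul_left _
  exact Summable.of_norm_bounded hs fun j =>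
    bound_term hc hR (norm_nonneg x) hx zero_le_one (Nat.zero_le j)
      (by simpa using norm_pow_le x j)

lemma exists_powerSeries_bounds (A : Type*) [NormedCommRing A] [NormOneClass A]
    [NormedAlgebra ℝ A] [CompleteSpace A] (hc : ∀ j, |c j| ≤ C₀ * R ^ j) (hR : 0 < R) :
    ∃ C : ℝ, 0 < C ∧
      (∀ x : A, ‖x‖ * R ≤ 1 / 2 → ‖powerSeries c x‖ ≤ C) ∧
      (∀ x y : A, ‖x‖ * R ≤ 1 / 2 → ‖y‖ * R ≤ 1 / 2 →
        ∃ K, powerSeries c x - powerSeries c y = (x - y) * K ∧ ‖K‖ ≤ C) ∧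
      (∀ x y v : A, ‖x‖ * R ≤ 1 / 2 → ‖y‖ * R ≤ 1 / 2 → ‖x + v‖ * R ≤ 1 / 2 →
        ‖y + v‖ * R ≤ 1 / 2 → ∃ K,
          powerSeries c (x + v) - powerSeries c x - (powerSeries c (y + v) - powerSeries c y)
            = v * (x - y) * K ∧ ‖K‖ ≤ C) := by
  have hC : 0 ≤ C₀ := by simpa using (abs_nonneg _).trans (hc 0)
  have hMR : 1 / (2 * R) * R ≤ 1 / 2 := by field_simp; rfl
  have hle : ∀ {x : A}, ‖x‖ * R ≤ 1 / 2 → ‖x‖ ≤ 1 / (2 * R) := fun h => by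
    rw [le_div_iff₀ (by positivity)]; linarith
  have hM : 0 ≤ 1 / (2 * R) := by positivity
  have hs0 : Summable fun j : ℕ => C₀ * ((2 * R) ^ 0 * (1 * (1 / 2 : ℝ) ^ j)) :=
    (((summable_geometric_of_lt_one (by norm_num) (by norm_num)).mul_left _).mul_left _).mul_left _
  have hs1 := summable_sq_geometric C₀ ((2 * R) ^ 1)
  have hs2 := summable_sq_geometric C₀ ((2 * R) ^ 2)
  set S0 := ∑' j : ℕ, C₀ * ((2 * R) ^ 0 * (1 * (1 / 2 : ℝ) ^ j))
  set S1 := ∑' j : ℕ, C₀ * ((2 * R) ^ 1 * ((j : ℝ) ^ 2 * (1 / 2) ^ j))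
  set S2 := ∑' j : ℕ, C₀ * ((2 * R) ^ 2 * ((j : ℝ) ^ 2 * (1 / 2) ^ j))
  have hS0 : 0 ≤ S0 := tsum_nonneg fun j => by positivity
  have hS1 : 0 ≤ S1 := tsum_nonneg fun j => by positivity
  have hS2 : 0 ≤ S2 := tsum_nonneg fun j => by positivity
  refine ⟨S0 + S1 + S2 + 1, by positivity, fun x hx => ?_, fun x y hx hy => ?_,
    fun x y v hx hy hxv hyv => ?_⟩
  · have h := tsum_of_norm_bounded hs0.hasSum fun j =>
      bound_term (x := x ^ j) hc hR (norm_nonneg x) hx zero_le_one (Nat.zero_le j)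
        (by simpa using norm_pow_le x j)
    exact h.trans (by linarith)
  · have hb : ∀ j, ‖c j • divDiff x y j‖ ≤ C₀ * ((2 * R) ^ 1 * ((j : ℝ) ^ 2 * (1 / 2) ^ j)) := by
      intro j
      rcases Nat.eq_zero_or_pos j with rfl | hj
      · simp [divDiff]
      · refine bound_term hc hR hM hMR (by positivity) hj
          ((norm_divDiff_le (hle hx) (hle hy) j).trans ?_)
        have : (1 : ℝ) ≤ j := by exact_mod_cast hj
        gcongr
        nlinarith
    refine ⟨∑' j, c j • divDiff x y j, ?_, ?_⟩
    · rw [powerSeries, powerSeries, ← (summable_powerSeries hc hR hx).tsum_sub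
        (summable_powerSeries hc hR hy), ← (Summable.of_norm_bounded hs1 hb).tsum_mul_left]
      exact tsum_congr fun j => by
        rw [← smul_sub, pow_sub_pow_eq_divDiff, mul_smul_comm]
    · exact (tsum_of_norm_bounded hs1.hasSum hb).trans (by linarith)
  · have hb : ∀ j, ‖c j • divDiff₂ x y v j‖
        ≤ C₀ * ((2 * R) ^ 2 * ((j : ℝ) ^ 2 * (1 / 2) ^ j)) := by
      intro j
      rcases lt_or_ge j 2 with hj | hj
      · have : divDiff₂ x y v j = 0 := by
          interval_cases j <;> simp [divDiff₂, divDiff]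
        rw [this, smul_zero, norm_zero]; positivity
      · refine bound_term hc hR hM hMR (by positivity) hj
          ((norm_divDiff₂_le (hle hx) (hle hy) (hle hxv) (hle hyv) j).trans ?_)
        have : (1 : ℝ) ≤ j := by exact_mod_cast (by omega : 1 ≤ j)
        gcongr
        nlinarith
    refine ⟨∑' j, c j • divDiff₂ x y v j, ?_, ?_⟩
    · simp only [powerSeries]
      rw [← (summable_powerSeries hc hR hxv).tsum_sub (summable_powerSeries hc hR hx),
        ← (summable_powerSeries hc hR hyv).tsum_sub (summable_powerSeries hc hR hy),
        ← ((summable_powerSeries hc hR hxv).sub (summable_powerSeries hc hR hx)).tsum_sub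
          ((summable_powerSeries hc hR hyv).sub (summable_powerSeries hc hR hy)),
        ← (Summable.of_norm_bounded hs2 hb).tsum_mul_left]
      exact tsum_congr fun j => by
        rw [← smul_sub, ← smul_sub, ← smul_sub, pow_second_difference, mul_smul_comm]
    · exact (tsum_of_norm_bounded hs2.hasSum hb).trans (by linarith)

/-- Continuous homomorphisms pass through convergent power series. This links functions of algebra
elements with pointwise values of `F`. -/
lemma map_powerSeries (hc : ∀ j, |c j| ≤ C₀ * R ^ j) (hR : 0 < R) (φ : A →ₐ[ℝ] ℂ)
    (hφ : ∀ x, ‖φ x‖ ≤ ‖x‖) {x : A} (hx : ‖x‖ * R ≤ 1 / 2) {y : ℝ} (hxy : φ x = y) :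
    φ (powerSeries c x) = (powerSeries c y : ℝ) := by
  have hφc : Continuous φ := AddMonoidHomClass.continuous_of_bound φ 1 (by simpa using hφ)
  rw [powerSeries, (summable_powerSeries hc hR hx).map_tsum φ hφc, powerSeries, Complex.ofReal_tsum]
  exact tsum_congr fun j => by simp [hxy]

end PowerSeries

/-! ### The quadratic Taylor remainder of the force. -/

/-- The remainder `g(x) = x² k(x)`, as a function on a Banach algebra. -/
noncomputable def remainder {A : Type*} [NormedCommRing A] [NormedAlgebra ℝ A] (k : ℕ → ℝ) (x : A) :
    A := x ^ 2 * powerSeries k x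

/-- Quadratic vanishing yields the factor `M` in the first difference, which is the smallness
driving the half-line contraction. A second difference of a quadratic function is merely bounded, so
no such factor appears there. -/
lemma exists_remainder_bounds (A : Type*) [NormedCommRing A] [NormOneClass A]
    [NormedAlgebra ℝ A] [CompleteSpace A] {k : ℕ → ℝ} {C₀ R : ℝ}
    (hk : ∀ j, |k j| ≤ C₀ * R ^ j) (hR : 0 < R) :
    ∃ C : ℝ, 0 < C ∧
      (∀ (M : ℝ) (x y : A), M * R ≤ 1 / 2 → ‖x‖ ≤ M → ‖y‖ ≤ M →
        ∃ K, remainder k x - remainder k y = (x - y) * K ∧ ‖K‖ ≤ C * M) ∧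
      (∀ (M : ℝ) (x y v : A), M * R ≤ 1 / 2 → ‖x‖ ≤ M → ‖y‖ ≤ M → ‖x + v‖ ≤ M → ‖y + v‖ ≤ M →
        ∃ K, remainder k (x + v) - remainder k x - (remainder k (y + v) - remainder k y)
            = v * (x - y) * K ∧ ‖K‖ ≤ C) := by
  obtain ⟨C₁, hC₁, hb, hl, -⟩ := exists_powerSeries_bounds A hk hR
  -- The remainder is itself a power series, with coefficients shifted by two; the second-difference
  -- bound is applied to this series.
  let c : ℕ → ℝ := fun j => if j < 2 then 0 else k (j - 2)
  have hC : 0 ≤ C₀ := by simpa using (abs_nonneg _).trans (hk 0)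
  have hc : ∀ j, |c j| ≤ (C₀ / R ^ 2) * R ^ j := by
    intro j
    rcases lt_or_ge j 2 with hj | hj
    · simp only [c, if_pos hj, abs_zero]; positivity
    · obtain ⟨i, rfl⟩ := Nat.exists_eq_add_of_le hj
      simp only [c, if_neg (not_lt.2 hj), add_tsub_cancel_left]
      refine (hk i).trans (le_of_eq ?_)
      rw [pow_add]; field_simp
  have hrem : ∀ x : A, ‖x‖ * R ≤ 1 / 2 → remainder k x = powerSeries c x := by
    intro x hx
    rw [powerSeries, ← (summable_powerSeries hc hR hx).sum_add_tsum_nat_add 2, remainder,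
      powerSeries, ← (summable_powerSeries hk hR hx).tsum_mul_left]
    simp only [c, Finset.sum_range_succ]
    simp [pow_add, mul_comm]
  obtain ⟨C₂, hC₂, -, -, hl₂⟩ := exists_powerSeries_bounds A hc hR
  refine ⟨2 * C₁ + C₁ / R + C₂, by positivity, fun M x y hM hx hy => ?_,
    fun M x y v hM hx hy hxv hyv => ?_⟩
  · have hR' : ∀ {z : A}, ‖z‖ ≤ M → ‖z‖ * R ≤ 1 / 2 := fun h =>
      (mul_le_mul_of_nonneg_right h hR.le).trans hM
    have hM0 : 0 ≤ M := (norm_nonneg _).trans hx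
    obtain ⟨K, hK, hKb⟩ := hl x y (hR' hx) (hR' hy)
    refine ⟨(x + y) * powerSeries k x + y ^ 2 * K, ?_, ?_⟩
    · rw [remainder, remainder]
      linear_combination y ^ 2 * hK
    · have h1 : ‖(x + y) * powerSeries k x‖ ≤ (M + M) * C₁ :=
        (norm_mul_le _ _).trans (mul_le_mul ((norm_add_le _ _).trans (add_le_add hx hy))
          (hb x (hR' hx)) (norm_nonneg _) (by positivity))
      have h2 : ‖y ^ 2 * K‖ ≤ M ^ 2 * C₁ :=
        (norm_mul_le _ _).trans (mul_le_mul ((norm_pow_le _ _).trans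
          (pow_le_pow_left₀ (norm_nonneg _) hy 2)) hKb (norm_nonneg _) (by positivity))
      have h3 : M ^ 2 * C₁ ≤ C₁ / R * M := by
        rw [div_mul_eq_mul_div, le_div_iff₀ hR]
        nlinarith [mul_le_mul_of_nonneg_left hM (mul_nonneg hC₁.le hM0), mul_nonneg hC₁.le hM0]
      have h4 : 0 ≤ C₂ * M := by positivity
      refine (norm_add_le _ _).trans ((add_le_add h1 (h2.trans h3)).trans ?_)
      nlinarith
  · have hR' : ∀ {z : A}, ‖z‖ ≤ M → ‖z‖ * R ≤ 1 / 2 := fun h =>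
      (mul_le_mul_of_nonneg_right h hR.le).trans hM
    obtain ⟨K, hK, hKb⟩ := hl₂ x y v (hR' hx) (hR' hy) (hR' hxv) (hR' hyv)
    refine ⟨K, ?_, hKb.trans ?_⟩
    · rw [hrem _ (hR' hx), hrem _ (hR' hy), hrem _ (hR' hxv), hrem _ (hR' hyv), hK]
    · have : 0 ≤ C₁ / R := by positivity
      linarith

lemma map_remainder {A : Type*} [NormedCommRing A] [NormOneClass A]
    [NormedAlgebra ℝ A] [CompleteSpace A] {k : ℕ → ℝ} {C₀ R : ℝ}
    (hk : ∀ j, |k j| ≤ C₀ * R ^ j) (hR : 0 < R) (φ : A →ₐ[ℝ] ℂ)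
    (hφ : ∀ x, ‖φ x‖ ≤ ‖x‖) {x : A} (hx : ‖x‖ * R ≤ 1 / 2) {y : ℝ} (hxy : φ x = y) :
    φ (remainder k x) = (remainder k y : ℝ) := by
  rw [remainder, map_mul, map_pow, map_powerSeries hk hR φ hφ hx hxy, hxy, remainder]
  push_cast; rfl

lemma remainder_smul {A : Type*} [NormedCommRing A] [NormedAlgebra ℝ A] (k : ℕ → ℝ) (a : ℝ) (x : A) :
    remainder k (a • x) = a ^ 2 • (x ^ 2 * powerSeries k (a • x)) := by
  rw [remainder, smul_pow, smul_mul_assoc]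

/-- Take `R = 1/ρ` for some `ρ` strictly inside the radius of convergence; then `|y| R ≤ 1/2` forces
`|y| < ρ`. -/
lemma exists_taylor {F : ℝ → ℝ} {z : ℝ} (hF : AnalyticAt ℝ F z) :
    ∃ (k : ℕ → ℝ) (C₀ R : ℝ), 0 < R ∧ (∀ j, |k j| ≤ C₀ * R ^ j) ∧
      ∀ y : ℝ, |y| * R ≤ 1 / 2 → F (z + y) = F z + deriv F z * y + remainder k y := by
  obtain ⟨p, r, hp⟩ := hF
  obtain ⟨ρ, hρ0, hρr⟩ := ENNReal.lt_iff_exists_nnreal_btwn.1 hp.r_pos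
  have hρ0' : 0 < (ρ : ℝ) := by exact_mod_cast hρ0
  obtain ⟨C, hC, hCb⟩ := p.norm_mul_pow_le_of_lt_radius (hρr.trans_le hp.r_le)
  have hcoef : ∀ n, |p.coeff n| ≤ C * (ρ : ℝ)⁻¹ ^ n := fun n => by
    have := hCb n
    rw [FormalMultilinearSeries.norm_apply_eq_norm_coef, Real.norm_eq_abs] at this
    rw [inv_pow, ← div_eq_mul_inv, le_div_iff₀ (by positivity)]
    exact this
  refine ⟨fun j => p.coeff (j + 2), C * (ρ : ℝ)⁻¹ ^ 2, (ρ : ℝ)⁻¹, by positivity, fun j => ?_,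
    fun y hy => ?_⟩
  · exact (hcoef _).trans (le_of_eq (by rw [pow_add]; ring))
  · have hyρ : |y| < ρ := by
      rw [mul_inv_le_iff₀ hρ0'] at hy; linarith
    have hmem : y ∈ Metric.eball (0 : ℝ) r := by
      rw [Metric.mem_eball, edist_zero_right]
      refine lt_trans ?_ hρr
      rw [← ofReal_norm, Real.norm_eq_abs, ← ENNReal.ofReal_coe_nnreal]
      exact (ENNReal.ofReal_lt_ofReal_iff hρ0').2 hyρ
    have hs : HasSum (fun n => p.coeff n * y ^ n) (F (z + y)) := by
      refine (hp.hasSum hmem).congr_fun fun n => ?_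
      rw [FormalMultilinearSeries.apply_eq_pow_smul_coeff, smul_eq_mul, mul_comm]
    have hd : deriv F z = p.coeff 1 := by
      rw [hp.hasFPowerSeriesAt.deriv]; rfl
    have h0 : F z = p.coeff 0 := (hp.coeff_zero _).symm
    rw [← hs.tsum_eq, ← hs.summable.sum_add_tsum_nat_add 2, hd, h0, remainder, powerSeries,
      ← tsum_mul_left]
    simp only [Finset.sum_range_succ, Finset.sum_range_zero, zero_add, pow_zero, mul_one, pow_one]
    congr 1
    exact tsum_congr fun j => by rw [pow_add, smul_eq_mul]; ring

/-! ### Comparison of norms and Fourier multipliers on Wiener algebras. -/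

namespace Wiener

variable {w : SymmWeight} {B : Type*} [NormedCommRing B] [NormedAlgebra ℝ B] [StarRing B]
  [NormedStarGroup B] [StarModule ℝ B] [CompleteSpace B]
  {B' : Type*} [NormedCommRing B'] [NormedAlgebra ℝ B'] [StarRing B']
  [NormedStarGroup B'] [StarModule ℝ B'] [CompleteSpace B']

lemma summable_of_le (y : Wiener w B') (z : Wiener w B') {c d : ℝ}
    {x : ℤ → B} (h : ∀ m, ‖x m‖ ≤ c * ‖y m‖ + d * ‖z m‖) :
    Summable fun m => w m * ‖x m‖ :=
  Summable.of_nonneg_of_le (fun m => mul_nonneg (w.nonneg m) (norm_nonneg _))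
    (fun m => (mul_le_mul_of_nonneg_left (h m) (w.nonneg m)).trans
      (le_of_eq (by ring : _ = c * (w m * ‖y m‖) + d * (w m * ‖z m‖))))
    ((y.summable.mul_left c).add (z.summable.mul_left d))

lemma norm_le_add (x : Wiener w B) (y : Wiener w B') (z : Wiener w B') {c d : ℝ}
    (h : ∀ m, ‖x m‖ ≤ c * ‖y m‖ + d * ‖z m‖) : ‖x‖ ≤ c * ‖y‖ + d * ‖z‖ := by
  rw [norm_eq, norm_eq, norm_eq, ← tsum_mul_left, ← tsum_mul_left,
    ← (y.summable.mul_left c).tsum_add (z.summable.mul_left d)]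
  refine x.summable.tsum_le_tsum (fun m => ?_) ((y.summable.mul_left c).add (z.summable.mul_left d))
  exact (mul_le_mul_of_nonneg_left (h m) (w.nonneg m)).trans (le_of_eq (by ring))

lemma norm_le_mul (x : Wiener w B) (y : Wiener w B') {c : ℝ}
    (h : ∀ m, ‖x m‖ ≤ c * ‖y m‖) : ‖x‖ ≤ c * ‖y‖ := by
  simpa using norm_le_add x y 0 (d := 0) (by simpa using h)

/-- The operator acting on the `m`-th coefficient by `T m`. -/
noncomputable def diag (T : ℤ → B →ₗ[ℝ] B) (C : ℝ) (hT : ∀ m x, ‖T m x‖ ≤ C * ‖x‖)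
    (hs : ∀ m x, T (-m) (star x) = star (T m x)) : Wiener w B →ₗ[ℝ] Wiener w B where
  toFun a := mk (fun m => T m (a m))
    (summable_of_le a 0 (c := C) (d := 0) fun m => by simpa using hT m (a m))
    fun m => by rw [apply_neg, hs]
  map_add' a b := ext fun m => (T m).map_add (a m) (b m)
  map_smul' c a := ext fun m => (T m).map_smul c (a m)

@[simp] lemma diag_apply (T : ℤ → B →ₗ[ℝ] B) (C : ℝ) (hT : ∀ m x, ‖T m x‖ ≤ C * ‖x‖)
    (hs : ∀ m x, T (-m) (star x) = star (T m x)) (a : Wiener w B) (m : ℤ) :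
    diag T C hT hs a m = T m (a m) := rfl

lemma norm_diag_le (T : ℤ → B →ₗ[ℝ] B) (C : ℝ) (hT : ∀ m x, ‖T m x‖ ≤ C * ‖x‖)
    (hs : ∀ m x, T (-m) (star x) = star (T m x)) (a : Wiener w B) :
    ‖diag T C hT hs a‖ ≤ C * ‖a‖ :=
  norm_le_mul _ _ fun m => hT m (a m)

/-- The sequence concentrated at `m = 0`. -/
noncomputable def const (x : B) (hx : star x = x) : Wiener w B :=
  mk (Pi.single 0 x) (summable_of_ne_finset_zero (s := {0}) fun m hm => by
      rw [Pi.single_eq_of_ne (by simpa using hm)]; simp) fun m => by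
    by_cases hm : m = 0
    · simp [hm, hx]
    · rw [Pi.single_eq_of_ne (by simpa using hm), Pi.single_eq_of_ne hm, star_zero]

lemma const_mul_apply (x : B) (hx : star x = x) (a : Wiener w B) (m : ℤ) :
    ((const x hx : Wiener w B) * a) m = x * a m := by
  rw [mul_apply, tsum_eq_single 0]
  · simp [const]
  · intro k hk
    rw [const, mk_apply, Pi.single_eq_of_ne hk, zero_mul]

lemma norm_const_mul_le (x : B) (hx : star x = x) (a : Wiener w B) :
    ‖(const x hx : Wiener w B) * a‖ ≤ ‖x‖ * ‖a‖ :=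
  norm_le_mul _ _ fun m => by rw [const_mul_apply]; exact norm_mul_le _ _

lemma conj_eval {ψ : B →ₐ[ℝ] ℂ} {hψ : ∀ x, ‖ψ x‖ ≤ ‖x‖}
    (hs : ∀ x, ψ (star x) = (starRingEnd ℂ) (ψ x)) (a : Wiener w B) (θ : ℝ) :
    ((eval ψ hψ θ a).re : ℂ) = eval ψ hψ θ a :=
  ofReal_re_fourierSeries (fun m => by rw [apply_neg, hs]) θ

/-- The sequence `e` with `e(1) = e(-1) = 1` and zero otherwise. -/
noncomputable def cosine (w : SymmWeight) : Wiener w ℝ :=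
  mk (fun m => if |m| = 1 then 1 else 0)
    (summable_of_ne_finset_zero (s := {1, -1}) fun m hm => by
      have : ¬ |m| = 1 := by
        rw [abs_eq (by norm_num)]; simpa using hm
      simp [this]) fun m => by simp

lemma cosine_apply (m : ℤ) : cosine w m = if |m| = 1 then 1 else 0 := rfl

end Wiener

/-! ### Differentiating Fourier series -/

lemma norm_fourier_term (z : ℂ) (m : ℤ) (θ : ℝ) :
    ‖z * Complex.exp (Complex.I * (m : ℂ) * (θ : ℂ))‖ = ‖z‖ := by
  have : Complex.I * (m : ℂ) * (θ : ℂ) = ((m * θ : ℝ) : ℂ) * Complex.I := by push_cast; ring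
  rw [norm_mul, this, Complex.norm_exp_ofReal_mul_I, mul_one]

lemma summable_fourier {a : ℤ → ℂ} (ha : Summable fun m => ‖a m‖) (θ : ℝ) :
    Summable fun m : ℤ => a m * Complex.exp (Complex.I * (m : ℂ) * (θ : ℂ)) :=
  Summable.of_norm (ha.congr fun m => (norm_fourier_term (a m) m θ).symm)

lemma fourierSeries_add {a b : ℤ → ℂ} (ha : Summable fun m => ‖a m‖)
    (hb : Summable fun m => ‖b m‖) (θ : ℝ) :
    fourierSeries (fun m => a m + b m) θ = fourierSeries a θ + fourierSeries b θ := by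
  simp only [fourierSeries, add_mul]
  exact (summable_fourier ha θ).tsum_add (summable_fourier hb θ)

lemma fourierSeries_sub {a b : ℤ → ℂ} (ha : Summable fun m => ‖a m‖)
    (hb : Summable fun m => ‖b m‖) (θ : ℝ) :
    fourierSeries (fun m => a m - b m) θ = fourierSeries a θ - fourierSeries b θ := by
  simp only [fourierSeries, sub_mul]
  exact (summable_fourier ha θ).tsum_sub (summable_fourier hb θ)

lemma fourierSeries_const_mul (z : ℂ) (a : ℤ → ℂ) (θ : ℝ) :
    fourierSeries (fun m => z * a m) θ = z * fourierSeries a θ := by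
  simp only [fourierSeries, mul_assoc]
  exact tsum_mul_left

lemma fourierSeries_shift (a : ℤ → ℂ) (s θ : ℝ) :
    fourierSeries (fun m => a m * Complex.exp (Complex.I * (m : ℂ) * (s : ℂ))) θ
      = fourierSeries a (s + θ) := by
  simp only [fourierSeries, mul_assoc, ← Complex.exp_add]
  refine tsum_congr fun m => ?_
  congr 2; push_cast; ring

lemma fourierSeries_periodic (a : ℤ → ℂ) (θ : ℝ) :
    fourierSeries a (θ + 2 * Real.pi) = fourierSeries a θ := by
  simp only [fourierSeries]
  refine tsum_congr fun m => ?_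
  congr 1
  rw [Complex.exp_eq_exp_iff_exists_int]
  exact ⟨m, by push_cast; ring⟩

lemma continuous_fourierSeries {a : ℤ → ℂ} (ha : Summable fun m => ‖a m‖) :
    Continuous (fourierSeries a) :=
  continuous_tsum (fun m => by fun_prop) ha fun m θ => (norm_fourier_term _ _ _).le

lemma hasDerivAt_fourierSeries {a : ℤ → ℂ} (ha : Summable fun m => ‖a m‖)
    (ha' : Summable fun m : ℤ => ‖Complex.I * m * a m‖) (θ : ℝ) :
    HasDerivAt (fourierSeries a) (fourierSeries (fun m => Complex.I * m * a m) θ) θ := by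
  refine hasDerivAt_tsum (g := fun (m : ℤ) (θ : ℝ) =>
      a m * Complex.exp (Complex.I * (m : ℂ) * (θ : ℂ)))
    (g' := fun (m : ℤ) (θ : ℝ) =>
      Complex.I * m * a m * Complex.exp (Complex.I * (m : ℂ) * (θ : ℂ))) ha'
    (fun m y => ?_) (fun m y => (norm_fourier_term _ _ _).le) (y₀ := 0)
    (summable_fourier ha 0) θ
  have h1 : HasDerivAt (fun y : ℝ => Complex.I * (m : ℂ) * (y : ℂ)) (Complex.I * m) y := by
    simpa using (Complex.ofRealCLM.hasDerivAt (x := y)).const_mul (Complex.I * (m : ℂ))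
  exact ((h1.cexp).const_mul (a m)).congr_deriv (by ring)

lemma contDiff_two_of_hasDerivAt {x x' x'' : ℝ → ℝ} (h : ∀ t, HasDerivAt x (x' t) t)
    (h' : ∀ t, HasDerivAt x' (x'' t) t) (hc : Continuous x'') :
    ContDiff ℝ 2 x ∧ ∀ t, iteratedDeriv 2 x t = x'' t := by
  have e1 : deriv x = x' := funext fun t => (h t).deriv
  have e2 : deriv x' = x'' := funext fun t => (h' t).deriv
  constructor
  · rw [show (2 : WithTop ℕ∞) = 1 + 1 by norm_num, contDiff_succ_iff_deriv]
    refine ⟨fun t => (h t).differentiableAt, by simp, ?_⟩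
    rw [e1, contDiff_one_iff_deriv]
    exact ⟨fun t => (h' t).differentiableAt, by rwa [e2]⟩
  · intro t
    rw [iteratedDeriv_succ, iteratedDeriv_one, e1, e2]

/-- Two termwise differentiations; summability with the factor `m²` also controls the factor `m`,
because `|m| ≤ m²` on integers. -/
lemma contDiff_re_fourierSeries {a : ℤ → ℂ} (ha : Summable fun m => ‖a m‖)
    (ha' : Summable fun m : ℤ => ‖(m : ℂ) ^ 2 * a m‖) (s γ c : ℝ) :
    ContDiff ℝ 2 (fun t => c + (fourierSeries a (s + γ * t)).re) ∧
      ∀ t, iteratedDeriv 2 (fun t => c + (fourierSeries a (s + γ * t)).re) t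
        = (fourierSeries (fun m => -(((m : ℂ) * γ) ^ 2 * a m)) (s + γ * t)).re := by
  have h1 : Summable fun m : ℤ => ‖Complex.I * m * a m‖ := by
    refine Summable.of_nonneg_of_le (fun _ => norm_nonneg _) (fun m => ?_) ha'
    simp only [norm_mul, Complex.norm_I, one_mul, norm_pow, Complex.norm_intCast]
    refine mul_le_mul_of_nonneg_right ?_ (norm_nonneg _)
    rcases eq_or_ne m 0 with rfl | hm
    · simp
    · have : (1 : ℝ) ≤ |(m : ℝ)| := by exact_mod_cast Int.one_le_abs hm
      nlinarith
  have h2 : Summable fun m : ℤ => ‖Complex.I * m * (Complex.I * m * a m)‖ := by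
    refine ha'.congr fun m => ?_
    simp only [norm_mul, Complex.norm_I, one_mul, norm_pow, Complex.norm_intCast]; ring
  have hlin : ∀ t, HasDerivAt (fun t : ℝ => s + γ * t) γ t := fun t => by
    simpa using ((hasDerivAt_id t).const_mul γ).const_add s
  have d1 : ∀ t, HasDerivAt (fun t => c + (fourierSeries a (s + γ * t)).re)
      (γ * (fourierSeries (fun m => Complex.I * m * a m) (s + γ * t)).re) t := fun t => by
    have := (hasDerivAt_fourierSeries ha h1 (s + γ * t)).scomp t (hlin t)
    exact ((Complex.reCLM.hasFDerivAt.comp_hasDerivAt t this).const_add c).congr_deriv (by simp)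
  have d2 : ∀ t, HasDerivAt
      (fun t => γ * (fourierSeries (fun m => Complex.I * m * a m) (s + γ * t)).re)
      (fourierSeries (fun m => -(((m : ℂ) * γ) ^ 2 * a m)) (s + γ * t)).re t := fun t => by
    have := (hasDerivAt_fourierSeries h1 h2 (s + γ * t)).scomp t (hlin t)
    refine ((Complex.reCLM.hasFDerivAt.comp_hasDerivAt t this).const_mul γ).congr_deriv ?_
    have e : (fun m : ℤ => -(((m : ℂ) * γ) ^ 2 * a m))
        = fun m : ℤ => ((γ ^ 2 : ℝ) : ℂ) * (Complex.I * m * (Complex.I * m * a m)) := by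
      funext m
      push_cast
      linear_combination (-(γ : ℂ) ^ 2 * m ^ 2 * a m) * Complex.I_sq
    rw [e, fourierSeries_const_mul, Complex.re_ofReal_mul]
    simp; ring
  refine contDiff_two_of_hasDerivAt d1 d2 (Complex.continuous_re.comp
    ((continuous_fourierSeries ?_).comp (by fun_prop)))
  refine (ha'.mul_left (γ ^ 2)).congr fun m => ?_
  simp only [norm_neg, norm_mul, norm_pow, Complex.norm_intCast, Complex.norm_real,
    Real.norm_eq_abs]
  rw [← sq_abs γ]; ring

/-! ### Fixed points -/

lemma exists_fixedPoint_closedBall {X : Type*} [NormedAddCommGroup X] [CompleteSpace X]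
    {f : X → X} {x₀ : X} {r q : ℝ} (hr : 0 ≤ r) (hq0 : 0 ≤ q) (hq : q < 1)
    (hmaps : ∀ x, ‖x - x₀‖ ≤ r → ‖f x - x₀‖ ≤ r)
    (hf : ∀ x y, ‖x - x₀‖ ≤ r → ‖y - x₀‖ ≤ r → ‖f x - f y‖ ≤ q * ‖x - y‖) :
    ∃ x, ‖x - x₀‖ ≤ r ∧ f x = x := by
  have hmaps' : Set.MapsTo f (Metric.closedBall x₀ r) (Metric.closedBall x₀ r) := fun x hx => by
    rw [Metric.mem_closedBall, dist_eq_norm] at hx ⊢; exact hmaps x hx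
  have hc : ContractingWith ⟨q, hq0⟩ (hmaps'.restrict f _ _) := by
    refine ⟨by exact_mod_cast hq, LipschitzWith.of_dist_le_mul fun x y => ?_⟩
    have hx := x.2
    have hy := y.2
    rw [Metric.mem_closedBall, dist_eq_norm] at hx hy
    rw [Subtype.dist_eq, Subtype.dist_eq, dist_eq_norm, dist_eq_norm]
    exact hf _ _ hx hy
  obtain ⟨x, hx, hfx, -⟩ := ContractingWith.exists_fixedPoint' (Metric.isClosed_closedBall.isComplete)
    hmaps' hc (Metric.mem_closedBall_self hr) (edist_ne_top _ _)
  exact ⟨x, by rwa [Metric.mem_closedBall, dist_eq_norm] at hx, hfx⟩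

/-- Lipschitz dependence of fixed points on a parameter. -/
lemma exists_lipschitz_fixedPoint {X : Type*} [NormedAddCommGroup X] [CompleteSpace X]
    {Ψ : ℝ → X → X} {x₀ : X} {a₁ K : ℝ} (ha₁ : 0 < a₁) (hK : 0 < K) (h0 : Ψ 0 x₀ = x₀)
    (hΨ : ∀ a a' x x', 0 ≤ a → a ≤ a₁ → 0 ≤ a' → a' ≤ a₁ → ‖x - x₀‖ ≤ 1 → ‖x' - x₀‖ ≤ 1 →
      ‖Ψ a x - Ψ a' x'‖ ≤ K * (|a - a'| + a' * ‖x - x'‖)) :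
    ∃ a₀, 0 < a₀ ∧ a₀ ≤ a₁ ∧ ∃ φ : ℝ → X, ∀ a, 0 ≤ a → a ≤ a₀ → ‖φ a - x₀‖ ≤ 1 ∧
      Ψ a (φ a) = φ a ∧ ∀ a', 0 ≤ a' → a' ≤ a₀ → ‖φ a - φ a'‖ ≤ 2 * K * |a - a'| := by
  set a₀ := min a₁ (1 / (2 * K)) with ha₀
  have hle : a₀ ≤ a₁ := min_le_left _ _
  have hKa : ∀ {a}, a ≤ a₀ → K * a ≤ 1 / 2 := fun {a} h => by
    have := mul_le_mul_of_nonneg_left (h.trans (min_le_right _ _)) hK.le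
    rwa [show K * (1 / (2 * K)) = 1 / 2 by field_simp] at this
  have hex : ∀ a, 0 ≤ a → a ≤ a₀ → ∃ x, ‖x - x₀‖ ≤ 1 ∧ Ψ a x = x := by
    intro a ha haa
    refine exists_fixedPoint_closedBall (q := 1 / 2) zero_le_one (by norm_num) (by norm_num)
      (fun x hx => ?_) fun x y hx hy => ?_
    -- Comparison with parameter `0` drops the term in `‖x - x₀‖`, so the displacement of `Ψ a x`
    -- from `x₀` is at most `K a ≤ 1/2`.
    · have := hΨ a 0 x x₀ ha (haa.trans hle) le_rfl ha₁.le hx (by simp)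
      rw [h0, sub_zero, abs_of_nonneg ha, zero_mul, add_zero] at this
      exact this.trans ((hKa haa).trans (by norm_num))
    · have := hΨ a a x y ha (haa.trans hle) ha (haa.trans hle) hx hy
      rw [sub_self, abs_zero, zero_add, ← mul_assoc] at this
      exact this.trans (mul_le_mul_of_nonneg_right (hKa haa) (norm_nonneg _))
  choose! φ hφ using hex
  refine ⟨a₀, by positivity, hle, φ, fun a ha haa => ⟨(hφ a ha haa).1, (hφ a ha haa).2, ?_⟩⟩
  intro a' ha' haa'
  have := hΨ a a' (φ a) (φ a') ha (haa.trans hle) ha' (haa'.trans hle) (hφ a ha haa).1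
    (hφ a' ha' haa').1
  rw [(hφ a ha haa).2, (hφ a' ha' haa').2, mul_add, ← mul_assoc] at this
  have h2 := mul_le_mul_of_nonneg_right (hKa haa') (norm_nonneg (φ a - φ a'))
  linarith

/-! ### Dispersion relation -/

/-- `δ_m = -2 + κ m²`. -/
def disp (κ : ℝ) (m : ℤ) : ℝ := -2 + κ * (m : ℝ) ^ 2

lemma disp_neg (κ : ℝ) (m : ℤ) : disp κ (-m) = disp κ m := by simp [disp]

lemma four_le_sq {m : ℤ} (hm : 2 ≤ |m|) : (4 : ℝ) ≤ (m : ℝ) ^ 2 := by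
  have : (2 : ℝ) ≤ |(m : ℝ)| := by exact_mod_cast hm
  rw [← sq_abs]; nlinarith

/-- Since `m² ≥ 4`, the worst value `-4 + κ m²` still dominates `(κ - 1) m²`. This quadratic
coercivity rules out small divisors and supplies the gain of two derivatives. -/
lemma le_disp_add_cos {κ : ℝ} {m : ℤ} (hm : 2 ≤ |m|) (t : ℝ) :
    (κ - 1) * (m : ℝ) ^ 2 ≤ disp κ m + 2 * Real.cos t := by
  have h1 := four_le_sq hm
  have h2 := Real.neg_one_le_cos t
  rw [disp]; nlinarith

lemma disp_add_cos_pos {κ : ℝ} (hκ : 1 < κ) {m : ℤ} (hm : 2 ≤ |m|) (t : ℝ) :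
    0 < disp κ m + 2 * Real.cos t := by
  have h1 := four_le_sq hm
  exact lt_of_lt_of_le (by nlinarith) (le_disp_add_cos hm t)

lemma abs_div_sub_div_le {n n' d d' D K Δ : ℝ} (hD : 0 < D) (hd : D ≤ d) (hd' : D ≤ d')
    (hn : |n - n'| ≤ Δ) (hdd : |d - d'| ≤ Δ) (hK : |n'| ≤ K) :
    |n / d - n' / d'| ≤ Δ / D * (1 + K / D) := by
  have hd0 : 0 < d := hD.trans_le hd
  have hd0' : 0 < d' := hD.trans_le hd'
  have hΔ : 0 ≤ Δ := (abs_nonneg _).trans hn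
  have hK0 : 0 ≤ K := (abs_nonneg _).trans hK
  have e : n / d - n' / d' = (n - n') / d - (d - d') / d * (n' / d') := by field_simp; ring
  have h1 : |(n - n') / d| ≤ Δ / D := by
    rw [abs_div, abs_of_pos hd0]; exact div_le_div₀ hΔ hn hD hd
  have h2 : |(d - d') / d| ≤ Δ / D := by
    rw [abs_div, abs_of_pos hd0]; exact div_le_div₀ hΔ hdd hD hd
  have h3 : |n' / d'| ≤ K / D := by
    rw [abs_div, abs_of_pos hd0']; exact div_le_div₀ hK0 hK hD hd'
  rw [e]
  refine (abs_sub _ _).trans ?_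
  rw [abs_mul, mul_add, mul_one]
  exact add_le_add h1 (mul_le_mul h2 h3 (abs_nonneg _) (by positivity))

lemma abs_cos_sub_cos_le (x y : ℝ) : |Real.cos x - Real.cos y| ≤ |x - y| := by
  simpa [Real.dist_eq] using Real.lipschitzWith_cos.dist_le_mul x y

lemma abs_sin_sub_sin_le (x y : ℝ) : |Real.sin x - Real.sin y| ≤ |x - y| := by
  simpa [Real.dist_eq] using Real.lipschitzWith_sin.dist_le_mul x y

lemma abs_two_cos_sub_le (m : ℤ) (β β' : ℝ) :
    |2 * Real.cos (m * β) - 2 * Real.cos (m * β')| ≤ 2 * |(m : ℝ)| * |β - β'| := by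
  rw [← mul_sub, abs_mul, abs_two, mul_assoc, ← abs_mul, mul_sub]
  exact mul_le_mul_of_nonneg_left (abs_cos_sub_cos_le _ _) zero_le_two

/-- The Fourier multiplier of the travelling wave equation for the force variable. -/
noncomputable def forceMultiplier (κ β : ℝ) (m : ℤ) : ℝ :=
  if 2 ≤ |m| then (2 - 2 * Real.cos (m * β)) / (disp κ m + 2 * Real.cos (m * β)) else 0

/-- The Fourier multiplier of the travelling wave equation for the displacement. -/
noncomputable def shapeMultiplier (κ β : ℝ) (m : ℤ) : ℝ :=
  if 2 ≤ |m| then 2 * Real.sin (m * (β / 2)) / (disp κ m + 2 * Real.cos (m * β)) else 0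

lemma forceMultiplier_neg (κ β : ℝ) (m : ℤ) :
    forceMultiplier κ β (-m) = forceMultiplier κ β m := by
  simp [forceMultiplier, disp_neg]

lemma shapeMultiplier_neg (κ β : ℝ) (m : ℤ) :
    shapeMultiplier κ β (-m) = -shapeMultiplier κ β m := by
  simp only [shapeMultiplier, disp_neg, abs_neg]
  split_ifs
  · simp [neg_div]
  · simp

lemma forceMultiplier_eq (κ β : ℝ) (m : ℤ) :
    forceMultiplier κ β m = 2 * Real.sin (m * (β / 2)) * shapeMultiplier κ β m := by
  simp only [forceMultiplier, shapeMultiplier]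
  split_ifs
  · have : Real.cos (m * β) = 1 - 2 * Real.sin (m * (β / 2)) ^ 2 := by
      rw [show (m : ℝ) * β = 2 * (m * (β / 2)) by ring, Real.cos_two_mul, Real.cos_sq']; ring
    rw [this]; ring
  · simp

lemma abs_le_sq {m : ℤ} (hm : 2 ≤ |m|) : |(m : ℝ)| ≤ (m : ℝ) ^ 2 := by
  have : (2 : ℝ) ≤ |(m : ℝ)| := by exact_mod_cast hm
  rw [← sq_abs]; nlinarith

lemma sq_mul_abs_shapeMultiplier_le {κ : ℝ} (hκ : 1 < κ) (β : ℝ) (m : ℤ) :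
    (m : ℝ) ^ 2 * |shapeMultiplier κ β m| ≤ 2 / (κ - 1) := by
  have hκ' : 0 < κ - 1 := sub_pos.2 hκ
  simp only [shapeMultiplier]
  split_ifs with hm
  · have h4 := four_le_sq hm
    rw [abs_div, abs_of_pos (disp_add_cos_pos hκ hm _)]
    have : |2 * Real.sin (m * (β / 2))| / (disp κ m + 2 * Real.cos (m * β))
        ≤ 2 / ((κ - 1) * (m : ℝ) ^ 2) := by
      refine div_le_div₀ zero_le_two ?_ (by positivity) (le_disp_add_cos hm _)
      rw [abs_mul, abs_two]
      linarith [Real.abs_sin_le_one (m * (β / 2))]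
    refine (mul_le_mul_of_nonneg_left this (by positivity)).trans (le_of_eq ?_)
    have h0 : (m : ℝ) ^ 2 ≠ 0 := by positivity
    generalize (m : ℝ) ^ 2 = t at h0
    field_simp
  · rw [abs_zero, mul_zero]; positivity

lemma abs_forceMultiplier_le {κ : ℝ} (hκ : 1 < κ) (β : ℝ) (m : ℤ) :
    |forceMultiplier κ β m| ≤ 1 / (κ - 1) := by
  have hκ' : 0 < κ - 1 := sub_pos.2 hκ
  by_cases hm : 2 ≤ |m|
  · have h4 := four_le_sq hm
    have h := sq_mul_abs_shapeMultiplier_le hκ β m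
    rw [forceMultiplier_eq, abs_mul, abs_mul, abs_two]
    have h1 := Real.abs_sin_le_one (m * (β / 2))
    have h2 := abs_nonneg (shapeMultiplier κ β m)
    have h3 : 4 * |shapeMultiplier κ β m| ≤ 2 / (κ - 1) := by nlinarith
    have h5 : 2 / (κ - 1) = 2 * (1 / (κ - 1)) := by ring
    nlinarith
  · simp only [forceMultiplier, if_neg hm, abs_zero]; positivity

/-- Varying `β` costs a factor `|m|` in numerator and denominator, which the `m²` in the lower bound
of the denominator pays for. -/
lemma abs_forceMultiplier_sub_le {κ : ℝ} (hκ : 1 < κ) (β β' : ℝ) (m : ℤ) :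
    |forceMultiplier κ β m - forceMultiplier κ β' m|
      ≤ 2 / (κ - 1) * (1 + 4 / (κ - 1)) * |β - β'| := by
  have hκ' : 0 < κ - 1 := sub_pos.2 hκ
  simp only [forceMultiplier]
  split_ifs with hm
  · have h4 := four_le_sq hm
    have h1 := abs_two_cos_sub_le m β β'
    refine (abs_div_sub_div_le (D := (κ - 1) * (m : ℝ) ^ 2) (K := 4) (by positivity)
      (le_disp_add_cos hm _) (le_disp_add_cos hm _) (Δ := 2 * |(m : ℝ)| * |β - β'|)
      ?_ ?_ ?_).trans ?_
    · rw [sub_sub_sub_cancel_left, abs_sub_comm]; exact h1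
    · rw [add_sub_add_left_eq_sub]; exact h1
    · rw [abs_le]
      constructor <;> linarith [Real.neg_one_le_cos (m * β'), Real.cos_le_one (m * β')]
    · have h5 : 2 * |(m : ℝ)| * |β - β'| / ((κ - 1) * (m : ℝ) ^ 2)
          ≤ 2 / (κ - 1) * |β - β'| := by
        rw [div_le_iff₀ (by positivity)]
        have e : 2 / (κ - 1) * |β - β'| * ((κ - 1) * (m : ℝ) ^ 2)
            = 2 * (m : ℝ) ^ 2 * |β - β'| := by field_simp
        rw [e]
        have := abs_le_sq hm
        gcongr
      have h6 : 4 / ((κ - 1) * (m : ℝ) ^ 2) ≤ 4 / (κ - 1) :=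
        div_le_div_of_nonneg_left (by norm_num) hκ' (by nlinarith)
      calc _ ≤ 2 / (κ - 1) * |β - β'| * (1 + 4 / (κ - 1)) := by gcongr
        _ = _ := by ring
  · rw [sub_self, abs_zero]; positivity

lemma abs_shapeMultiplier_sub_le {κ : ℝ} (hκ : 1 < κ) (β β' : ℝ) (m : ℤ) :
    |shapeMultiplier κ β m - shapeMultiplier κ β' m|
      ≤ 2 / (κ - 1) * (1 + 4 / (κ - 1)) * |β - β'| := by
  have hκ' : 0 < κ - 1 := sub_pos.2 hκ
  simp only [shapeMultiplier]
  split_ifs with hm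
  · have h4 := four_le_sq hm
    have h1 := abs_two_cos_sub_le m β β'
    refine (abs_div_sub_div_le (D := (κ - 1) * (m : ℝ) ^ 2) (K := 4) (by positivity)
      (le_disp_add_cos hm _) (le_disp_add_cos hm _) (Δ := 2 * |(m : ℝ)| * |β - β'|)
      ?_ ?_ ?_).trans ?_
    · have := abs_sin_sub_sin_le (m * (β / 2)) (m * (β' / 2))
      rw [← mul_sub, abs_mul, abs_two]
      rw [← mul_sub, abs_mul, ← sub_div, abs_div, abs_two] at this
      nlinarith [mul_nonneg (abs_nonneg (m : ℝ)) (abs_nonneg (β - β'))]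
    · rw [add_sub_add_left_eq_sub]; exact h1
    · rw [abs_mul, abs_two]
      linarith [Real.abs_sin_le_one (m * (β' / 2))]
    · have h5 : 2 * |(m : ℝ)| * |β - β'| / ((κ - 1) * (m : ℝ) ^ 2)
          ≤ 2 / (κ - 1) * |β - β'| := by
        rw [div_le_iff₀ (by positivity)]
        have e : 2 / (κ - 1) * |β - β'| * ((κ - 1) * (m : ℝ) ^ 2)
            = 2 * (m : ℝ) ^ 2 * |β - β'| := by field_simp
        rw [e]
        have := abs_le_sq hm
        gcongr
      have h6 : 4 / ((κ - 1) * (m : ℝ) ^ 2) ≤ 4 / (κ - 1) :=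
        div_le_div_of_nonneg_left (by norm_num) hκ' (by nlinarith)
      calc _ ≤ 2 / (κ - 1) * |β - β'| * (1 + 4 / (κ - 1)) := by gcongr
        _ = _ := by ring
  · rw [sub_self, abs_zero]; positivity

/-- The equation is linear in `cos β`. At `x = 0` it gives `cos β = 1 - κ/2`, which lies strictly
inside `(-1, 1)` because `0 < κ < 4`, so the arccosine is smooth nearby and `sin (β/2)` stays away
from zero. Here `x` stands for `a N₁`. -/
lemma exists_phase {κ : ℝ} (hκ : 1 < κ) (hκ4 : κ < 4) :
    ∃ (b : ℝ → ℝ) (η L s₀ : ℝ), 0 < η ∧ 0 < L ∧ 0 < s₀ ∧ ∀ x, |x| ≤ η →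
      s₀ ≤ Real.sin (b x / 2) ∧
      disp κ 1 + 2 * Real.cos (b x) = x * (2 - 2 * Real.cos (b x)) ∧
      ∀ x', |x'| ≤ η → |b x - b x'| ≤ L * |x - x'| := by
  let y : ℝ → ℝ := fun x => (x - disp κ 1 / 2) / (1 + x)
  have hd : disp κ 1 = -2 + κ := by simp [disp]
  have hy0 : y 0 = 1 - κ / 2 := by simp [y, hd]; ring
  have hyc : ContDiffAt ℝ 1 y 0 := by
    refine ContDiffAt.div (by fun_prop) (by fun_prop) (by norm_num)
  have hbc : ContDiffAt ℝ 1 (fun x => Real.arccos (y x)) 0 := by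
    refine (Real.contDiffAt_arccos ?_ ?_).comp (0 : ℝ) hyc
    · rw [hy0]; intro h; linarith
    · rw [hy0]; intro h; linarith
  obtain ⟨K, t, ht, hK⟩ := hbc.exists_lipschitzOnWith
  have hcont : ContinuousAt (fun x => Real.arccos (y x)) 0 := hbc.continuousAt
  have hsin : 0 < Real.sin (Real.arccos (y 0) / 2) := by
    refine Real.sin_pos_of_pos_of_lt_pi ?_ ?_
    · have : 0 < Real.arccos (y 0) := Real.arccos_pos.2 (by rw [hy0]; linarith)
      linarith
    · linarith [Real.arccos_le_pi (y 0), Real.pi_pos]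
  have e1 : ∀ᶠ x in 𝓝 (0 : ℝ), Real.sin (Real.arccos (y 0) / 2) / 2
      ≤ Real.sin (Real.arccos (y x) / 2) := by
    have : ContinuousAt (fun x => Real.sin (Real.arccos (y x) / 2)) 0 :=
      Real.continuous_sin.continuousAt.comp (hcont.div_const 2)
    filter_upwards [this.eventually (lt_mem_nhds (half_lt_self hsin))] with x hx using hx.le
  have e2 : ∀ᶠ x in 𝓝 (0 : ℝ), -1 ≤ y x ∧ y x ≤ 1 := by
    have h1 := hyc.continuousAt.eventually (lt_mem_nhds (a := -1) (by rw [hy0]; linarith))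
    have h2 := hyc.continuousAt.eventually ((gt_mem_nhds (by rw [hy0]; linarith) :
      ∀ᶠ z in 𝓝 (y 0), z < 1))
    filter_upwards [h1, h2] with x hx hx' using ⟨hx.le, hx'.le⟩
  have e3 : ∀ᶠ x in 𝓝 (0 : ℝ), -1 < x := lt_mem_nhds (by norm_num)
  obtain ⟨η, hη, hall⟩ := Metric.eventually_nhds_iff.1 ((e1.and e2).and (e3.and ht))
  have hall' : ∀ {x}, |x| ≤ η / 2 → _ := fun {x} hx =>
    hall (y := x) (by rw [Real.dist_eq, sub_zero]; linarith)
  refine ⟨fun x => Real.arccos (y x), η / 2, K + 1, Real.sin (Real.arccos (y 0) / 2) / 2,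
    by positivity, by positivity, by positivity, fun x hx => ⟨(hall' hx).1.1, ?_, fun x' hx' => ?_⟩⟩
  · obtain ⟨⟨-, h1, h2⟩, h3, -⟩ := hall' hx
    rw [Real.cos_arccos h1 h2]
    have : (1 + x) ≠ 0 := by linarith
    simp only [y]; field_simp; ring
  · have := hK.dist_le_mul x (hall' hx).2.2 x' (hall' hx').2.2
    rw [Real.dist_eq, Real.dist_eq] at this
    nlinarith [abs_nonneg (x - x')]

/-! ### The rescaled travelling-wave profile. -/

/-- The rescaled force variable of the travelling wave. -/
noncomputable def forceProfile {w : SymmWeight} {κ : ℝ} (hκ : 1 < κ) (a β : ℝ) (N : Wiener w ℝ) :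
    Wiener w ℝ :=
  Wiener.cosine w + a • Wiener.diag (fun m => forceMultiplier κ β m • LinearMap.id) (1 / (κ - 1))
    (fun m x => by
      rw [LinearMap.smul_apply, norm_smul, Real.norm_eq_abs]
      exact mul_le_mul_of_nonneg_right (abs_forceMultiplier_le hκ β m) (norm_nonneg _))
    (fun m x => by simp [forceMultiplier_neg]) N

lemma forceProfile_apply {w : SymmWeight} {κ : ℝ} (hκ : 1 < κ) (a β : ℝ) (N : Wiener w ℝ) (m : ℤ) :
    forceProfile hκ a β N m = (if |m| = 1 then 1 else 0) + a * (forceMultiplier κ β m * N m) := by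
  rw [forceProfile, Wiener.add_apply, Wiener.smul_apply, Wiener.diag_apply, Wiener.cosine_apply]
  simp

lemma norm_forceProfile_le {w : SymmWeight} {κ : ℝ} (hκ : 1 < κ) {a : ℝ} (ha : 0 ≤ a) (β : ℝ)
    (N : Wiener w ℝ) : ‖forceProfile hκ a β N‖ ≤ ‖Wiener.cosine w‖ + a * (1 / (κ - 1) * ‖N‖) := by
  refine (norm_add_le _ _).trans (add_le_add le_rfl ?_)
  rw [norm_smul, Real.norm_of_nonneg ha]
  exact mul_le_mul_of_nonneg_left (Wiener.norm_diag_le _ _ _ _ _) ha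

lemma norm_forceProfile_sub_le {w : SymmWeight} {κ : ℝ} (hκ : 1 < κ) {a a' : ℝ} (ha' : 0 ≤ a')
    (β β' : ℝ) (N N' : Wiener w ℝ) :
    ‖forceProfile hκ a β N - forceProfile hκ a' β' N'‖ ≤
      1 / (κ - 1) * (|a - a'| * ‖N‖ + a' * ‖N - N'‖)
        + 2 / (κ - 1) * (1 + 4 / (κ - 1)) * (a' * |β - β'| * ‖N'‖) := by
  have hκ' : 0 < κ - 1 := sub_pos.2 hκ
  have h := Wiener.norm_le_add (forceProfile hκ a β N - forceProfile hκ a' β' N')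
    ((a - a') • N + a' • (N - N')) N' (c := 1 / (κ - 1))
    (d := 2 / (κ - 1) * (1 + 4 / (κ - 1)) * (a' * |β - β'|)) (fun m => ?_)
  · have h' : ‖(a - a') • N + a' • (N - N')‖ ≤ |a - a'| * ‖N‖ + a' * ‖N - N'‖ := by
      refine (norm_add_le _ _).trans (le_of_eq ?_)
      rw [norm_smul, norm_smul, Real.norm_eq_abs, Real.norm_of_nonneg ha']
    rw [← mul_assoc] at h
    refine h.trans (add_le_add (mul_le_mul_of_nonneg_left h' (by positivity)) (le_of_eq ?_))
    ring
  · have e : (forceProfile hκ a β N - forceProfile hκ a' β' N') m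
        = forceMultiplier κ β m * ((a - a') • N + a' • (N - N')) m
          + (forceMultiplier κ β m - forceMultiplier κ β' m) * a' * N' m := by
      simp only [Wiener.sub_apply, Wiener.add_apply, Wiener.smul_apply, forceProfile_apply,
        smul_eq_mul]
      ring
    rw [e]
    refine (norm_add_le _ _).trans (add_le_add ?_ ?_)
    · rw [norm_mul]
      exact mul_le_mul_of_nonneg_right (abs_forceMultiplier_le hκ β m) (norm_nonneg _)
    · rw [norm_mul, norm_mul, Real.norm_of_nonneg ha']
      refine mul_le_mul_of_nonneg_right ?_ (norm_nonneg _)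
      refine (mul_le_mul_of_nonneg_right (abs_forceMultiplier_sub_le hκ β β' m) ha').trans
        (le_of_eq (by ring))

lemma norm_sq_mul_powerSeries_sub_le {A : Type*} [NormedCommRing A] [NormOneClass A]
    [NormedAlgebra ℝ A] [CompleteSpace A] {k : ℕ → ℝ} {R C M : ℝ} (hR : 0 < R)
    (hb : ∀ x : A, ‖x‖ * R ≤ 1 / 2 → ‖powerSeries k x‖ ≤ C)
    (hl : ∀ x y : A, ‖x‖ * R ≤ 1 / 2 → ‖y‖ * R ≤ 1 / 2 →
        ∃ K, powerSeries k x - powerSeries k y = (x - y) * K ∧ ‖K‖ ≤ C)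
    {a a' : ℝ} {P P' : A} (ha : 0 ≤ a) (ha' : 0 ≤ a') (hP : ‖P‖ ≤ M) (hP' : ‖P'‖ ≤ M)
    (haM : a * M * R ≤ 1 / 2) (haM' : a' * M * R ≤ 1 / 2) :
    ‖P ^ 2 * powerSeries k (a • P) - P' ^ 2 * powerSeries k (a' • P')‖ ≤
      (2 * M * C + M ^ 2 * C * a') * ‖P - P'‖ + M ^ 3 * C * |a - a'| := by
  have hM : 0 ≤ M := (norm_nonneg _).trans hP
  have h1 : ∀ {b : ℝ} {Q : A}, 0 ≤ b → ‖Q‖ ≤ M → b * M * R ≤ 1 / 2 → ‖b • Q‖ * R ≤ 1 / 2 := by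
    intro b Q hb hQ h
    rw [norm_smul, Real.norm_of_nonneg hb]
    exact (by gcongr : b * ‖Q‖ * R ≤ b * M * R).trans h
  obtain ⟨K, hK, hKC⟩ := hl (a • P) (a' • P') (h1 ha hP haM) (h1 ha' hP' haM')
  have e : P ^ 2 * powerSeries k (a • P) - P' ^ 2 * powerSeries k (a' • P')
      = (P - P') * ((P + P') * powerSeries k (a • P)) + P' ^ 2 * ((a • P - a' • P') * K) := by
    rw [← hK]; ring
  have e2 : a • P - a' • P' = (a - a') • P + a' • (P - P') := by
    rw [sub_smul, smul_sub]; abel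
  have h2 : ‖a • P - a' • P'‖ ≤ |a - a'| * M + a' * ‖P - P'‖ := by
    rw [e2]
    refine (norm_add_le _ _).trans ?_
    rw [norm_smul, norm_smul, Real.norm_eq_abs, Real.norm_of_nonneg ha']
    gcongr
  rw [e]
  calc _ ≤ ‖P - P'‖ * ((M + M) * C) + M ^ 2 * ((|a - a'| * M + a' * ‖P - P'‖) * C) := by
        refine (norm_add_le _ _).trans (add_le_add ?_ ?_)
        · refine (norm_mul_le _ _).trans (mul_le_mul_of_nonneg_left ?_ (norm_nonneg _))
          exact (norm_mul_le _ _).trans (mul_le_mul ((norm_add_le _ _).trans (add_le_add hP hP'))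
            (hb _ (h1 ha hP haM)) (norm_nonneg _) (by positivity))
        · refine (norm_mul_le _ _).trans (mul_le_mul ((norm_pow_le _ _).trans
            (pow_le_pow_left₀ (norm_nonneg _) hP' 2)) ?_ (norm_nonneg _) (by positivity))
          exact (norm_mul_le _ _).trans (mul_le_mul h2 hKC (norm_nonneg _) (by positivity))
    _ = _ := by ring

/-- Factoring `a²` out of the remainder desingularizes the bifurcation at zero amplitude: the
fixed-point equation is `N = f₁⁻¹ P² k(aP)`, with `β` eliminated by `exists_phase` evaluated at `a
N₁`. Both `P` and `β` see `N` only through `a N`, which is the structure required by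
`exists_lipschitz_fixedPoint`. -/
theorem exists_travelling_profile (w : SymmWeight) {κ f₁ : ℝ} (hκ : 1 < κ) (hκ4 : κ < 4)
    (hf₁ : 0 < f₁) {k : ℕ → ℝ} {C₀ R : ℝ} (hk : ∀ j, |k j| ≤ C₀ * R ^ j) (hR : 0 < R) :
    ∃ (a₀ C s₀ : ℝ) (β : ℝ → ℝ) (N : ℝ → Wiener w ℝ), 0 < a₀ ∧ 0 < C ∧ 0 < s₀ ∧
      ∀ a, 0 ≤ a → a ≤ a₀ → s₀ ≤ Real.sin (β a / 2) ∧ ‖N a‖ ≤ C ∧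
        disp κ 1 + 2 * Real.cos (β a) = a * N a 1 * (2 - 2 * Real.cos (β a)) ∧
        ‖a • forceProfile hκ a (β a) (N a)‖ * R ≤ 1 / 2 ∧
        remainder k (a • forceProfile hκ a (β a) (N a)) = (f₁ * a ^ 2) • N a ∧
        ∀ a', 0 ≤ a' → a' ≤ a₀ → |β a - β a'| ≤ C * |a - a'| ∧ ‖N a - N a'‖ ≤ C * |a - a'| := by
  have hκ' : 0 < κ - 1 := sub_pos.2 hκ
  obtain ⟨b, η, L, s₀, hη, hL, hs₀, hphase⟩ := exists_phase hκ hκ4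
  obtain ⟨Ck, hCk, hb, hl, -⟩ := exists_powerSeries_bounds (Wiener w ℝ) hk hR
  -- The solution at `a = 0`, where the profile is the pure cosine and only the quadratic term of
  -- the force survives.
  set N₀ : Wiener w ℝ := f₁⁻¹ • (Wiener.cosine w ^ 2 * powerSeries k (0 : Wiener w ℝ)) with hN₀
  set ρ := ‖N₀‖ + 1 with hρ
  have hρ0 : 0 < ρ := by positivity
  set M := ‖Wiener.cosine w‖ + 1 with hM
  have hM0 : 0 < M := by positivity
  set D := 1 / (κ - 1) with hD
  set E := 2 / (κ - 1) * (1 + 4 / (κ - 1)) with hE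
  have hD0 : 0 < D := by positivity
  have hE0 : 0 < E := by positivity
  -- The four bounds give, in order: `a ≤ 1`, `a N₁` in the domain of the phase function, `‖P‖ ≤ M`,
  -- and `aP` within half the convergence scale.
  set a₁ := min (min 1 (η / ρ)) (min (1 / (D * ρ)) (1 / (2 * M * R))) with ha₁
  have ha₁0 : 0 < a₁ := by positivity
  have b1 : ∀ {a}, a ≤ a₁ → a ≤ 1 := fun h => h.trans ((min_le_left _ _).trans (min_le_left _ _))
  have b2 : ∀ {a}, a ≤ a₁ → a * ρ ≤ η := fun h =>
    (le_div_iff₀ hρ0).1 (h.trans ((min_le_left _ _).trans (min_le_right _ _)))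
  have b3 : ∀ {a}, a ≤ a₁ → a * (D * ρ) ≤ 1 := fun h =>
    (le_div_iff₀ (by positivity)).1 (h.trans ((min_le_right _ _).trans (min_le_left _ _)))
  have b4 : ∀ {a}, a ≤ a₁ → a * M * R ≤ 1 / 2 := fun h => by
    have := (le_div_iff₀ (by positivity)).1 (h.trans ((min_le_right _ _).trans (min_le_right _ _)))
    linarith
  have hball : ∀ {N : Wiener w ℝ}, ‖N - N₀‖ ≤ 1 → ‖N‖ ≤ ρ := fun {N} h => by
    have := norm_le_norm_add_norm_sub' N N₀
    rw [hρ]; linarith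
  have hx : ∀ {a} {N : Wiener w ℝ}, 0 ≤ a → a ≤ a₁ → ‖N‖ ≤ ρ → |a * N 1| ≤ η := by
    intro a N ha haa hN
    rw [abs_mul, abs_of_nonneg ha]
    exact (mul_le_mul_of_nonneg_left ((N.norm_apply_le 1).trans hN) ha).trans (b2 haa)
  let P : ℝ → Wiener w ℝ → Wiener w ℝ := fun a N => forceProfile hκ a (b (a * N 1)) N
  have hP : ∀ {a} {N : Wiener w ℝ}, 0 ≤ a → a ≤ a₁ → ‖N‖ ≤ ρ → ‖P a N‖ ≤ M := by
    intro a N ha haa hN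
    refine (norm_forceProfile_le hκ ha _ N).trans (add_le_add le_rfl ?_)
    refine le_trans ?_ (b3 haa)
    gcongr
  have hβ : ∀ {a a'} {N N' : Wiener w ℝ}, 0 ≤ a → a ≤ a₁ → 0 ≤ a' → a' ≤ a₁ → ‖N‖ ≤ ρ →
      ‖N'‖ ≤ ρ → |b (a * N 1) - b (a' * N' 1)| ≤ L * (|a - a'| * ρ + a' * ‖N - N'‖) := by
    intro a a' N N' ha haa ha' haa' hN hN'
    refine ((hphase _ (hx ha haa hN)).2.2 _ (hx ha' haa' hN')).trans
      (mul_le_mul_of_nonneg_left ?_ hL.le)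
    have e : a * N 1 - a' * N' 1 = (a - a') * N 1 + a' * (N - N') 1 := by
      rw [Wiener.sub_apply]; ring
    rw [e]
    refine (abs_add_le _ _).trans ?_
    rw [abs_mul, abs_mul, abs_of_nonneg ha']
    have h1 := (N.norm_apply_le 1).trans hN
    have h2 := (N - N').norm_apply_le 1
    rw [Real.norm_eq_abs] at h1 h2
    gcongr
  have hPsub : ∀ {a a'} {N N' : Wiener w ℝ}, 0 ≤ a → a ≤ a₁ → 0 ≤ a' → a' ≤ a₁ → ‖N‖ ≤ ρ →
      ‖N'‖ ≤ ρ → ‖P a N - P a' N'‖ ≤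
        (D * ρ + D + E * L * ρ * ρ + E * L * ρ) * (|a - a'| + a' * ‖N - N'‖) := by
    intro a a' N N' ha haa ha' haa' hN hN'
    refine (norm_forceProfile_sub_le hκ ha' _ _ N N').trans ?_
    have h1 := hβ ha haa ha' haa' hN hN'
    have h2 := b1 haa'
    have h3 : 0 ≤ ‖N - N'‖ := norm_nonneg _
    have h4 : 0 ≤ |a - a'| := abs_nonneg _
    calc _ ≤ D * (|a - a'| * ρ + a' * ‖N - N'‖)
          + E * (1 * (L * (|a - a'| * ρ + a' * ‖N - N'‖)) * ρ) := by gcongr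
      _ ≤ _ := by
        have : 0 ≤ D * |a - a'| + D * ρ * (a' * ‖N - N'‖) + E * L * ρ * |a - a'|
          + E * L * ρ * ρ * (a' * ‖N - N'‖) := by positivity
        linarith
  set Q := D * ρ + D + E * L * ρ * ρ + E * L * ρ with hQ
  have hQ0 : 0 < Q := by positivity
  let Ψ : ℝ → Wiener w ℝ → Wiener w ℝ := fun a N =>
    f₁⁻¹ • (P a N ^ 2 * powerSeries k (a • P a N))
  have hΨ0 : Ψ 0 N₀ = N₀ := by
    simp only [Ψ, P, forceProfile, zero_smul, add_zero, hN₀]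
  set K := f₁⁻¹ * ((2 * M * Ck + M ^ 2 * Ck) * Q + M ^ 3 * Ck) with hK
  have hK0 : 0 < K := by positivity
  obtain ⟨a₀, ha₀, ha₀₁, N, hN⟩ := exists_lipschitz_fixedPoint (Ψ := Ψ) (x₀ := N₀) (K := K) ha₁0 hK0
    hΨ0 (by
      intro a a' N N' ha haa ha' haa' hN hN'
      have h1 := hball hN
      have h2 := hball hN'
      have h := norm_sq_mul_powerSeries_sub_le hR hb hl ha ha' (hP ha haa h1)
        (hP ha' haa' h2) (b4 haa) (b4 haa')
      simp only [Ψ]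
      rw [← smul_sub, norm_smul, Real.norm_of_nonneg (by positivity), hK, mul_assoc]
      refine mul_le_mul_of_nonneg_left (h.trans ?_) (by positivity)
      have h3 := hPsub ha haa ha' haa' h1 h2
      have h4 := b1 haa'
      calc _ ≤ (2 * M * Ck + M ^ 2 * Ck * 1) * (Q * (|a - a'| + a' * ‖N - N'‖))
            + M ^ 3 * Ck * (|a - a'| + a' * ‖N - N'‖) := by
            have : 0 ≤ a' * ‖N - N'‖ := by positivity
            gcongr
            linarith
        _ = _ := by ring)
  refine ⟨a₀, ρ + L * ρ + L * (2 * K) + 2 * K, s₀, fun a => b (a * N a 1), N, ha₀, by positivity,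
    hs₀, fun a ha haa => ?_⟩
  obtain ⟨h1, h2, h3⟩ := hN a ha haa
  have haa₁ := haa.trans ha₀₁
  have hNρ := hball h1
  obtain ⟨p1, p2, -⟩ := hphase _ (hx ha haa₁ hNρ)
  refine ⟨p1, hNρ.trans ?_, p2, ?_, ?_, fun a' ha' haa' => ?_⟩
  · have : 0 ≤ L * ρ + L * (2 * K) + 2 * K := by positivity
    linarith
  · rw [norm_smul, Real.norm_of_nonneg ha]
    refine le_trans ?_ (b4 haa₁)
    have := hP ha haa₁ hNρ
    gcongr
  · have h5 : N a = f₁⁻¹ • (P a (N a) ^ 2 * powerSeries k (a • P a (N a))) := h2.symm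
    have h6 : (f₁ * a ^ 2) • N a = a ^ 2 • (P a (N a) ^ 2 * powerSeries k (a • P a (N a))) := by
      conv_lhs => rw [h5]
      rw [smul_smul]
      congr 1
      field_simp
    rw [h6, remainder_smul]
  · obtain ⟨h1', -, -⟩ := hN a' ha' haa'
    have h7 := h3 a' ha' haa'
    have h8 := hβ ha haa₁ ha' (haa'.trans ha₀₁) hNρ (hball h1')
    have h9 := b1 (haa'.trans ha₀₁)
    have h10 : 0 ≤ |a - a'| := abs_nonneg _
    constructor
    · refine h8.trans ?_
      calc _ ≤ L * (|a - a'| * ρ + 1 * (2 * K * |a - a'|)) := by gcongr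
        _ ≤ _ := by
          have : 0 ≤ (ρ + 2 * K) * |a - a'| := by positivity
          linarith
    · refine h7.trans ?_
      have : 0 ≤ (ρ + L * ρ + L * (2 * K)) * |a - a'| := by positivity
      linarith

namespace Wiener

variable {w : SymmWeight} {B : Type*} [NormedCommRing B] [NormedAlgebra ℝ B] [StarRing B]
  [NormedStarGroup B] [StarModule ℝ B] [CompleteSpace B]

lemma hasSum_norm (y : Wiener w B) : HasSum (fun m => w m * ‖y m‖) ‖y‖ := by
  rw [norm_eq]; exact y.summable.hasSum

lemma norm_le_of_hasSum (x : Wiener w B) {f : ℤ → ℝ} {s : ℝ}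
    (hf : HasSum (fun m => w m * f m) s) (h : ∀ m, ‖x m‖ ≤ f m) : ‖x‖ ≤ s := by
  rw [norm_eq, ← hf.tsum_eq]
  exact x.summable.tsum_le_tsum (fun m => mul_le_mul_of_nonneg_left (h m) (w.nonneg m)) hf.summable

end Wiener

/-! ### Bounded sequences over the sites and exponential weights. -/

/-- Bounded complex sequences, indexed by the lattice sites. -/
abbrev BddSeq : Type := BoundedContinuousFunction ℕ ℂ

/-- Evaluation of a bounded sequence at a site. -/
noncomputable def siteEval (n : ℕ) : BddSeq →ₐ[ℝ] ℂ :=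
  AlgHom.ofLinearMap { toFun := fun f => f n, map_add' := fun _ _ => rfl, map_smul' := fun _ _ => rfl }
    rfl fun _ _ => rfl

@[simp] lemma siteEval_apply (n : ℕ) (f : BddSeq) : siteEval n f = f n := rfl

lemma norm_siteEval_le (n : ℕ) (f : BddSeq) : ‖siteEval n f‖ ≤ ‖f‖ := f.norm_coe_le_norm n

/-- A bounded sequence from a bound. -/
noncomputable def BddSeq.mk (f : ℕ → ℂ) (C : ℝ) (h : ∀ n, ‖f n‖ ≤ C) : BddSeq :=
  BoundedContinuousFunction.ofNormedAddCommGroupDiscrete f C h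

@[simp] lemma BddSeq.mk_apply (f : ℕ → ℂ) (C : ℝ) (h : ∀ n, ‖f n‖ ≤ C) (n : ℕ) :
    BddSeq.mk f C h n = f n := rfl

lemma BddSeq.norm_mk_le {f : ℕ → ℂ} {C : ℝ} (h : ∀ n, ‖f n‖ ≤ C) : ‖BddSeq.mk f C h‖ ≤ C :=
  (BoundedContinuousFunction.norm_le ((norm_nonneg _).trans (h 0))).2 h

/-- The sequence `e^{-τ n}`, as an element of the Wiener algebra. -/
noncomputable def decay (w : SymmWeight) {τ : ℝ} (hτ : 0 ≤ τ) : Wiener w BddSeq :=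
  Wiener.const (BddSeq.mk (fun n => (Real.exp (-τ * n) : ℝ)) 1 fun n => by
    rw [Complex.norm_real, Real.norm_of_nonneg (Real.exp_pos _).le, Real.exp_le_one_iff]
    have : 0 ≤ τ * n := by positivity
    linarith) (by ext n; simp [Complex.conj_ofReal, ← Complex.exp_conj])

lemma decay_mul_apply {w : SymmWeight} {τ : ℝ} (hτ : 0 ≤ τ) (a : Wiener w BddSeq) (m : ℤ) (n : ℕ) :
    (decay w hτ * a) m n = (Real.exp (-τ * n) : ℝ) * a m n := by
  rw [decay, Wiener.const_mul_apply]; rfl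

lemma norm_decay_mul_le {w : SymmWeight} {τ : ℝ} (hτ : 0 ≤ τ) (a : Wiener w BddSeq) :
    ‖decay w hτ * a‖ ≤ ‖a‖ := by
  refine (Wiener.norm_const_mul_le _ _ a).trans (mul_le_of_le_one_left (norm_nonneg _) ?_)
  exact BddSeq.norm_mk_le _

/-! ### Displacement coefficients of the wave. -/

section Shape

variable {κ : ℝ}

/-- The coefficients of the travelling wave, up to the phase and the amplitude. -/
noncomputable def shape (κ a β : ℝ) (N : ℤ → ℝ) (m : ℤ) : ℝ :=
  (if |m| = 1 then (m : ℝ) / (2 * Real.sin (β / 2)) else 0) + a * (shapeMultiplier κ β m * N m)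

lemma shape_zero (κ a β : ℝ) (N : ℤ → ℝ) : shape κ a β N 0 = 0 := by
  simp [shape, shapeMultiplier]

lemma shape_one (κ a β : ℝ) (N : ℤ → ℝ) : shape κ a β N 1 = 1 / (2 * Real.sin (β / 2)) := by
  simp [shape, shapeMultiplier]

lemma shape_neg {N : ℤ → ℝ} (hN : ∀ m, N (-m) = N m) (κ a β : ℝ) (m : ℤ) :
    shape κ a β N (-m) = -shape κ a β N m := by
  simp only [shape, abs_neg, shapeMultiplier_neg, hN]
  split_ifs
  · push_cast; ring
  · ring

/-- Taking the centred neighbour difference multiplies mode `m` by `2 sin (mβ/2)`, up to a power of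
`i`; the right-hand side is the coefficient of the force profile. Thus `shape` is a discrete
primitive of that profile. -/
lemma two_sin_mul_shape {β : ℝ} (hs : Real.sin (β / 2) ≠ 0) (a : ℝ) (N : ℤ → ℝ) (m : ℤ) :
    2 * Real.sin (m * (β / 2)) * shape κ a β N m
      = (if |m| = 1 then 1 else 0) + a * (forceMultiplier κ β m * N m) := by
  rw [shape, forceMultiplier_eq]
  split_ifs with h
  · rcases (abs_eq zero_le_one).1 h with rfl | rfl
    · simp only [Int.cast_one, one_mul]; field_simp
    · simp only [Int.cast_neg, Int.cast_one, neg_mul, one_mul, Real.sin_neg]; field_simp; ring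
  · ring

/-- For `|m| ≥ 2` this is the definition of the multiplier, for `m = ±1` it is the phase equation
`h1`, and for `m = 0` both sides vanish. -/
lemma disp_mul_shape (hκ : 1 < κ) {a β : ℝ} {N : ℤ → ℝ} (hs : Real.sin (β / 2) ≠ 0)
    (hN : ∀ m, N (-m) = N m)
    (h1 : disp κ 1 + 2 * Real.cos β = a * N 1 * (2 - 2 * Real.cos β)) (m : ℤ) :
    (disp κ m + 2 * Real.cos (m * β)) * shape κ a β N m = a * (2 * Real.sin (m * (β / 2)) * N m) := by
  have key : (disp κ 1 + 2 * Real.cos β) * shape κ a β N 1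
      = a * (2 * Real.sin (β / 2) * N 1) := by
    have : Real.cos β = 1 - 2 * Real.sin (β / 2) ^ 2 := by
      rw [show β = 2 * (β / 2) by ring, Real.cos_two_mul, Real.cos_sq']; ring_nf
    rw [h1, shape_one, this]; field_simp; ring
  by_cases hm : 2 ≤ |m|
  · have h0 := (disp_add_cos_pos hκ hm (m * β)).ne'
    have h2 : ¬ |m| = 1 := by omega
    simp only [shape, shapeMultiplier, if_neg h2, if_pos hm]
    field_simp; ring
  · have : m = 0 ∨ m = 1 ∨ m = -1 := by
      have := abs_lt.1 (not_le.1 hm); omega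
    rcases this with rfl | rfl | rfl
    · rw [shape_zero]; simp
    · simpa using key
    · rw [shape_neg hN, disp_neg, hN]
      simp only [Int.cast_neg, Int.cast_one, neg_mul, one_mul, Real.sin_neg, Real.cos_neg]
      linarith

lemma sq_mul_abs_shape_le (hκ : 1 < κ) {a β s₀ : ℝ} (ha : 0 ≤ a) (hs₀ : 0 < s₀)
    (hs : s₀ ≤ Real.sin (β / 2)) (N : ℤ → ℝ) (m : ℤ) :
    (m : ℝ) ^ 2 * |shape κ a β N m| ≤
      1 / (2 * s₀) * (if |m| = 1 then 1 else 0) + a * (2 / (κ - 1)) * |N m| := by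
  have hsp := hs₀.trans_le hs
  have h1 : (m : ℝ) ^ 2 * |if |m| = 1 then (m : ℝ) / (2 * Real.sin (β / 2)) else 0|
      ≤ 1 / (2 * s₀) * (if |m| = 1 then 1 else 0) := by
    split_ifs with h
    · have : |(m : ℝ)| = 1 := by exact_mod_cast h
      rw [← sq_abs, abs_div, this, abs_of_pos (by positivity : 0 < 2 * Real.sin (β / 2))]
      simp only [one_pow, one_mul, mul_one]
      gcongr
    · simp
  have h2 : (m : ℝ) ^ 2 * |a * (shapeMultiplier κ β m * N m)| ≤ a * (2 / (κ - 1)) * |N m| := by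
    rw [abs_mul, abs_mul, abs_of_nonneg ha]
    calc _ = a * ((m : ℝ) ^ 2 * |shapeMultiplier κ β m|) * |N m| := by ring
      _ ≤ _ := by
        have := sq_mul_abs_shapeMultiplier_le hκ β m
        gcongr
  rw [shape]
  refine (mul_le_mul_of_nonneg_left (abs_add_le _ _) (by positivity)).trans ?_
  rw [mul_add]
  exact add_le_add h1 h2

lemma abs_cast_le_sq (m : ℤ) : |(m : ℝ)| ≤ (m : ℝ) ^ 2 := by
  rcases eq_or_ne m 0 with rfl | hm
  · simp
  · have : (1 : ℝ) ≤ |(m : ℝ)| := by exact_mod_cast Int.one_le_abs hm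
    rw [← sq_abs]; nlinarith

lemma abs_shape_le_sq (κ a β : ℝ) (N : ℤ → ℝ) (m : ℤ) :
    |shape κ a β N m| ≤ (m : ℝ) ^ 2 * |shape κ a β N m| := by
  rcases eq_or_ne m 0 with rfl | hm
  · simp [shape_zero]
  · have : (1 : ℝ) ≤ |(m : ℝ)| := by exact_mod_cast Int.one_le_abs hm
    refine le_mul_of_one_le_left (abs_nonneg _) ?_
    rw [← sq_abs]; nlinarith

lemma abs_shape_sub_le (hκ : 1 < κ) {a a' β β' s₀ : ℝ} (ha' : 0 ≤ a') (hs₀ : 0 < s₀)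
    (hs : s₀ ≤ Real.sin (β / 2)) (hs' : s₀ ≤ Real.sin (β' / 2)) (N N' : ℤ → ℝ) (m : ℤ) :
    |shape κ a β N m - shape κ a' β' N' m| ≤
      |β - β'| / (4 * s₀ ^ 2) * (if |m| = 1 then 1 else 0) +
      ((|a - a'| * (2 / (κ - 1)) + a' * (2 / (κ - 1) * (1 + 4 / (κ - 1)) * |β - β'|)) * |N m|
        + a' * (2 / (κ - 1)) * |N m - N' m|) := by
  have hsp := hs₀.trans_le hs
  have hsp' := hs₀.trans_le hs'
  have hκ' : 0 < κ - 1 := sub_pos.2 hκ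
  have hμ : ∀ b, |shapeMultiplier κ b m| ≤ 2 / (κ - 1) := fun b => by
    by_cases hm : 2 ≤ |m|
    · refine le_trans ?_ (sq_mul_abs_shapeMultiplier_le hκ b m)
      exact le_mul_of_one_le_left (abs_nonneg _) (by linarith [four_le_sq hm])
    · simp only [shapeMultiplier, if_neg hm, abs_zero]; positivity
  have e : shape κ a β N m - shape κ a' β' N' m =
      ((if |m| = 1 then (m : ℝ) / (2 * Real.sin (β / 2)) else 0)
        - (if |m| = 1 then (m : ℝ) / (2 * Real.sin (β' / 2)) else 0))
      + (((a - a') * shapeMultiplier κ β m + a' * (shapeMultiplier κ β m - shapeMultiplier κ β' m))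
          * N m + a' * shapeMultiplier κ β' m * (N m - N' m)) := by
    rw [shape, shape]; ring
  rw [e]
  refine (abs_add_le _ _).trans (add_le_add ?_ ((abs_add_le _ _).trans (add_le_add ?_ ?_)))
  · split_ifs with h
    · have hm : |(m : ℝ)| = 1 := by exact_mod_cast h
      have e2 : (m : ℝ) / (2 * Real.sin (β / 2)) - m / (2 * Real.sin (β' / 2))
          = m * (Real.sin (β' / 2) - Real.sin (β / 2)) /
            (2 * (Real.sin (β / 2) * Real.sin (β' / 2))) := by
        field_simp
      rw [e2, abs_div, abs_mul, hm, one_mul, mul_one,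
        abs_of_pos (by positivity : 0 < 2 * (Real.sin (β / 2) * Real.sin (β' / 2))),
        div_le_div_iff₀ (by positivity) (by positivity)]
      have h3 := abs_sin_sub_sin_le (β' / 2) (β / 2)
      rw [← sub_div, abs_div, abs_two, abs_sub_comm β'] at h3
      have h4 : s₀ ^ 2 ≤ Real.sin (β / 2) * Real.sin (β' / 2) := by rw [sq]; gcongr
      calc _ ≤ |β - β'| / 2 * (4 * (Real.sin (β / 2) * Real.sin (β' / 2))) := by gcongr
        _ = _ := by ring
    · simp
  · rw [abs_mul]
    refine mul_le_mul_of_nonneg_right ((abs_add_le _ _).trans (add_le_add ?_ ?_)) (abs_nonneg _)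
    · rw [abs_mul]
      exact mul_le_mul_of_nonneg_left (hμ _) (abs_nonneg _)
    · rw [abs_mul, abs_of_nonneg ha']
      exact mul_le_mul_of_nonneg_left (abs_shapeMultiplier_sub_le hκ β β' m) ha'
  · rw [abs_mul, abs_mul, abs_of_nonneg ha']
    exact mul_le_mul_of_nonneg_right (mul_le_mul_of_nonneg_left (hμ _) ha') (abs_nonneg _)

end Shape

/-! ### The travelling wave equation -/

lemma fourierSeries_sub_shift {A : ℤ → ℂ} (hA : Summable fun m => ‖A m‖) (s θ : ℝ) :
    fourierSeries A (θ - s) - fourierSeries A (θ + s)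
      = fourierSeries (fun m => A m * (-2 * Complex.I * Real.sin (m * s))) θ := by
  rw [fourierSeries, fourierSeries, ← (summable_fourier hA _).tsum_sub (summable_fourier hA _),
    fourierSeries]
  refine tsum_congr fun m => ?_
  have e1 : Complex.exp (Complex.I * m * ((θ - s : ℝ) : ℂ))
      = Complex.exp (Complex.I * m * θ) * Complex.exp (-(m * s : ℂ) * Complex.I) := by
    rw [← Complex.exp_add]; congr 1; push_cast; ring
  have e2 : Complex.exp (Complex.I * m * ((θ + s : ℝ) : ℂ))
      = Complex.exp (Complex.I * m * θ) * Complex.exp ((m * s : ℂ) * Complex.I) := by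
    rw [← Complex.exp_add]; congr 1; push_cast; ring
  have e3 : (Real.sin (m * s) : ℂ) = (Complex.exp (-(m * s : ℂ) * Complex.I)
      - Complex.exp ((m * s : ℂ) * Complex.I)) * Complex.I / 2 := by
    push_cast; rw [Complex.sin]
  rw [e1, e2, e3]
  linear_combination (A m * Complex.exp (Complex.I * m * θ) *
    (Complex.exp (-(m * s : ℂ) * Complex.I) - Complex.exp ((m * s : ℂ) * Complex.I))) * Complex.I_sq

/-- Fourier coefficients of the travelling wave with amplitude `a` and phase `θ₀`. -/
noncomputable def waveCoeff (κ a β θ₀ : ℝ) (N : ℤ → ℝ) (m : ℤ) : ℂ :=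
  Complex.I * ((a * shape κ a β N m : ℝ) : ℂ) * Complex.exp (Complex.I * m * θ₀)

lemma norm_waveCoeff {κ a β θ₀ : ℝ} (ha : 0 ≤ a) (N : ℤ → ℝ) (m : ℤ) :
    ‖waveCoeff κ a β θ₀ N m‖ = a * |shape κ a β N m| := by
  rw [waveCoeff, norm_fourier_term, norm_mul, Complex.norm_I, one_mul, Complex.norm_real,
    Real.norm_eq_abs, abs_mul, abs_of_nonneg ha]

lemma waveCoeff_neg {κ a β θ₀ : ℝ} {N : ℤ → ℝ} (hN : ∀ m, N (-m) = N m) (m : ℤ) :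
    waveCoeff κ a β θ₀ N (-m) = (starRingEnd ℂ) (waveCoeff κ a β θ₀ N m) := by
  rw [waveCoeff, waveCoeff, shape_neg hN, map_mul, map_mul, ← Complex.exp_conj]
  simp

/-- The differences to the left and right neighbours are the same profile `p` evaluated at phases
shifted by `∓β/2`. Hence the force is a half-shift difference of `f₁ p + g(p)`, the constant `F(-c)`
cancelling, and the equation reduces to `disp_mul_shape` mode by mode. -/
theorem travelling_wave_motion {F : ℝ → ℝ} {c γ κ f₁ : ℝ} (hκ : 1 < κ)
    (hγκ : γ ^ 2 = f₁ * κ) {k : ℕ → ℝ} {C₀ R : ℝ} (hk : ∀ j, |k j| ≤ C₀ * R ^ j) (hR : 0 < R)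
    (hF : ∀ y : ℝ, |y| * R ≤ 1 / 2 → F (-c + y) = F (-c) + f₁ * y + remainder k y)
    {w : SymmWeight} {a β s₀ : ℝ} {N : Wiener w ℝ} (ha : 0 ≤ a) (hs₀ : 0 < s₀)
    (hs : s₀ ≤ Real.sin (β / 2))
    (h1 : disp κ 1 + 2 * Real.cos β = a * N 1 * (2 - 2 * Real.cos β))
    (hsmall : ‖a • forceProfile hκ a β N‖ * R ≤ 1 / 2)
    (hrem : remainder k (a • forceProfile hκ a β N) = (f₁ * a ^ 2) • N) (θ₀ : ℝ) (n : ℤ) :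
    EqOfMotion F
      (fun t => c * ((n - 1 : ℤ) : ℝ)
        + (fourierSeries (waveCoeff κ a β θ₀ N) (β * ((n - 1 : ℤ) : ℝ) + γ * t)).re)
      (fun t => c * (n : ℝ) + (fourierSeries (waveCoeff κ a β θ₀ N) (β * (n : ℝ) + γ * t)).re)
      (fun t => c * ((n + 1 : ℤ) : ℝ)
        + (fourierSeries (waveCoeff κ a β θ₀ N) (β * ((n + 1 : ℤ) : ℝ) + γ * t)).re) := by
  have hNeven : ∀ m, N (-m) = N m := fun m => by rw [Wiener.apply_neg]; rfl
  have hs0 : Real.sin (β / 2) ≠ 0 := (hs₀.trans_le hs).ne'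
  set r := waveCoeff κ a β θ₀ N with hr
  set p := a • forceProfile hκ a β N with hp
  have hsumb : Summable fun m : ℤ => a * (1 / (2 * s₀) * ‖Wiener.cosine w m‖
      + a * (2 / (κ - 1)) * ‖N m‖) :=
    (((Wiener.cosine w).summable_norm.mul_left _).add (N.summable_norm.mul_left _)).mul_left _
  have hbd : ∀ m : ℤ, (m : ℝ) ^ 2 * ‖r m‖ ≤ a * (1 / (2 * s₀) * ‖Wiener.cosine w m‖
      + a * (2 / (κ - 1)) * ‖N m‖) := fun m => by
    rw [hr, norm_waveCoeff ha, Wiener.cosine_apply, mul_left_comm]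
    refine mul_le_mul_of_nonneg_left ((sq_mul_abs_shape_le hκ ha hs₀ hs N m).trans (le_of_eq ?_)) ha
    split_ifs <;> simp
  have hr2 : Summable fun m : ℤ => ‖(m : ℂ) ^ 2 * r m‖ := by
    refine Summable.of_nonneg_of_le (fun _ => norm_nonneg _) (fun m => ?_) hsumb
    rw [norm_mul, norm_pow, Complex.norm_intCast, sq_abs]
    exact hbd m
  have hr1 : Summable fun m : ℤ => ‖r m‖ := by
    refine Summable.of_nonneg_of_le (fun _ => norm_nonneg _) (fun m => le_trans ?_ (hbd m)) hsumb
    rw [hr, norm_waveCoeff ha, mul_left_comm]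
    exact mul_le_mul_of_nonneg_left (abs_shape_le_sq _ _ _ _ _) ha
  have hψ : ∀ x : ℝ, ‖Complex.ofRealAm x‖ ≤ ‖x‖ := fun x => by simp
  have hstar : ∀ x : ℝ, Complex.ofRealAm (star x) = (starRingEnd ℂ) (Complex.ofRealAm x) :=
    fun x => by simp
  let ev : ℝ → Wiener w ℝ →ₐ[ℝ] ℂ := Wiener.eval Complex.ofRealAm hψ
  have hpsin : ∀ m, p m = a * (2 * Real.sin (m * (β / 2)) * shape κ a β N m) := fun m => by
    rw [two_sin_mul_shape hs0, hp, Wiener.smul_apply, forceProfile_apply, smul_eq_mul]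
  -- the difference of neighbours is the force profile
  have hdiff : ∀ θ : ℝ, fourierSeries r (θ - β / 2) - fourierSeries r (θ + β / 2) = ev (θ + θ₀) p := by
    intro θ
    rw [fourierSeries_sub_shift hr1, Wiener.eval_apply, add_comm, ← fourierSeries_shift]
    congr 1
    funext m
    rw [hr, waveCoeff, Complex.ofRealAm_coe, hpsin]
    push_cast
    linear_combination (-2 * (a : ℂ) * (shape κ a β N m) * Complex.exp (Complex.I * m * θ₀)
      * Complex.sin (m * (β / 2))) * Complex.I_sq
  have hreal : ∀ θ : ℝ, (((ev θ p).re : ℝ) : ℂ) = ev θ p := fun θ => Wiener.conj_eval hstar p θ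
  have hevF : ∀ θ : ℝ, (F (-c + (ev θ p).re) : ℂ)
      = F (-c) + f₁ * ev θ p + (f₁ * a ^ 2 : ℝ) * ev θ N := by
    intro θ
    have hb : |(ev θ p).re| * R ≤ 1 / 2 := by
      refine (mul_le_mul_of_nonneg_right ?_ hR.le).trans hsmall
      exact (Complex.abs_re_le_norm _).trans (Wiener.norm_eval_le _ _ _ _)
    rw [hF _ hb]
    have h2 := map_remainder hk hR (ev θ) (Wiener.norm_eval_le _ hψ θ) hsmall (hreal θ).symm
    rw [hrem, map_smul, Complex.real_smul] at h2
    push_cast at h2 ⊢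
    rw [← h2, hreal]
  obtain ⟨hC, hD⟩ := contDiff_re_fourierSeries hr1 hr2 (β * n) γ (c * n)
  refine ⟨hC, fun t => ?_⟩
  rw [hD]
  set θ := β * n + γ * t with hθ
  have eL : c * ((n - 1 : ℤ) : ℝ) + (fourierSeries r (β * ((n - 1 : ℤ) : ℝ) + γ * t)).re
      - (c * n + (fourierSeries r θ).re) = -c + (ev (θ - β / 2 + θ₀) p).re := by
    rw [← hdiff, Complex.sub_re]
    push_cast
    rw [show β * ((n : ℝ) - 1) + γ * t = θ - β / 2 - β / 2 by rw [hθ]; ring,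
      show θ - β / 2 + β / 2 = θ by ring]
    ring
  have eR : c * n + (fourierSeries r θ).re
      - (c * ((n + 1 : ℤ) : ℝ) + (fourierSeries r (β * ((n + 1 : ℤ) : ℝ) + γ * t)).re)
      = -c + (ev (θ + β / 2 + θ₀) p).re := by
    rw [← hdiff, Complex.sub_re]
    push_cast
    rw [show β * ((n : ℝ) + 1) + γ * t = θ + β / 2 + β / 2 by rw [hθ]; ring,
      show θ + β / 2 - β / 2 = θ by ring]
    ring
  rw [eL, eR, ← Complex.ofReal_inj, Complex.ofReal_sub, hevF, hevF]
  have hshift : ∀ x : Wiener w ℝ, ev (θ - β / 2 + θ₀) x - ev (θ + β / 2 + θ₀) x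
      = fourierSeries (fun m => (x m : ℂ) * (-2 * Complex.I * Real.sin (m * (β / 2)))
        * Complex.exp (Complex.I * m * θ₀)) θ := by
    intro x
    have hx : Summable fun m : ℤ => ‖((x m : ℝ) : ℂ)‖ := by simpa using x.summable_norm
    rw [fourierSeries_shift, ← fourierSeries_sub_shift hx, Wiener.eval_apply, Wiener.eval_apply]
    simp only [Complex.ofRealAm_coe]
    congr 2 <;> ring
  have hsx : ∀ x : Wiener w ℝ, Summable fun m : ℤ => ‖(x m : ℂ) *
      (-2 * Complex.I * Real.sin (m * (β / 2))) * Complex.exp (Complex.I * m * θ₀)‖ := by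
    intro x
    refine Summable.of_nonneg_of_le (fun _ => norm_nonneg _) (fun m => ?_)
      (x.summable_norm.mul_right 2)
    rw [norm_fourier_term, norm_mul, norm_mul, norm_mul, Complex.norm_real, Complex.norm_real,
      Complex.norm_I, Real.norm_eq_abs (Real.sin _)]
    refine mul_le_mul_of_nonneg_left ?_ (norm_nonneg _)
    simpa using Real.abs_sin_le_one (m * (β / 2))
  have hconj : ∀ m, -(((((-m : ℤ)) : ℂ) * γ) ^ 2 * r (-m))
      = (starRingEnd ℂ) (-(((m : ℂ) * γ) ^ 2 * r m)) := fun m => by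
    rw [hr, waveCoeff_neg hNeven]; simp
  rw [ofReal_re_fourierSeries hconj]
  calc fourierSeries (fun m => -(((m : ℂ) * γ) ^ 2 * r m)) θ
      = (f₁ : ℂ) * (ev (θ - β / 2 + θ₀) p - ev (θ + β / 2 + θ₀) p) + (f₁ * a ^ 2 : ℝ) *
        (ev (θ - β / 2 + θ₀) N - ev (θ + β / 2 + θ₀) N) := by
        rw [hshift, hshift, ← fourierSeries_const_mul, ← fourierSeries_const_mul,
          ← fourierSeries_add]
        · congr 1
          funext m
          have h3 := disp_mul_shape hκ hs0 hNeven h1 m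
          have hcos : Real.cos (m * β) = 1 - 2 * Real.sin (m * (β / 2)) ^ 2 := by
            rw [show (m : ℝ) * β = 2 * (m * (β / 2)) by ring, Real.cos_two_mul, Real.cos_sq']; ring
          -- The equation of motion for mode `m`, stripped of the common phase factor:
          -- `disp_mul_shape` with `cos (mβ)` written through `sin² (mβ/2)`.
          have h4 : (m * γ) ^ 2 * (a * shape κ a β N m) = f₁ * (p m * (2 * Real.sin (m * (β / 2))))
              + f₁ * a ^ 2 * (N m * (2 * Real.sin (m * (β / 2)))) := by
            rw [hpsin, mul_pow, hγκ]
            rw [hcos, disp] at h3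
            linear_combination f₁ * a * h3
          have h5 : ((m : ℂ) * γ) ^ 2 * (a * shape κ a β N m : ℝ)
              = f₁ * (p m * (2 * Real.sin (m * (β / 2))))
              + f₁ * a ^ 2 * (N m * (2 * Real.sin (m * (β / 2)))) := by exact_mod_cast h4
          rw [hr, waveCoeff]
          push_cast at h5 ⊢
          linear_combination (-Complex.I * Complex.exp (Complex.I * m * θ₀)) * h5
        · simpa only [norm_mul] using (hsx p).mul_left ‖(f₁ : ℂ)‖
        · simpa only [norm_mul] using (hsx N).mul_left ‖((f₁ * a ^ 2 : ℝ) : ℂ)‖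
    _ = _ := by ring

/-! ### Lipschitz dependence of the waves on the complex amplitude, in a decaying weight. -/

lemma norm_pow_mul_sub_le {z z' : ℂ} (hz : ‖z‖ ≤ 1) (hz' : ‖z'‖ ≤ 1) (j : ℕ) :
    ‖z ^ j - z' ^ j‖ ≤ j * ‖z - z'‖ := by
  rw [pow_sub_pow_eq_divDiff, norm_mul, mul_comm]
  refine mul_le_mul_of_nonneg_right ?_ (norm_nonneg _)
  simpa using norm_divDiff_le hz hz' j

lemma norm_exp_int_mul_sub_le (m : ℤ) (x y : ℝ) :
    ‖Complex.exp (Complex.I * m * x) - Complex.exp (Complex.I * m * y)‖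
      ≤ |(m : ℝ)| * ‖Complex.exp (Complex.I * x) - Complex.exp (Complex.I * y)‖ := by
  have hn : ∀ x : ℝ, ‖Complex.exp (Complex.I * x)‖ = 1 := fun x => by
    rw [mul_comm, Complex.norm_exp_ofReal_mul_I]
  have hpos : ∀ j : ℕ, ‖Complex.exp (Complex.I * (j : ℂ) * x) - Complex.exp (Complex.I * (j : ℂ) * y)‖
      ≤ j * ‖Complex.exp (Complex.I * x) - Complex.exp (Complex.I * y)‖ := fun j => by
    have e : ∀ x : ℝ, Complex.exp (Complex.I * (j : ℂ) * x) = Complex.exp (Complex.I * x) ^ j :=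
      fun x => by rw [← Complex.exp_nat_mul]; congr 1; ring
    rw [e, e]
    exact norm_pow_mul_sub_le (hn x).le (hn y).le j
  obtain ⟨j, rfl | rfl⟩ := m.eq_nat_or_neg
  · simpa using hpos j
  · have e : ∀ x : ℝ, Complex.exp (Complex.I * ((-(j : ℤ) : ℤ) : ℂ) * x)
        = (starRingEnd ℂ) (Complex.exp (Complex.I * (j : ℂ) * x)) := fun x => by
      rw [← Complex.exp_conj]; simp
    rw [e, e, ← map_sub, RCLike.norm_conj]
    simpa using hpos j

lemma norm_exp_sub_exp_le (x y : ℝ) :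
    ‖Complex.exp (Complex.I * x) - Complex.exp (Complex.I * y)‖ ≤ |x - y| := by
  have e : Complex.exp (Complex.I * x) - Complex.exp (Complex.I * y)
      = Complex.exp (Complex.I * y) * (Complex.exp (Complex.I * ((x - y : ℝ) : ℂ)) - 1) := by
    rw [mul_sub, ← Complex.exp_add]; congr 2
    · push_cast; ring
    · ring
  rw [e, norm_mul, mul_comm Complex.I (y : ℂ), Complex.norm_exp_ofReal_mul_I, one_mul]
  exact Real.norm_exp_I_mul_ofReal_sub_one_le

/-- The argument is discontinuous on the negative axis and singular at the origin, but modulus times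
unit phase is just `z`. The factor `‖z'‖` compensates, which makes polar parameters usable for a
Lipschitz family in `z`. -/
lemma mul_norm_exp_arg_sub_le (z z' : ℂ) :
    ‖z'‖ * ‖Complex.exp (Complex.I * z.arg) - Complex.exp (Complex.I * z'.arg)‖
      ≤ 2 * ‖z - z'‖ := by
  have h : ∀ z : ℂ, (‖z‖ : ℂ) * Complex.exp (Complex.I * z.arg) = z := fun z => by
    rw [mul_comm Complex.I]; exact Complex.norm_mul_exp_arg_mul_I z
  have e : (‖z'‖ : ℂ) * (Complex.exp (Complex.I * z.arg) - Complex.exp (Complex.I * z'.arg))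
      = (z - z') - ((‖z‖ - ‖z'‖ : ℝ) : ℂ) * Complex.exp (Complex.I * z.arg) := by
    push_cast
    linear_combination (-1 : ℂ) * h z' + h z
  have e' : ‖z'‖ * ‖Complex.exp (Complex.I * z.arg) - Complex.exp (Complex.I * z'.arg)‖
      = ‖(‖z'‖ : ℂ) * (Complex.exp (Complex.I * z.arg) - Complex.exp (Complex.I * z'.arg))‖ := by
    rw [norm_mul, Complex.norm_real, norm_norm]
  rw [e', e]
  refine (norm_sub_le _ _).trans ?_
  rw [norm_mul, mul_comm Complex.I, Complex.norm_exp_ofReal_mul_I, mul_one, Complex.norm_real,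
    Real.norm_eq_abs, two_mul]
  exact add_le_add le_rfl (abs_norm_sub_norm_le z z')

/-- This pays for the factor `n` produced by varying `β` in `e^{iβmn}`, and is the reason for a
second, weaker weight. -/
lemma nat_mul_exp_neg_le {τ : ℝ} (hτ : 0 < τ) (n : ℕ) : n * Real.exp (-τ * n) ≤ 1 / τ := by
  have h1 := Real.add_one_le_exp (τ * n)
  have h2 : Real.exp (-τ * n) * Real.exp (τ * n) = 1 := by rw [← Real.exp_add]; simp
  have h3 := Real.exp_pos (-τ * n)
  rw [le_div_iff₀ hτ]
  nlinarith

/-- The travelling wave, as an element of the Wiener algebra. -/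
noncomputable def waveElement {w : SymmWeight} {κ : ℝ} (hκ : 1 < κ) {a β s₀ : ℝ} (θ₀ : ℝ)
    (ha : 0 ≤ a) (hs₀ : 0 < s₀) (hs : s₀ ≤ Real.sin (β / 2)) (N : Wiener w ℝ) :
    Wiener w BddSeq :=
  Wiener.mk (fun m => BddSeq.mk
      (fun n => waveCoeff κ a β θ₀ N m * Complex.exp (Complex.I * (m : ℂ) * ((β * n : ℝ) : ℂ)))
      (a * |shape κ a β N m|) fun n => by rw [norm_fourier_term, norm_waveCoeff ha])
    (Wiener.summable_of_le (Wiener.cosine w) N (c := a * (1 / (2 * s₀)))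
      (d := a * (a * (2 / (κ - 1)))) fun m => by
        refine (BddSeq.norm_mk_le _).trans ?_
        rw [mul_assoc a, mul_assoc a, ← mul_add, Wiener.cosine_apply]
        refine mul_le_mul_of_nonneg_left ((abs_shape_le_sq _ _ _ _ _).trans
          ((sq_mul_abs_shape_le hκ ha hs₀ hs N m).trans (le_of_eq ?_))) ha
        split_ifs <;> simp)
    fun m => by
      ext n
      rw [BoundedContinuousFunction.star_apply, BddSeq.mk_apply, BddSeq.mk_apply,
        waveCoeff_neg (fun m => by rw [Wiener.apply_neg]; rfl), star_mul', ← starRingEnd_apply,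
        ← starRingEnd_apply, ← Complex.exp_conj]
      simp

lemma waveElement_apply {w : SymmWeight} {κ : ℝ} (hκ : 1 < κ) {a β s₀ : ℝ} (θ₀ : ℝ)
    (ha : 0 ≤ a) (hs₀ : 0 < s₀) (hs : s₀ ≤ Real.sin (β / 2)) (N : Wiener w ℝ) (m : ℤ) (n : ℕ) :
    waveElement hκ θ₀ ha hs₀ hs N m n
      = waveCoeff κ a β θ₀ N m * Complex.exp (Complex.I * (m : ℂ) * ((β * n : ℝ) : ℂ)) := rfl

lemma norm_waveElement_apply_le {w : SymmWeight} {κ : ℝ} (hκ : 1 < κ) {a β s₀ : ℝ} (θ₀ : ℝ)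
    (ha : 0 ≤ a) (hs₀ : 0 < s₀) (hs : s₀ ≤ Real.sin (β / 2)) (N : Wiener w ℝ) (m : ℤ) :
    ‖waveElement hκ θ₀ ha hs₀ hs N m‖ ≤ a * |shape κ a β N m| :=
  (BoundedContinuousFunction.norm_le (by positivity)).2 fun n => by
    rw [waveElement_apply, norm_fourier_term, norm_waveCoeff ha]

lemma norm_waveElement_le {w : SymmWeight} {κ : ℝ} (hκ : 1 < κ) {a β s₀ : ℝ} (θ₀ : ℝ)
    (ha : 0 ≤ a) (hs₀ : 0 < s₀) (hs : s₀ ≤ Real.sin (β / 2)) (N : Wiener w ℝ) :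
    ‖waveElement hκ θ₀ ha hs₀ hs N‖
      ≤ a * (1 / (2 * s₀)) * ‖Wiener.cosine w‖ + a * (a * (2 / (κ - 1))) * ‖N‖ := by
  refine Wiener.norm_le_add _ _ _ fun m => ?_
  refine (norm_waveElement_apply_le hκ θ₀ ha hs₀ hs N m).trans ?_
  rw [mul_assoc a, mul_assoc a, ← mul_add, Wiener.cosine_apply]
  refine mul_le_mul_of_nonneg_left ((abs_shape_le_sq _ _ _ _ _).trans
    ((sq_mul_abs_shape_le hκ ha hs₀ hs N m).trans (le_of_eq ?_))) ha
  split_ifs <;> simp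

/-- Telescoping through amplitude and shape, then the phase `arg z`, then the wave number `β`. The
last two changes each cost a factor `|m| ≤ m²`, which is why `m² |shape|` appears. -/
lemma norm_waveElement_sub_apply_le {w : SymmWeight} {κ : ℝ} (hκ : 1 < κ) {z z' : ℂ}
    {β β' s₀ τ : ℝ} (hτ : 0 < τ)
    (hs₀ : 0 < s₀) (hs : s₀ ≤ Real.sin (β / 2)) (hs' : s₀ ≤ Real.sin (β' / 2))
    (N N' : Wiener w ℝ) (m : ℤ) :
    ‖(decay w hτ.le * (waveElement hκ z.arg (norm_nonneg z) hs₀ hs N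
        - waveElement hκ z'.arg (norm_nonneg z') hs₀ hs' N')) m‖ ≤
      ‖z - z'‖ * |shape κ ‖z‖ β N m| + ‖z'‖ * |shape κ ‖z‖ β N m - shape κ ‖z'‖ β' N' m|
      + (2 * ‖z - z'‖ + ‖z'‖ * (|β - β'| * (1 / τ))) * ((m : ℝ) ^ 2 * |shape κ ‖z'‖ β' N' m|) := by
  refine (BoundedContinuousFunction.norm_le (by positivity)).2 fun n => ?_
  rw [decay_mul_apply, Wiener.sub_apply, BoundedContinuousFunction.sub_apply, waveElement_apply,
    waveElement_apply, norm_mul, Complex.norm_real, Real.norm_of_nonneg (Real.exp_pos _).le,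
    waveCoeff, waveCoeff]
  set S := shape κ ‖z‖ β N m
  set S' := shape κ ‖z'‖ β' N' m
  set e₁ := Complex.exp (Complex.I * m * z.arg) with he₁
  set e₁' := Complex.exp (Complex.I * m * z'.arg) with he₁'
  set q := Complex.exp (Complex.I * m * ((β * n : ℝ) : ℂ)) with hq
  set q' := Complex.exp (Complex.I * m * ((β' * n : ℝ) : ℂ)) with hq'
  have hone : ∀ (m : ℤ) (x : ℝ), ‖Complex.exp (Complex.I * m * x)‖ = 1 := fun m x => by
    simpa using norm_fourier_term 1 m x
  have n1 : ‖e₁‖ = 1 := hone _ _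
  have n1' : ‖e₁'‖ = 1 := hone _ _
  have n2 : ‖q‖ = 1 := hone _ _
  have h1 : ‖e₁ - e₁'‖ ≤ |(m : ℝ)| *
      ‖Complex.exp (Complex.I * z.arg) - Complex.exp (Complex.I * z'.arg)‖ :=
    norm_exp_int_mul_sub_le _ _ _
  have h2 : ‖q - q'‖ ≤ |(m : ℝ)| * (|β - β'| * n) := by
    refine (norm_exp_int_mul_sub_le _ _ _).trans (mul_le_mul_of_nonneg_left
      ((norm_exp_sub_exp_le _ _).trans (le_of_eq ?_)) (abs_nonneg _))
    rw [← sub_mul, abs_mul, Nat.abs_cast]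
  have h3 := mul_norm_exp_arg_sub_le z z'
  have h4 := nat_mul_exp_neg_le hτ n
  have h5 : Real.exp (-τ * n) ≤ 1 := by
    rw [Real.exp_le_one_iff]
    have : 0 ≤ τ * n := by positivity
    linarith
  have h6 := abs_cast_le_sq m
  have h7 : |‖z‖ - ‖z'‖| ≤ ‖z - z'‖ := abs_norm_sub_norm_le z z'
  have h8 := (Real.exp_pos (-τ * n)).le
  have e : Complex.I * ((‖z‖ * S : ℝ) : ℂ) * e₁ * q - Complex.I * ((‖z'‖ * S' : ℝ) : ℂ) * e₁' * q'
      = Complex.I * (((‖z‖ - ‖z'‖) * S + ‖z'‖ * (S - S') : ℝ) : ℂ) * e₁ * q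
        + Complex.I * ((‖z'‖ * S' : ℝ) : ℂ) * (e₁ - e₁') * q
        + Complex.I * ((‖z'‖ * S' : ℝ) : ℂ) * e₁' * (q - q') := by
    push_cast; ring
  have t1 : ‖Complex.I * (((‖z‖ - ‖z'‖) * S + ‖z'‖ * (S - S') : ℝ) : ℂ) * e₁ * q‖
      ≤ ‖z - z'‖ * |S| + ‖z'‖ * |S - S'| := by
    rw [norm_mul, norm_mul, norm_mul, n1, n2, Complex.norm_I, one_mul, mul_one, mul_one,
      Complex.norm_real, Real.norm_eq_abs]
    refine (abs_add_le _ _).trans ?_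
    rw [abs_mul, abs_mul, abs_norm]
    gcongr
  have t2 : ‖Complex.I * ((‖z'‖ * S' : ℝ) : ℂ) * (e₁ - e₁') * q‖
      ≤ 2 * ‖z - z'‖ * ((m : ℝ) ^ 2 * |S'|) := by
    rw [norm_mul, norm_mul, norm_mul, n2, Complex.norm_I, one_mul, mul_one,
      Complex.norm_real, Real.norm_eq_abs, abs_mul, abs_norm]
    calc _ ≤ ‖z'‖ * |S'| * (|(m : ℝ)| *
          ‖Complex.exp (Complex.I * z.arg) - Complex.exp (Complex.I * z'.arg)‖) := by gcongr
      _ = (‖z'‖ * ‖Complex.exp (Complex.I * z.arg) - Complex.exp (Complex.I * z'.arg)‖)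
          * (|(m : ℝ)| * |S'|) := by ring
      _ ≤ _ := by gcongr
  have t3 : ‖Complex.I * ((‖z'‖ * S' : ℝ) : ℂ) * e₁' * (q - q')‖
      ≤ ‖z'‖ * |S'| * (|(m : ℝ)| * (|β - β'| * n)) := by
    rw [norm_mul, norm_mul, norm_mul, n1', Complex.norm_I, one_mul, mul_one,
      Complex.norm_real, Real.norm_eq_abs, abs_mul, abs_norm]
    gcongr
  rw [e]
  calc _ ≤ Real.exp (-τ * n) * ((‖z - z'‖ * |S| + ‖z'‖ * |S - S'|)
        + 2 * ‖z - z'‖ * ((m : ℝ) ^ 2 * |S'|) + ‖z'‖ * |S'| * (|(m : ℝ)| * (|β - β'| * n))) := by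
        refine mul_le_mul_of_nonneg_left (norm_add₃_le.trans ?_) h8
        gcongr
    _ = Real.exp (-τ * n) * ((‖z - z'‖ * |S| + ‖z'‖ * |S - S'|)
        + 2 * ‖z - z'‖ * ((m : ℝ) ^ 2 * |S'|)) + ‖z'‖ * |S'| * (|(m : ℝ)| *
          (|β - β'| * (n * Real.exp (-τ * n)))) := by ring
    _ ≤ 1 * ((‖z - z'‖ * |S| + ‖z'‖ * |S - S'|)
        + 2 * ‖z - z'‖ * ((m : ℝ) ^ 2 * |S'|)) + ‖z'‖ * |S'| * ((m : ℝ) ^ 2 *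
          (|β - β'| * (1 / τ))) := by gcongr
    _ = _ := by ring

/-- The real amplitude `a = ‖z‖` selects the profile and `arg z` translates it in time. The first
boundary mode is then explicitly proportional to `z`, and this formula turns the resonant matching
into a fixed-point equation. -/
theorem exists_travelling_waves (w : SymmWeight) {F : ℝ → ℝ} {c γ κ f₁ : ℝ} (hκ : 1 < κ)
    (hκ4 : κ < 4) (hf₁ : 0 < f₁) (hγκ : γ ^ 2 = f₁ * κ) {k : ℕ → ℝ} {C₀ R : ℝ}
    (hk : ∀ j, |k j| ≤ C₀ * R ^ j) (hR : 0 < R)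
    (hF : ∀ y : ℝ, |y| * R ≤ 1 / 2 → F (-c + y) = F (-c) + f₁ * y + remainder k y)
    {τ : ℝ} (hτ : 0 < τ) :
    ∃ (a₀ C s₀ : ℝ) (β : ℂ → ℝ) (u : ℂ → Wiener w BddSeq), 0 < a₀ ∧ 0 < C ∧ 0 < s₀ ∧
      ∀ z, ‖z‖ ≤ a₀ → s₀ ≤ Real.sin (β z / 2) ∧ ‖u z‖ ≤ C * ‖z‖ ∧
        u z 1 0 = Complex.I * z / ((2 * Real.sin (β z / 2) : ℝ) : ℂ) ∧ u z 0 = 0 ∧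
        IsOnePhaseWave F c γ (fun n m => u z m n) ∧
        ∀ z', ‖z'‖ ≤ a₀ → |β z - β z'| ≤ C * ‖z - z'‖ ∧
          ‖decay w hτ.le * (u z - u z')‖ ≤ C * ‖z - z'‖ := by
  have hκ' : 0 < κ - 1 := sub_pos.2 hκ
  obtain ⟨a₁, C, s₀, b, N, ha₁, hC, hs₀, h⟩ := exists_travelling_profile w hκ hκ4 hf₁ hk hR
  let u : ℂ → Wiener w BddSeq := fun z =>
    -- The default value `0` is never met on the ball `‖z‖ ≤ a₀`, where the sine bound holds.
    if hz : s₀ ≤ Real.sin (b ‖z‖ / 2) then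
      waveElement hκ z.arg (norm_nonneg z) hs₀ hz (N ‖z‖) else 0
  set a₀ := min a₁ 1 with ha₀
  set e := ‖Wiener.cosine w‖ with he
  set D := 2 / (κ - 1) with hD
  set E := 2 / (κ - 1) * (1 + 4 / (κ - 1)) with hE
  have hD0 : 0 < D := by positivity
  have hE0 : 0 < E := by positivity
  have he0 : 0 ≤ e := norm_nonneg _
  -- constants
  set C₁ := 1 / (2 * s₀) * e + D * C with hC₁
  have hC₁0 : 0 < C₁ := by positivity
  set C₂ := C / (4 * s₀ ^ 2) * e + ((D + E * C) * C + D * C) with hC₂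
  have hC₂0 : 0 < C₂ := by positivity
  set C₃ := C₁ + C₂ + (2 + C * (1 / τ)) * C₁ with hC₃
  have hC₃0 : 0 < C₃ := by positivity
  refine ⟨a₀, C + C₁ + C₃, s₀, fun z => b ‖z‖, u, by positivity, by positivity, hs₀,
    fun z hz => ?_⟩
  have hz1 : ‖z‖ ≤ 1 := hz.trans (min_le_right _ _)
  obtain ⟨p1, p2, p3, p4, p5, p6⟩ := h ‖z‖ (norm_nonneg z) (hz.trans (min_le_left _ _))
  have hu : u z = waveElement hκ z.arg (norm_nonneg z) hs₀ p1 (N ‖z‖) := dif_pos p1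
  refine ⟨p1, ?_, ?_, ?_, ?_, fun z' hz' => ?_⟩
  · rw [hu]
    refine (norm_waveElement_le hκ _ _ hs₀ p1 _).trans ?_
    calc _ ≤ ‖z‖ * (1 / (2 * s₀)) * e + ‖z‖ * (1 * D) * C := by gcongr
      _ = C₁ * ‖z‖ := by rw [hC₁]; ring
      _ ≤ _ := by gcongr; linarith
  · rw [hu, waveElement_apply, waveCoeff, shape_one]
    have h2 : (‖z‖ : ℂ) * Complex.exp (Complex.I * z.arg) = z := by
      rw [mul_comm Complex.I]; exact Complex.norm_mul_exp_arg_mul_I z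
    generalize Real.sin (b ‖z‖ / 2) = s
    conv_rhs => rw [← h2]
    push_cast
    simp only [mul_one, mul_zero, Complex.exp_zero]
    ring
  · rw [hu]
    ext n
    rw [waveElement_apply, waveCoeff, shape_zero]
    simp
  · rw [hu]
    have hNeven : ∀ m, N ‖z‖ (-m) = N ‖z‖ m := fun m => by rw [Wiener.apply_neg]; rfl
    refine ⟨b ‖z‖, waveCoeff κ ‖z‖ (b ‖z‖) z.arg (N ‖z‖), fun n t => c * (n : ℝ)
      + (fourierSeries (waveCoeff κ ‖z‖ (b ‖z‖) z.arg (N ‖z‖)) (b ‖z‖ * (n : ℝ) + γ * t)).re,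
      fun n m => rfl, fun n t => ?_, fun n => ?_⟩
    · rw [Complex.ofReal_add, ofReal_re_fourierSeries (fun m => waveCoeff_neg hNeven m)]
    · exact travelling_wave_motion hκ hγκ hk hR hF (norm_nonneg z) hs₀ p1 p3 p4 p5 z.arg n
  · obtain ⟨q1, q2, -, -, -, -⟩ := h ‖z'‖ (norm_nonneg z') (hz'.trans (min_le_left _ _))
    have hz1' : ‖z'‖ ≤ 1 := hz'.trans (min_le_right _ _)
    have hu' : u z' = waveElement hκ z'.arg (norm_nonneg z') hs₀ q1 (N ‖z'‖) := dif_pos q1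
    obtain ⟨r1, r2⟩ := p6 ‖z'‖ (norm_nonneg z') (hz'.trans (min_le_left _ _))
    have hzz : |‖z‖ - ‖z'‖| ≤ ‖z - z'‖ := abs_norm_sub_norm_le z z'
    have r1' : |b ‖z‖ - b ‖z'‖| ≤ C * ‖z - z'‖ := r1.trans (by gcongr)
    have r2' : ‖N ‖z‖ - N ‖z'‖‖ ≤ C * ‖z - z'‖ := r2.trans (by gcongr)
    refine ⟨r1'.trans (by gcongr; linarith), ?_⟩
    set Δ := ‖z - z'‖ with hΔ
    have hΔ0 : 0 ≤ Δ := norm_nonneg _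
    have hif : ∀ m : ℤ, (if |m| = 1 then (1 : ℝ) else 0) = ‖Wiener.cosine w m‖ := fun m => by
      rw [Wiener.cosine_apply]; split_ifs <;> simp
    rw [hu, hu']
    have hsq : ∀ (ξ : ℂ) (h1 : ‖ξ‖ ≤ 1) (h2 : s₀ ≤ Real.sin (b ‖ξ‖ / 2)) (m : ℤ),
        (m : ℝ) ^ 2 * |shape κ ‖ξ‖ (b ‖ξ‖) (N ‖ξ‖) m|
          ≤ 1 / (2 * s₀) * ‖Wiener.cosine w m‖ + D * ‖N ‖ξ‖ m‖ := by
      intro ξ h1 h2 m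
      refine (sq_mul_abs_shape_le hκ (norm_nonneg _) hs₀ h2 _ m).trans ?_
      rw [hif, Real.norm_eq_abs (N ‖ξ‖ m)]
      have : ‖ξ‖ * (2 / (κ - 1)) ≤ D := by rw [← hD]; exact mul_le_of_le_one_left hD0.le h1
      gcongr
    have hsub : ∀ m : ℤ, |shape κ ‖z‖ (b ‖z‖) (N ‖z‖) m - shape κ ‖z'‖ (b ‖z'‖) (N ‖z'‖) m|
        ≤ C * Δ / (4 * s₀ ^ 2) * ‖Wiener.cosine w m‖ + ((Δ * D + E * (C * Δ)) * ‖N ‖z‖ m‖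
          + D * ‖(N ‖z‖ - N ‖z'‖) m‖) := by
      intro m
      refine (abs_shape_sub_le hκ (norm_nonneg _) hs₀ p1 q1 _ _ m).trans ?_
      rw [hif, Wiener.sub_apply, Real.norm_eq_abs (N ‖z‖ m), Real.norm_eq_abs (_ - _), ← hD, ← hE]
      have b1 : ‖z'‖ * (E * |b ‖z‖ - b ‖z'‖|) ≤ 1 * (E * (C * Δ)) := by gcongr
      rw [one_mul] at b1
      have b2 : ‖z'‖ * D ≤ D := mul_le_of_le_one_left hD0.le hz1'
      gcongr
    have hmain := Wiener.norm_le_of_hasSum (decay w hτ.le *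
      (waveElement hκ z.arg (norm_nonneg z) hs₀ p1 (N ‖z‖)
        - waveElement hκ z'.arg (norm_nonneg z') hs₀ q1 (N ‖z'‖)))
      (f := fun m => Δ * (1 / (2 * s₀) * ‖Wiener.cosine w m‖ + D * ‖N ‖z‖ m‖)
        + (C * Δ / (4 * s₀ ^ 2) * ‖Wiener.cosine w m‖ + ((Δ * D + E * (C * Δ)) * ‖N ‖z‖ m‖
          + D * ‖(N ‖z‖ - N ‖z'‖) m‖))
        + (2 * Δ + C * Δ * (1 / τ)) * (1 / (2 * s₀) * ‖Wiener.cosine w m‖ + D * ‖N ‖z'‖ m‖))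
      (s := Δ * (1 / (2 * s₀) * e + D * ‖N ‖z‖‖)
        + (C * Δ / (4 * s₀ ^ 2) * e + ((Δ * D + E * (C * Δ)) * ‖N ‖z‖‖
          + D * ‖N ‖z‖ - N ‖z'‖‖))
        + (2 * Δ + C * Δ * (1 / τ)) * (1 / (2 * s₀) * e + D * ‖N ‖z'‖‖)) ?_ fun m => ?_
    · refine hmain.trans ?_
      calc _ ≤ Δ * (1 / (2 * s₀) * e + D * C)
        + (C * Δ / (4 * s₀ ^ 2) * e + ((Δ * D + E * (C * Δ)) * C + D * (C * Δ)))
        + (2 * Δ + C * Δ * (1 / τ)) * (1 / (2 * s₀) * e + D * C) := by gcongr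
        _ = C₃ * Δ := by rw [hC₃, hC₁, hC₂]; ring
        _ ≤ _ := by gcongr; linarith
    · have s1 := (Wiener.cosine w).hasSum_norm
      have s2 := (N ‖z‖).hasSum_norm
      have s3 := (N ‖z'‖).hasSum_norm
      have s4 := (N ‖z‖ - N ‖z'‖).hasSum_norm
      refine ((((s1.mul_left (1 / (2 * s₀))).add (s2.mul_left D)).mul_left Δ).add
        ((s1.mul_left (C * Δ / (4 * s₀ ^ 2))).add ((s2.mul_left (Δ * D + E * (C * Δ))).add
          (s4.mul_left D)))).add (((s1.mul_left (1 / (2 * s₀))).add (s3.mul_left D)).mul_left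
            (2 * Δ + C * Δ * (1 / τ))) |>.congr_fun fun m => ?_
      ring
    · refine (norm_waveElement_sub_apply_le hκ hτ hs₀ p1 q1 (N ‖z‖) (N ‖z'‖) m).trans ?_
      refine add_le_add (add_le_add ?_ ?_) ?_
      · exact mul_le_mul_of_nonneg_left ((abs_shape_le_sq _ _ _ _ _).trans (hsq z hz1 p1 m)) hΔ0
      · exact (mul_le_of_le_one_left (abs_nonneg _) hz1').trans (hsub m)
      · refine mul_le_mul ?_ (hsq z' hz1' q1 m) (by positivity) (by positivity)
        refine add_le_add le_rfl ?_
        calc _ ≤ 1 * (C * Δ * (1 / τ)) := by gcongr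
          _ = _ := one_mul _

/-! ### The half-line problem in an abstract Banach algebra. -/

section Abstract

variable {A : Type*} [NormedCommRing A] [NormOneClass A] [NormedAlgebra ℝ A] [CompleteSpace A]

open Classical in
/-- The solution `G` of `E G = g(U + E X) - g(U)`. -/
noncomputable def forceDifference (k : ℕ → ℝ) (E U X : A) : A :=
  if h : ∃ G, E * G = remainder k (U + E * X) - remainder k U then h.choose else 0

variable {k : ℕ → ℝ} {C₀ R : ℝ} {E : A}

/-- Estimates for the nonlinearity, with a constant `C`. -/
structure RemainderBounds (A : Type*) [NormedCommRing A] [NormedAlgebra ℝ A] (k : ℕ → ℝ)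
    (R C : ℝ) : Prop where
  first : ∀ (M : ℝ) (x y : A), M * R ≤ 1 / 2 → ‖x‖ ≤ M → ‖y‖ ≤ M →
    ∃ K, remainder k x - remainder k y = (x - y) * K ∧ ‖K‖ ≤ C * M
  second : ∀ (M : ℝ) (x y v : A), M * R ≤ 1 / 2 → ‖x‖ ≤ M → ‖y‖ ≤ M → ‖x + v‖ ≤ M → ‖y + v‖ ≤ M →
    ∃ K, remainder k (x + v) - remainder k x - (remainder k (y + v) - remainder k y)
      = v * (x - y) * K ∧ ‖K‖ ≤ C

lemma mul_forceDifference {C M : ℝ} (hb : RemainderBounds A k R C) (hM : M * R ≤ 1 / 2)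
    {U X : A} (hU : ‖U‖ ≤ M) (hX : ‖U + E * X‖ ≤ M) :
    E * forceDifference k E U X = remainder k (U + E * X) - remainder k U := by
  have h : ∃ G, E * G = remainder k (U + E * X) - remainder k U := by
    obtain ⟨K, hK, -⟩ := hb.first M _ _ hM hX hU
    exact ⟨X * K, by rw [hK]; ring⟩
  rw [forceDifference, dif_pos h]
  exact h.choose_spec

lemma forceDifference_zero (hE : ∀ a b : A, E * a = E * b → a = b) (U : A) :
    forceDifference k E U 0 = 0 := by
  have h : ∃ G, E * G = remainder k (U + E * 0) - remainder k U := ⟨0, by simp⟩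
  refine hE _ _ ?_
  rw [forceDifference, dif_pos h, h.choose_spec]
  simp

lemma forceDifference_sub_right (hE : ∀ a b : A, E * a = E * b → a = b) {C M : ℝ}
    (hb : RemainderBounds A k R C) (hM : M * R ≤ 1 / 2)
    {U X X' : A} (hU : ‖U‖ ≤ M) (hX : ‖U + E * X‖ ≤ M) (hX' : ‖U + E * X'‖ ≤ M) :
    ∃ K, forceDifference k E U X - forceDifference k E U X' = (X - X') * K ∧ ‖K‖ ≤ C * M := by
  obtain ⟨K, hK, hKb⟩ := hb.first M _ _ hM hX hX'
  refine ⟨K, hE _ _ ?_, hKb⟩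
  rw [mul_sub, mul_forceDifference hb hM hU hX, mul_forceDifference hb hM hU hX',
    sub_sub_sub_cancel_right, hK]
  ring

/-- The second difference has the factor `E X`, and `E` cancels. What remains contains `X` in full
and `U - U'` as a separate factor, so the weak weight can be placed on `U - U'` alone. -/
lemma forceDifference_sub_left (hE : ∀ a b : A, E * a = E * b → a = b) {C M : ℝ}
    (hb : RemainderBounds A k R C) (hM : M * R ≤ 1 / 2)
    {U U' X : A} (hU : ‖U‖ ≤ M) (hU' : ‖U'‖ ≤ M) (hX : ‖U + E * X‖ ≤ M)
    (hX' : ‖U' + E * X‖ ≤ M) :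
    ∃ K, forceDifference k E U X - forceDifference k E U' X = (U - U') * (X * K) ∧ ‖K‖ ≤ C := by
  obtain ⟨K, hK, hKb⟩ := hb.second M _ _ (E * X) hM hU hU' hX hX'
  refine ⟨K, hE _ _ ?_, hKb⟩
  rw [mul_sub, mul_forceDifference hb hM hU hX, mul_forceDifference hb hM hU' hX', hK]
  ring

/-- The linear data of the half-line problem: `E` and `E'` are the strong and the weak weight. -/
structure HalfLineOperators (E E' : A) (Λ S P₀ D D₀ : A →ₗ[ℝ] A) (ℓ : A →ₗ[ℝ] ℂ) (q Cs : ℝ) :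
    Prop where
  cancel : ∀ a b : A, E * a = E * b → a = b
  norm_E : ∀ a : A, ‖E * a‖ ≤ ‖a‖
  norm_E' : ∀ a : A, ‖E' * a‖ ≤ ‖a‖
  norm_Λ : ∀ a, ‖Λ a‖ ≤ q * ‖a‖
  weak_Λ : ∀ a, ‖E' * Λ a‖ ≤ q * ‖E' * a‖
  norm_S : ∀ a, ‖S a‖ ≤ Cs * ‖a‖
  weak_S : ∀ a, ‖E' * S a‖ ≤ Cs * ‖E' * a‖
  norm_P₀ : ∀ a, ‖P₀ a‖ ≤ ‖a‖
  weak_P₀ : ∀ a, ‖E' * P₀ a‖ ≤ ‖E' * a‖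
  norm_D : ∀ a, ‖D a‖ ≤ 2 * ‖a‖
  weak_D : ∀ a, ‖E' * D a‖ ≤ 2 * ‖E' * a‖
  norm_D₀ : ∀ a, ‖D₀ a‖ ≤ 2 * ‖a‖
  weak_D₀ : ∀ a, ‖E' * D₀ a‖ ≤ 3 * ‖E' * a‖
  norm_ℓ : ∀ a, ‖ℓ a‖ ≤ ‖E' * a‖
  ℓ_Λ : ∀ a, ℓ (Λ a) = 0
  ℓ_P₀ : ∀ a, ℓ (P₀ a) = 0

-- Two nested contractions. For fixed `z` the strong norm gives `v`, because `S G` has Lipschitz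
-- constant `O(|ε|)` and `Λ` has constant `q < 1`. Since `u` is Lipschitz in `z` only under the weak
-- weight `E'`, so is `v`; the scalar `ℓ v` does not see this loss, and the equation for `z` closes
-- as a contraction on a disc of radius `O(|ε|)`.
set_option maxHeartbeats 2000000 in
theorem exists_halfLine_solution {E E' : A} {Λ S P₀ D D₀ : A →ₗ[ℝ] A} {ℓ : A →ₗ[ℝ] ℂ} {q Cs : ℝ}
    (ops : HalfLineOperators E E' Λ S P₀ D D₀ ℓ q Cs) (hq0 : 0 ≤ q) (hq1 : q < 1) (hCs : 0 < Cs)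
    (hR : 0 < R) {Cg : ℝ} (hCg : 0 < Cg) (hb : RemainderBounds A k R Cg) {a₀ C : ℝ} (ha₀ : 0 < a₀)
    (hC : 0 < C) {β : ℂ → ℝ} {u : ℂ → A} (hu : ∀ z, ‖z‖ ≤ a₀ → ‖u z‖ ≤ C * ‖z‖)
    (hβ : ∀ z z', ‖z‖ ≤ a₀ → ‖z'‖ ≤ a₀ → |β z - β z'| ≤ C * ‖z - z'‖)
    (hul : ∀ z z', ‖z‖ ≤ a₀ → ‖z'‖ ≤ a₀ → ‖E' * (u z - u z')‖ ≤ C * ‖z - z'‖) (f : A) :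
    ∃ (ε₀ K : ℝ), 0 < ε₀ ∧ 0 < K ∧ ∀ ε : ℝ, |ε| ≤ ε₀ → ∃ (z : ℂ) (v G : A),
      ‖z‖ ≤ a₀ ∧ ‖z‖ ≤ K * |ε| ∧ ‖v‖ ≤ K * |ε| ∧ ‖D₀ (u z)‖ * R ≤ 1 / 2 ∧
      ‖D₀ (u z) + E * D v‖ * R ≤ 1 / 2 ∧
      E * G = remainder k (D₀ (u z) + E * D v) - remainder k (D₀ (u z)) ∧
      v = Λ v + S G + P₀ (ε • f - u z) ∧
      z = -(2 * Real.sin (β z / 2) : ℝ) * Complex.I * (ε * ℓ f - ℓ v) := by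
  set B := ‖f‖ + 1 with hB
  have hB0 : 0 < B := by positivity
  set q' := (1 + q) / 2 with hq'
  have hq'1 : q' < 1 := by rw [hq']; linarith
  have hq'0 : 0 ≤ q' := by rw [hq']; linarith
  have h1q : 0 < 1 - q' := by linarith
  -- The radii for `z`, `v` and the arguments of the remainder are `cz`, `cv` and `cM` times `|ε|`.
  -- The value `4B` is the bound `|2 sin| ≤ 2` times `|ε ℓ f| + |ℓ v| ≤ 2B|ε|`.
  set cz := 4 * B with hcz
  set cv := (B + C * cz) / (1 - q') with hcv
  set cM := 2 * C * cz + 2 * cv with hcM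
  have hcz0 : 0 < cz := by positivity
  have hcv0 : 0 < cv := by positivity
  have hcM0 : 0 < cM := by positivity
  set J := Cs * Cg with hJ
  have hJ0 : 0 < J := by positivity
  set Lv := (J * (3 * C) * 2 + C) / (1 - q') with hLv
  have hLv0 : 0 < Lv := by positivity
  -- Each summand encodes one smallness condition `c1`–`c6`, so `|ε| ≤ 1/T` implies all of them.
  set T := cz / a₀ + 2 * cM * R + J * cM * 2 / (1 - q') + J * cM * 2 * cv / B + cv
    + 2 * (2 * C * B + 2 * J * (cM * 2 * Lv + 6 * C * cv)) with hT
  have t1 : 0 < cz / a₀ := by positivity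
  have t2 : 0 < 2 * cM * R := by positivity
  have t3 : 0 < J * cM * 2 / (1 - q') := by positivity
  have t4 : 0 < J * cM * 2 * cv / B := by positivity
  have t6 : 0 < 2 * (2 * C * B + 2 * J * (cM * 2 * Lv + 6 * C * cv)) := by positivity
  have hT0 : 0 < T := by positivity
  refine ⟨1 / T, cz + cv, by positivity, by positivity, fun ε hε => ?_⟩
  set δ := |ε| with hδ
  have hδ0 : 0 ≤ δ := abs_nonneg ε
  have hTδ : T * δ ≤ 1 := by rw [le_div_iff₀ hT0] at hε; linarith
  have hsm : ∀ {x}, x ≤ T → x * δ ≤ 1 := fun {x} hx =>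
    (mul_le_mul_of_nonneg_right hx hδ0).trans hTδ
  have c1 : cz * δ ≤ a₀ := by
    have : cz / a₀ * δ ≤ 1 := hsm (by rw [hT]; linarith)
    rwa [div_mul_eq_mul_div, div_le_one ha₀] at this
  have c2 : cM * δ * R ≤ 1 / 2 := by
    have : 2 * cM * R * δ ≤ 1 := hsm (by rw [hT]; linarith)
    linarith
  have c3 : J * (cM * δ) * 2 ≤ 1 - q' := by
    have : J * cM * 2 / (1 - q') * δ ≤ 1 := hsm (by rw [hT]; linarith)
    rw [div_mul_eq_mul_div, div_le_one h1q] at this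
    linarith
  have c4 : J * (cM * δ) * (2 * cv) ≤ B := by
    have : J * cM * 2 * cv / B * δ ≤ 1 := hsm (by rw [hT]; linarith)
    rw [div_mul_eq_mul_div, div_le_one hB0] at this
    linarith
  have c5 : cv * δ ≤ 1 := hsm (by rw [hT]; linarith)
  have c6 : (2 * C * B + 2 * J * (cM * 2 * Lv + 6 * C * cv)) * δ ≤ 1 / 2 := by
    have : 2 * (2 * C * B + 2 * J * (cM * 2 * Lv + 6 * C * cv)) * δ ≤ 1 :=
      hsm (by rw [hT]; linarith)
    linarith
  set Z := cz * δ with hZ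
  set V := cv * δ with hV
  set M := cM * δ with hM
  have hV0 : 0 ≤ V := by positivity
  have hM0 : 0 ≤ M := by positivity
  have hf : ‖f‖ ≤ B := by rw [hB]; linarith
  have hU : ∀ {z}, ‖z‖ ≤ Z → ‖D₀ (u z)‖ ≤ 2 * C * Z := fun {z} hz => by
    have h1 := ops.norm_D₀ (u z)
    have h2 := hu z (hz.trans c1)
    have h3 := mul_le_mul_of_nonneg_left hz hC.le
    linarith
  have hMsum : 2 * C * Z + 2 * V = M := by rw [hM, hZ, hV, hcM]; ring
  have hUM : ∀ {z}, ‖z‖ ≤ Z → ‖D₀ (u z)‖ ≤ M := fun {z} hz => by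
    have := hU hz; linarith
  have hDV : ∀ {v}, ‖v‖ ≤ V → ‖D v‖ ≤ 2 * V := fun {v} hv => by
    have := ops.norm_D v; linarith
  have hUXM : ∀ {z v}, ‖z‖ ≤ Z → ‖v‖ ≤ V → ‖D₀ (u z) + E * D v‖ ≤ M := fun {z v} hz hv => by
    have h1 := norm_add_le (D₀ (u z)) (E * D v)
    have h2 := ops.norm_E (D v)
    have h3 := hU hz
    have h4 := hDV hv
    linarith
  let G : ℂ → A → A := fun z v => forceDifference k E (D₀ (u z)) (D v)
  have hGv : ∀ {z v v'}, ‖z‖ ≤ Z → ‖v‖ ≤ V → ‖v'‖ ≤ V →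
      ∃ K, G z v - G z v' = D (v - v') * K ∧ ‖K‖ ≤ Cg * M := fun {z v v'} hz hv hv' => by
    rw [map_sub]
    exact forceDifference_sub_right ops.cancel hb c2 (hUM hz) (hUXM hz hv) (hUXM hz hv')
  have hGz : ∀ {z z' v}, ‖z‖ ≤ Z → ‖z'‖ ≤ Z → ‖v‖ ≤ V →
      ∃ K, G z v - G z' v = D₀ (u z - u z') * (D v * K) ∧ ‖K‖ ≤ Cg := fun {z z' v} hz hz' hv => by
    rw [map_sub]
    exact forceDifference_sub_left ops.cancel hb c2 (hUM hz) (hUM hz') (hUXM hz hv) (hUXM hz' hv)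
  have hGv1 : ∀ {z v v'}, ‖z‖ ≤ Z → ‖v‖ ≤ V → ‖v'‖ ≤ V →
      ‖G z v - G z v'‖ ≤ Cg * M * (2 * ‖v - v'‖) := fun {z v v'} hz hv hv' => by
    obtain ⟨K, hK, hKb⟩ := hGv hz hv hv'
    rw [hK, mul_comm (Cg * M)]
    exact (norm_mul_le _ _).trans (mul_le_mul (ops.norm_D _) hKb (norm_nonneg _) (by positivity))
  have hGv2 : ∀ {z v v'}, ‖z‖ ≤ Z → ‖v‖ ≤ V → ‖v'‖ ≤ V →
      ‖E' * (G z v - G z v')‖ ≤ Cg * M * (2 * ‖E' * (v - v')‖) := fun {z v v'} hz hv hv' => by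
    obtain ⟨K, hK, hKb⟩ := hGv hz hv hv'
    rw [hK, mul_comm (Cg * M), ← mul_assoc]
    exact (norm_mul_le _ _).trans (mul_le_mul (ops.weak_D _) hKb (norm_nonneg _) (by positivity))
  have hGz2 : ∀ {z z' v}, ‖z‖ ≤ Z → ‖z'‖ ≤ Z → ‖v‖ ≤ V →
      ‖E' * (G z v - G z' v)‖ ≤ 3 * (C * ‖z - z'‖) * (2 * V * Cg) := fun {z z' v} hz hz' hv => by
    obtain ⟨K, hK, hKb⟩ := hGz hz hz' hv
    rw [hK, ← mul_assoc]
    have h1 := ops.weak_D₀ (u z - u z')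
    have h2 := hul z z' (hz.trans c1) (hz'.trans c1)
    refine (norm_mul_le _ _).trans (mul_le_mul (h1.trans (by linarith)) ?_ (norm_nonneg _)
      (by positivity))
    exact (norm_mul_le _ _).trans (mul_le_mul (hDV hv) hKb (norm_nonneg _) (by positivity))
  have hG0 : ∀ z, G z 0 = 0 := fun z => by
    simp only [G, map_zero]
    exact forceDifference_zero ops.cancel _
  let Ψ : ℂ → A → A := fun z v => Λ v + S (G z v) + P₀ (ε • f - u z)
  -- the decaying part for a given travelling wave
  have hvex : ∀ z, ‖z‖ ≤ Z → ∃ v, ‖v‖ ≤ V ∧ Ψ z v = v := by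
    intro z hz
    have hlip : ∀ x y, ‖x‖ ≤ V → ‖y‖ ≤ V → ‖Ψ z x - Ψ z y‖ ≤ q' * ‖x - y‖ := by
      intro x y hx hy
      have e : Ψ z x - Ψ z y = Λ (x - y) + S (G z x - G z y) := by
        simp only [Ψ, map_sub]; abel
      rw [e]
      have h1 := ops.norm_Λ (x - y)
      have h2 := ops.norm_S (G z x - G z y)
      have h3 := mul_le_mul_of_nonneg_left (hGv1 hz hx hy) hCs.le
      have h4 := mul_le_mul_of_nonneg_right c3 (norm_nonneg (x - y))
      have h5 := norm_add_le (Λ (x - y)) (S (G z x - G z y))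
      have h6 : Cs * (Cg * M * (2 * ‖x - y‖)) = J * M * 2 * ‖x - y‖ := by rw [hJ]; ring
      have h7 : (1 - q') * ‖x - y‖ = (q' - q) * ‖x - y‖ := by rw [hq']; ring
      rw [h6] at h3
      rw [h7] at h4
      linarith
    obtain ⟨v, hv, hv'⟩ := exists_fixedPoint_closedBall (f := Ψ z) (x₀ := 0) hV0 hq'0 hq'1
      (fun x hx => by
        rw [sub_zero] at hx ⊢
        have h1 := hlip x 0 hx (by simpa using hV0)
        have h2 : Ψ z 0 = P₀ (ε • f - u z) := by simp only [Ψ, hG0, map_zero, zero_add]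
        have h3 : ‖Ψ z 0‖ ≤ (1 - q') * V := by
          rw [h2]
          have h4 : (1 - q') * V = B * δ + C * Z := by
            rw [hV, hcv, hZ]; field_simp
          rw [h4]
          refine (ops.norm_P₀ _).trans ((norm_sub_le _ _).trans (add_le_add ?_ ?_))
          · rw [norm_smul, Real.norm_eq_abs, mul_comm]
            exact mul_le_mul_of_nonneg_right hf hδ0
          · exact (hu z (hz.trans c1)).trans (mul_le_mul_of_nonneg_left hz hC.le)
        rw [sub_zero] at h1
        have h5 : ‖Ψ z x‖ ≤ ‖Ψ z x - Ψ z 0‖ + ‖Ψ z 0‖ := by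
          simpa using norm_add_le (Ψ z x - Ψ z 0) (Ψ z 0)
        have h6 := mul_le_mul_of_nonneg_left hx hq'0
        linarith)
      (fun x y hx hy => hlip x y (by simpa using hx) (by simpa using hy))
    exact ⟨v, by simpa using hv, hv'⟩
  choose! v hv using hvex
  -- The resonant boundary value comes from the nonlinear source alone, hence is of second order in
  -- `ε`.
  have hℓv : ∀ z, ‖z‖ ≤ Z → ℓ (v z) = ℓ (S (G z (v z))) := by
    intro z hz
    conv_lhs => rw [← (hv z hz).2]
    simp only [Ψ, map_add, ops.ℓ_Λ, ops.ℓ_P₀, zero_add, add_zero]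
  have hℓb : ∀ z, ‖z‖ ≤ Z → ‖ℓ (v z)‖ ≤ B * δ := by
    intro z hz
    rw [hℓv z hz]
    have h1 := hGv1 hz (hv z hz).1 (v' := 0) (by simpa using hV0)
    rw [hG0, sub_zero, sub_zero] at h1
    have h2 := (ops.norm_ℓ (S (G z (v z)))).trans ((ops.norm_E' _).trans (ops.norm_S _))
    have h3 := mul_le_mul_of_nonneg_right c4 hδ0
    calc _ ≤ Cs * (Cg * M * (2 * V)) := h2.trans (mul_le_mul_of_nonneg_left (h1.trans
            (mul_le_mul_of_nonneg_left (mul_le_mul_of_nonneg_left (hv z hz).1 zero_le_two)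
              (by positivity))) hCs.le)
      _ = J * M * (2 * cv) * δ := by rw [hJ, hV]; ring
      _ ≤ _ := h3
  have hGdiff : ∀ z z', ‖z‖ ≤ Z → ‖z'‖ ≤ Z →
      ‖E' * (G z (v z) - G z' (v z'))‖ ≤ Cg * M * (2 * ‖E' * (v z - v z')‖)
        + 3 * (C * ‖z - z'‖) * (2 * V * Cg) := by
    intro z z' hz hz'
    have e : E' * (G z (v z) - G z' (v z')) = E' * (G z (v z) - G z (v z'))
        + E' * (G z (v z') - G z' (v z')) := by ring
    rw [e]
    exact (norm_add_le _ _).trans (add_le_add (hGv2 hz (hv z hz).1 (hv z' hz').1)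
      (hGz2 hz hz' (hv z' hz').1))
  have hvl : ∀ z z', ‖z‖ ≤ Z → ‖z'‖ ≤ Z → ‖E' * (v z - v z')‖ ≤ Lv * ‖z - z'‖ := by
    intro z z' hz hz'
    have e : E' * (v z - v z') = E' * Λ (v z - v z') + E' * S (G z (v z) - G z' (v z'))
        - E' * P₀ (u z - u z') := by
      conv_lhs => rw [← (hv z hz).2, ← (hv z' hz').2]
      simp only [Ψ, map_sub]; ring
    have h1 := ops.weak_Λ (v z - v z')
    have h2 := ops.weak_S (G z (v z) - G z' (v z'))
    have h3 := mul_le_mul_of_nonneg_left (hGdiff z z' hz hz') hCs.le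
    have h4 := (ops.weak_P₀ (u z - u z')).trans (hul z z' (hz.trans c1) (hz'.trans c1))
    have h5 : ‖E' * (v z - v z')‖ ≤ ‖E' * Λ (v z - v z')‖ + ‖E' * S (G z (v z) - G z' (v z'))‖
        + ‖E' * P₀ (u z - u z')‖ := by
      conv_lhs => rw [e]
      exact (norm_sub_le _ _).trans (add_le_add (norm_add_le _ _) le_rfl)
    set x := ‖E' * (v z - v z')‖ with hx
    have hx0 : 0 ≤ x := norm_nonneg _
    have h6 := mul_le_mul_of_nonneg_right c3 hx0
    have h7 : Cs * (Cg * M * (2 * x) + 3 * (C * ‖z - z'‖) * (2 * V * Cg))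
        = J * M * 2 * x + J * (3 * C) * 2 * V * ‖z - z'‖ := by rw [hJ]; ring
    rw [h7] at h3
    have h8 : J * (3 * C) * 2 * V * ‖z - z'‖ ≤ J * (3 * C) * 2 * 1 * ‖z - z'‖ := by gcongr
    have h9 : (1 - q') * x = (q' - q) * x := by rw [hq']; ring
    have h10 : (1 - q') * x ≤ (J * (3 * C) * 2 + C) * ‖z - z'‖ := by linarith
    rw [hLv, div_mul_eq_mul_div, le_div_iff₀ h1q]
    linarith
  -- The factor `δ` survives because `G` is at least quadratic; with it the outer map contracts for
  -- small `ε`.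
  have hℓl : ∀ z z', ‖z‖ ≤ Z → ‖z'‖ ≤ Z → ‖ℓ (v z) - ℓ (v z')‖
      ≤ J * (cM * 2 * Lv + 6 * C * cv) * δ * ‖z - z'‖ := by
    intro z z' hz hz'
    rw [hℓv z hz, hℓv z' hz', ← map_sub, ← map_sub]
    have h1 := (ops.norm_ℓ (S (G z (v z) - G z' (v z')))).trans (ops.weak_S _)
    refine h1.trans ((mul_le_mul_of_nonneg_left (hGdiff z z' hz hz') hCs.le).trans ?_)
    have h2 := hvl z z' hz hz'
    calc _ ≤ Cs * (Cg * M * (2 * (Lv * ‖z - z'‖)) + 3 * (C * ‖z - z'‖) * (2 * V * Cg)) := by gcongr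
      _ = _ := by rw [hJ, hM, hV]; ring
  -- the matching of the resonant modes
  let Φ : ℂ → ℂ := fun z => -(2 * Real.sin (β z / 2) : ℝ) * Complex.I * (ε * ℓ f - ℓ (v z))
  have hℓf : ‖(ε : ℂ) * ℓ f‖ ≤ B * δ := by
    rw [norm_mul, Complex.norm_real, Real.norm_eq_abs, mul_comm]
    exact mul_le_mul_of_nonneg_right ((ops.norm_ℓ f).trans ((ops.norm_E' f).trans hf)) hδ0
  have hrhs : ∀ z, ‖z‖ ≤ Z → ‖(ε : ℂ) * ℓ f - ℓ (v z)‖ ≤ 2 * B * δ := fun z hz => by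
    have h1 := norm_sub_le ((ε : ℂ) * ℓ f) (ℓ (v z))
    have h2 := hℓb z hz
    linarith
  obtain ⟨z, hz, hΦz⟩ := exists_fixedPoint_closedBall (f := Φ) (x₀ := 0) (r := Z) (q := 1 / 2)
    (by positivity) (by norm_num) (by norm_num)
    (fun z hz => by
      rw [sub_zero] at hz ⊢
      have h1 := hrhs z hz
      have h2 := Real.abs_sin_le_one (β z / 2)
      simp only [Φ]
      rw [norm_mul, norm_mul, Complex.norm_I, mul_one, norm_neg, Complex.norm_real,
        Real.norm_eq_abs, abs_mul, abs_two]
      calc _ ≤ 2 * 1 * (2 * B * δ) := by gcongr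
        _ = Z := by rw [hZ, hcz]; ring)
    (fun z z' hz hz' => by
      rw [sub_zero] at hz hz'
      have e : Φ z - Φ z' = -Complex.I * (((2 * (Real.sin (β z / 2) - Real.sin (β z' / 2)) : ℝ) : ℂ)
          * (ε * ℓ f - ℓ (v z)) - ((2 * Real.sin (β z' / 2) : ℝ) : ℂ) * (ℓ (v z) - ℓ (v z'))) := by
        simp only [Φ]; push_cast; ring
      have h1 := abs_sin_sub_sin_le (β z / 2) (β z' / 2)
      rw [← sub_div, abs_div, abs_two] at h1
      have h2 := hβ z z' (hz.trans c1) (hz'.trans c1)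
      have h3 := hrhs z hz
      have h4 := hℓl z z' hz hz'
      have h5 := Real.abs_sin_le_one (β z' / 2)
      rw [e, norm_mul, norm_neg, Complex.norm_I, one_mul]
      refine (norm_sub_le _ _).trans ?_
      rw [norm_mul, norm_mul, Complex.norm_real, Complex.norm_real, Real.norm_eq_abs,
        Real.norm_eq_abs, abs_mul, abs_mul, abs_two]
      have h6 : |Real.sin (β z / 2) - Real.sin (β z' / 2)| ≤ C * ‖z - z'‖ / 2 := by linarith
      calc _ ≤ 2 * (C * ‖z - z'‖ / 2) * (2 * B * δ)
            + 2 * 1 * (J * (cM * 2 * Lv + 6 * C * cv) * δ * ‖z - z'‖) := by gcongr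
        _ = (2 * C * B + 2 * J * (cM * 2 * Lv + 6 * C * cv)) * δ * ‖z - z'‖ := by ring
        _ ≤ _ := mul_le_mul_of_nonneg_right c6 (norm_nonneg _))
  rw [sub_zero] at hz
  obtain ⟨hvz, hΨz⟩ := hv z hz
  refine ⟨z, v z, G z (v z), hz.trans c1, hz.trans ?_, hvz.trans ?_, ?_, ?_,
    mul_forceDifference hb c2 (hUM hz) (hUXM hz hvz), hΨz.symm, hΦz.symm⟩
  · exact mul_le_mul_of_nonneg_right (by linarith) hδ0
  · exact mul_le_mul_of_nonneg_right (by linarith) hδ0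
  · exact (mul_le_mul_of_nonneg_right (hUM hz) hR.le).trans c2
  · exact (mul_le_mul_of_nonneg_right (hUXM hz hvz) hR.le).trans c2

end Abstract

/-! ### Operators on the half line -/

/-- A bounded linear operator on `BddSeq`, given by its entries. -/
noncomputable def BddSeq.lin (T : BddSeq → ℕ → ℂ) (C : ℝ)
    (hadd : ∀ f g n, T (f + g) n = T f n + T g n) (hsmul : ∀ (c : ℝ) f n, T (c • f) n = c • T f n)
    (hC : ∀ f n, ‖T f n‖ ≤ C * ‖f‖) : BddSeq →ₗ[ℝ] BddSeq where
  toFun f := BddSeq.mk (T f) (C * ‖f‖) (hC f)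
  map_add' f g := by ext n; exact hadd f g n
  map_smul' c f := by ext n; exact hsmul c f n

/-- Diagonal operators on the Wiener algebra whose entries act on `BddSeq`. -/
noncomputable def siteOp {w : SymmWeight} (T : ℤ → BddSeq → ℕ → ℂ) (C : ℝ)
    (hadd : ∀ m f g n, T m (f + g) n = T m f n + T m g n)
    (hsmul : ∀ m (c : ℝ) f n, T m (c • f) n = c • T m f n)
    (hC : ∀ m f n, ‖T m f n‖ ≤ C * ‖f‖)
    (hs : ∀ m f n, T (-m) (star f) n = (starRingEnd ℂ) (T m f n)) :
    Wiener w BddSeq →ₗ[ℝ] Wiener w BddSeq :=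
  Wiener.diag (fun m => BddSeq.lin (T m) C (hadd m) (hsmul m) (hC m)) C
    (fun m f => BddSeq.norm_mk_le (hC m f)) fun m f => by ext n; exact hs m f n

section siteOp

variable {w : SymmWeight} {T : ℤ → BddSeq → ℕ → ℂ} {C : ℝ}
    {hadd : ∀ m f g n, T m (f + g) n = T m f n + T m g n}
    {hsmul : ∀ m (c : ℝ) f n, T m (c • f) n = c • T m f n}
    {hC : ∀ m f n, ‖T m f n‖ ≤ C * ‖f‖}
    {hs : ∀ m f n, T (-m) (star f) n = (starRingEnd ℂ) (T m f n)}

lemma siteOp_apply (v : Wiener w BddSeq) (m : ℤ) (n : ℕ) :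
    siteOp T C hadd hsmul hC hs v m n = T m (v m) n := rfl

lemma norm_siteOp_le (v : Wiener w BddSeq) : ‖siteOp T C hadd hsmul hC hs v‖ ≤ C * ‖v‖ :=
  Wiener.norm_diag_le _ _ _ _ _

end siteOp

variable {κ : ℝ}

lemma disp_two_le {m : ℤ} (hκ : 0 < κ) (hm : 2 ≤ |m|) : disp κ 2 ≤ disp κ m := by
  have := four_le_sq hm
  simp only [disp]; push_cast; nlinarith

lemma disp_two_pos (hκ : 1 < κ) : 0 < disp κ 2 := by
  simp only [disp]; push_cast; linarith

/-- The neighbour coupling of the nonresonant modes. -/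
noncomputable def couplingFun (κ σ : ℝ) (m : ℤ) (f : BddSeq) (n : ℕ) : ℂ :=
  -- Site `0` is excluded since its value is prescribed by the boundary operator; this also keeps
  -- the truncated `n - 1` honest.
  if 2 ≤ |m| ∧ n ≠ 0 then
    -((disp κ m)⁻¹ : ℝ) * ((Real.exp σ : ℝ) * f (n - 1) + (Real.exp (-σ) : ℝ) * f (n + 1)) else 0

lemma norm_couplingFun_le (hκ : 1 < κ) (σ : ℝ) (m : ℤ) (f : BddSeq) (n : ℕ) :
    ‖couplingFun κ σ m f n‖ ≤ (2 * Real.cosh σ / disp κ 2) * ‖f‖ := by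
  have h2 := disp_two_pos hκ
  have hc := Real.cosh_pos σ
  rw [couplingFun]
  split_ifs with h
  · have h3 := disp_two_le (one_pos.trans hκ) h.1
    rw [norm_mul, norm_neg, Complex.norm_real, Real.norm_of_nonneg (by
      have := h2.trans_le h3; positivity)]
    have h4 : ‖((Real.exp σ : ℝ) : ℂ) * f (n - 1) + (Real.exp (-σ) : ℝ) * f (n + 1)‖
        ≤ 2 * Real.cosh σ * ‖f‖ := by
      refine (norm_add_le _ _).trans ?_
      rw [norm_mul, norm_mul, Complex.norm_real, Complex.norm_real,
        Real.norm_of_nonneg (Real.exp_pos _).le, Real.norm_of_nonneg (Real.exp_pos _).le]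
      have e : 2 * Real.cosh σ * ‖f‖ = Real.exp σ * ‖f‖ + Real.exp (-σ) * ‖f‖ := by
        rw [Real.cosh_eq]; ring
      rw [e]
      gcongr <;> exact f.norm_coe_le_norm _
    calc _ ≤ (disp κ 2)⁻¹ * (2 * Real.cosh σ * ‖f‖) := by gcongr
      _ = _ := by ring
  · rw [norm_zero]; positivity

/-- The operator of the neighbour coupling, in the weight `e^{σ n}`. -/
noncomputable def couplingOp (w : SymmWeight) (hκ : 1 < κ) (σ : ℝ) :
    Wiener w BddSeq →ₗ[ℝ] Wiener w BddSeq :=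
  siteOp (couplingFun κ σ) (2 * Real.cosh σ / disp κ 2)
    (fun m f g n => by
      simp only [couplingFun, BoundedContinuousFunction.add_apply]; split_ifs <;> ring)
    (fun m c f n => by
      simp only [couplingFun, BoundedContinuousFunction.smul_apply, Complex.real_smul]
      split_ifs <;> ring)
    (norm_couplingFun_le hκ σ)
    (fun m f n => by
      simp only [couplingFun, BoundedContinuousFunction.star_apply, abs_neg, disp_neg]
      split_ifs <;> simp [← Complex.exp_conj])

/-- The summation kernel of the resonant modes. -/
noncomputable def tailCoeff (κ : ℝ) (m : ℤ) (j : ℕ) : ℝ :=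
  Real.cos ((j + 1 / 2) * Real.arccos (-disp κ m / 2)) / Real.cos (Real.arccos (-disp κ m / 2) / 2)

lemma neg_disp_half_mem (hκ : 1 < κ) (hκ4 : κ < 4) {m : ℤ} (hm : ¬ 2 ≤ |m|) :
    -1 < -disp κ m / 2 ∧ -disp κ m / 2 ≤ 1 := by
  have : m = 0 ∨ m = 1 ∨ m = -1 := by
    have := abs_lt.1 (not_le.1 hm); omega
  rcases this with rfl | rfl | rfl <;> simp only [disp] <;> push_cast <;> constructor <;> linarith

lemma cos_half_arccos_pos {x : ℝ} (hx : -1 < x) : 0 < Real.cos (Real.arccos x / 2) := by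
  have h0 := Real.arccos_nonneg x
  have h1 : Real.arccos x < Real.pi :=
    (Real.arccos_le_pi x).lt_of_ne fun h => hx.not_ge (Real.arccos_eq_pi.1 h)
  exact Real.cos_pos_of_mem_Ioo ⟨by linarith [Real.pi_pos], by linarith⟩

lemma tailCoeff_zero (hκ : 1 < κ) (hκ4 : κ < 4) {m : ℤ} (hm : ¬ 2 ≤ |m|) :
    tailCoeff κ m 0 = 1 := by
  have h := cos_half_arccos_pos (neg_disp_half_mem hκ hκ4 hm).1
  rw [tailCoeff, Nat.cast_zero, zero_add, one_div_mul_eq_div, div_self h.ne']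

lemma tailCoeff_one (hκ : 1 < κ) (hκ4 : κ < 4) {m : ℤ} (hm : ¬ 2 ≤ |m|) :
    tailCoeff κ m 1 = -disp κ m - 1 := by
  obtain ⟨h1, h2⟩ := neg_disp_half_mem hκ hκ4 hm
  have h := cos_half_arccos_pos h1
  have hc : Real.cos (Real.arccos (-disp κ m / 2)) = -disp κ m / 2 := Real.cos_arccos h1.le h2
  set φ := Real.arccos (-disp κ m / 2) with hφ
  rw [tailCoeff, ← hφ, div_eq_iff h.ne',
    show ((1 : ℕ) + 1 / 2 : ℝ) * φ = 3 * (φ / 2) by push_cast; ring, Real.cos_three_mul]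
  have : Real.cos φ = 2 * Real.cos (φ / 2) ^ 2 - 1 := by
    rw [← Real.cos_two_mul]; ring_nf
  rw [this] at hc
  have h3 : disp κ m = 2 - 4 * Real.cos (φ / 2) ^ 2 := by linarith
  rw [h3]; ring

/-- With `cos φ = -δ_m/2`, the Green's function is `sin ((j+1)φ)/sin φ`. The source is a difference,
and summation by parts produces the kernel `cos ((j+1/2)φ)/cos (φ/2)`, which stays bounded even at
the double root `φ = 0` of mode `m = 0`. -/
lemma tailCoeff_add_two (hκ : 1 < κ) (hκ4 : κ < 4) {m : ℤ} (hm : ¬ 2 ≤ |m|) (j : ℕ) :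
    tailCoeff κ m j + disp κ m * tailCoeff κ m (j + 1) + tailCoeff κ m (j + 2) = 0 := by
  obtain ⟨h1, h2⟩ := neg_disp_half_mem hκ hκ4 hm
  have h := cos_half_arccos_pos h1
  have hc : Real.cos (Real.arccos (-disp κ m / 2)) = -disp κ m / 2 := Real.cos_arccos h1.le h2
  set φ := Real.arccos (-disp κ m / 2) with hφ
  have h3 : disp κ m = -(2 * Real.cos φ) := by linarith
  simp only [tailCoeff, ← hφ]
  rw [h3]
  have h4 : Real.cos ((j + 1 / 2) * φ) + Real.cos (((j + 2 : ℕ) + 1 / 2) * φ)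
      = 2 * Real.cos φ * Real.cos (((j + 1 : ℕ) + 1 / 2) * φ) := by
    rw [Real.cos_add_cos]
    push_cast
    rw [show ((j + 1 / 2 : ℝ) * φ + (j + 2 + 1 / 2) * φ) / 2 = (j + 1 + 1 / 2) * φ by ring,
      show ((j + 1 / 2 : ℝ) * φ - (j + 2 + 1 / 2) * φ) / 2 = -φ by ring, Real.cos_neg]
    ring
  generalize Real.cos (φ / 2) = s at *
  calc _ = (Real.cos ((j + 1 / 2) * φ) + Real.cos (((j + 2 : ℕ) + 1 / 2) * φ)
        - 2 * Real.cos φ * Real.cos (((j + 1 : ℕ) + 1 / 2) * φ)) / s := by ring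
    _ = 0 := by rw [h4, sub_self, zero_div]

lemma exists_tailCoeff_bound (hκ : 1 < κ) (hκ4 : κ < 4) :
    ∃ C : ℝ, 0 < C ∧ ∀ m : ℤ, ¬ 2 ≤ |m| → ∀ j, |tailCoeff κ m j| ≤ C := by
  have key : ∀ m : ℤ, ¬ 2 ≤ |m| → ∀ j,
      |tailCoeff κ m j| ≤ 1 / Real.cos (Real.arccos (-disp κ m / 2) / 2) := fun m hm j => by
    have h := cos_half_arccos_pos (neg_disp_half_mem hκ hκ4 hm).1
    rw [tailCoeff, abs_div, abs_of_pos h]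
    gcongr
    exact Real.abs_cos_le_one _
  have h0 := cos_half_arccos_pos (neg_disp_half_mem hκ hκ4 (m := 0) (by norm_num)).1
  have h1 := cos_half_arccos_pos (neg_disp_half_mem hκ hκ4 (m := 1) (by norm_num)).1
  refine ⟨1 / Real.cos (Real.arccos (-disp κ 0 / 2) / 2)
    + 1 / Real.cos (Real.arccos (-disp κ 1 / 2) / 2), by positivity, fun m hm j => ?_⟩
  have : m = 0 ∨ m = 1 ∨ m = -1 := by
    have := abs_lt.1 (not_le.1 hm); omega
  have p0 := one_div_pos.2 h0
  have p1 := one_div_pos.2 h1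
  rcases this with rfl | rfl | rfl
  · exact (key 0 hm j).trans (by linarith)
  · exact (key 1 hm j).trans (by linarith)
  · refine (key (-1) hm j).trans ?_
    rw [disp_neg]; linarith

/-- The solution operator applied to the force, mode by mode. -/
noncomputable def sourceFun (κ σ : ℝ) (m : ℤ) (f : BddSeq) (n : ℕ) : ℂ :=
  if 2 ≤ |m| then
    if n = 0 then 0 else ((disp κ m)⁻¹ : ℝ) * (f n - (Real.exp σ : ℝ) * f (n - 1))
  -- Summing from infinity selects the decaying solution, leaving no boundary value to prescribe for
  -- `|m| ≤ 1`.
  else -∑' j : ℕ, ((tailCoeff κ m j * Real.exp (-σ * j) : ℝ) : ℂ) * f (n + j)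

lemma exp_neg_mul_nat (σ : ℝ) (j : ℕ) : Real.exp (-σ * j) = Real.exp (-σ) ^ j := by
  rw [← Real.exp_nat_mul]; ring_nf

lemma hasSum_exp_neg_mul {σ : ℝ} (hσ : 0 < σ) :
    HasSum (fun j : ℕ => Real.exp (-σ * j)) (1 - Real.exp (-σ))⁻¹ := by
  simp only [exp_neg_mul_nat]
  exact hasSum_geometric_of_lt_one (Real.exp_pos _).le (by rw [Real.exp_lt_one_iff]; linarith)

lemma norm_tail_term_le {C σ : ℝ} {m : ℤ} (hC : ∀ j, |tailCoeff κ m j| ≤ C) (f : BddSeq) (n j : ℕ) :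
    ‖((tailCoeff κ m j * Real.exp (-σ * j) : ℝ) : ℂ) * f (n + j)‖
      ≤ C * ‖f‖ * Real.exp (-σ * j) := by
  rw [norm_mul, Complex.norm_real, Real.norm_eq_abs, abs_mul, abs_of_pos (Real.exp_pos _)]
  have := f.norm_coe_le_norm (n + j)
  have h0 : 0 ≤ C := (abs_nonneg _).trans (hC 0)
  calc _ ≤ C * Real.exp (-σ * j) * ‖f‖ := by gcongr; exact hC j
    _ = _ := by ring

lemma summable_tail {C σ : ℝ} (hσ : 0 < σ) {m : ℤ} (hC : ∀ j, |tailCoeff κ m j| ≤ C)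
    (f : BddSeq) (n : ℕ) :
    Summable fun j : ℕ => ((tailCoeff κ m j * Real.exp (-σ * j) : ℝ) : ℂ) * f (n + j) :=
  Summable.of_norm_bounded ((hasSum_exp_neg_mul hσ).summable.mul_left (C * ‖f‖))
    (norm_tail_term_le hC f n)

lemma norm_sourceFun_le (hκ : 1 < κ) {C σ : ℝ} (hσ : 0 < σ) (hC0 : 0 < C)
    (hC : ∀ m : ℤ, ¬ 2 ≤ |m| → ∀ j, |tailCoeff κ m j| ≤ C) (m : ℤ) (f : BddSeq) (n : ℕ) :
    ‖sourceFun κ σ m f n‖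
      ≤ ((1 + Real.exp σ) / disp κ 2 + C * (1 - Real.exp (-σ))⁻¹) * ‖f‖ := by
  have h2 := disp_two_pos hκ
  have h1 : 0 < 1 - Real.exp (-σ) := by
    have : Real.exp (-σ) < 1 := by rw [Real.exp_lt_one_iff]; linarith
    linarith
  have he := Real.exp_pos σ
  have hpos : 0 ≤ C * (1 - Real.exp (-σ))⁻¹ * ‖f‖ := by positivity
  have hpos2 : 0 ≤ (1 + Real.exp σ) / disp κ 2 * ‖f‖ := by positivity
  rw [sourceFun, add_mul]
  split_ifs with hm hn
  · rw [norm_zero]; positivity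
  · have h3 := disp_two_le (one_pos.trans hκ) hm
    rw [norm_mul, Complex.norm_real, Real.norm_of_nonneg (by
      have := h2.trans_le h3; positivity)]
    have h4 : ‖f n - (Real.exp σ : ℝ) * f (n - 1)‖ ≤ (1 + Real.exp σ) * ‖f‖ := by
      refine (norm_sub_le _ _).trans ?_
      rw [norm_mul, Complex.norm_real, Real.norm_of_nonneg he.le, add_mul, one_mul]
      gcongr <;> exact f.norm_coe_le_norm _
    calc _ ≤ (disp κ 2)⁻¹ * ((1 + Real.exp σ) * ‖f‖) := by gcongr
      _ = (1 + Real.exp σ) / disp κ 2 * ‖f‖ := by ring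
      _ ≤ _ := by linarith
  · rw [norm_neg]
    have := tsum_of_norm_bounded ((hasSum_exp_neg_mul hσ).mul_left (C * ‖f‖))
      (norm_tail_term_le (hC m hm) f n)
    refine this.trans ?_
    linarith

/-- The solution operator applied to the force, in the weight `e^{σ n}`. -/
noncomputable def sourceOp (w : SymmWeight) (hκ : 1 < κ) {C σ : ℝ} (hσ : 0 < σ) (hC0 : 0 < C)
    (hC : ∀ m : ℤ, ¬ 2 ≤ |m| → ∀ j, |tailCoeff κ m j| ≤ C) :
    Wiener w BddSeq →ₗ[ℝ] Wiener w BddSeq :=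
  siteOp (sourceFun κ σ) ((1 + Real.exp σ) / disp κ 2 + C * (1 - Real.exp (-σ))⁻¹)
    (fun m f g n => by
      simp only [sourceFun, BoundedContinuousFunction.add_apply]
      split_ifs with hm
      · ring
      · ring
      · simp only [mul_add]
        rw [(summable_tail hσ (hC m hm) f n).tsum_add (summable_tail hσ (hC m hm) g n), neg_add])
    (fun m c f n => by
      simp only [sourceFun, BoundedContinuousFunction.smul_apply, Complex.real_smul]
      split_ifs with hm
      · ring
      · ring
      · rw [mul_neg, ← tsum_mul_left]
        congr 1
        exact tsum_congr fun j => by ring)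
    (norm_sourceFun_le hκ hσ hC0 hC)
    (fun m f n => by
      simp only [sourceFun, BoundedContinuousFunction.star_apply, abs_neg, tailCoeff, disp_neg]
      split_ifs with hm
      · simp
      · simp [← Complex.exp_conj]
      · rw [map_neg, Complex.conj_tsum]
        congr 1
        exact tsum_congr fun j => by rw [map_mul, Complex.conj_ofReal]; rfl)

/-- The boundary values of the nonresonant modes. -/
noncomputable def boundaryFun (m : ℤ) (f : BddSeq) (n : ℕ) : ℂ :=
  if 2 ≤ |m| ∧ n = 0 then f 0 else 0

/-- The projection onto the boundary values of the nonresonant modes. -/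
noncomputable def boundaryOp (w : SymmWeight) : Wiener w BddSeq →ₗ[ℝ] Wiener w BddSeq :=
  siteOp boundaryFun 1
    (fun m f g n => by simp only [boundaryFun]; split_ifs <;> simp)
    (fun m c f n => by simp only [boundaryFun]; split_ifs <;> simp)
    (fun m f n => by
      rw [boundaryFun, one_mul]
      split_ifs
      · exact f.norm_coe_le_norm 0
      · rw [norm_zero]; positivity)
    (fun m f n => by simp only [boundaryFun, abs_neg]; split_ifs <;> simp)

/-- The difference of neighbours, in the weight `e^{σ n}`. -/
noncomputable def differenceOp (w : SymmWeight) (σ : ℝ) : Wiener w BddSeq →ₗ[ℝ] Wiener w BddSeq :=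
  siteOp (fun _ f n => f n - (Real.exp (-σ) : ℝ) * f (n + 1)) (1 + Real.exp (-σ))
    (fun m f g n => by simp only [BoundedContinuousFunction.add_apply]; ring)
    (fun m c f n => by
      simp only [BoundedContinuousFunction.smul_apply, Complex.real_smul]; ring)
    (fun m f n => by
      refine (norm_sub_le _ _).trans ?_
      rw [norm_mul, Complex.norm_real, Real.norm_of_nonneg (Real.exp_pos _).le, add_mul, one_mul]
      gcongr <;> exact f.norm_coe_le_norm _)
    (fun m f n => by simp [← Complex.exp_conj])

/-- The value of the first mode at the boundary. -/
noncomputable def firstMode (w : SymmWeight) : Wiener w BddSeq →ₗ[ℝ] ℂ where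
  toFun v := v 1 0
  map_add' _ _ := rfl
  map_smul' _ _ := rfl

lemma firstMode_apply {w : SymmWeight} (v : Wiener w BddSeq) : firstMode w v = v 1 0 := rfl

lemma exp_mul_exp_shift (τ σ : ℝ) (n : ℕ) :
    ((Real.exp (-τ * (n + 1 : ℕ)) : ℝ) : ℂ) * (Real.exp σ : ℝ)
      = (Real.exp (σ - τ) : ℝ) * (Real.exp (-τ * n) : ℝ) := by
  rw [← Complex.ofReal_mul, ← Complex.ofReal_mul, ← Real.exp_add, ← Real.exp_add]
  push_cast; ring_nf

lemma exp_mul_exp_neg (τ σ : ℝ) (n : ℕ) : ((Real.exp (-τ * n) : ℝ) : ℂ) * (Real.exp (-σ) : ℝ)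
    = (Real.exp (-(σ - τ)) : ℝ) * (Real.exp (-τ * (n + 1 : ℕ)) : ℝ) := by
  rw [← Complex.ofReal_mul, ← Complex.ofReal_mul, ← Real.exp_add, ← Real.exp_add]
  push_cast; ring_nf

/-- Conjugating a shift by `e^{-τn}` merely lowers the rate `σ` to `σ - τ`. Taken with `τ = σ/2` for
the half-line operators, this and its analogues reduce every weak bound to a strong one at another
rate. -/
lemma decay_mul_couplingOp {w : SymmWeight} (hκ : 1 < κ) (σ : ℝ) {τ : ℝ} (hτ : 0 ≤ τ)
    (a : Wiener w BddSeq) :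
    decay w hτ * couplingOp w hκ σ a = couplingOp w hκ (σ - τ) (decay w hτ * a) := by
  refine Wiener.ext fun m => ?_
  ext n
  rw [decay_mul_apply, couplingOp, couplingOp, siteOp_apply, siteOp_apply]
  simp only [couplingFun, decay_mul_apply]
  rcases n with _ | n
  · simp
  · split_ifs with h
    · simp only [Nat.add_sub_cancel]
      linear_combination (-((disp κ m)⁻¹ : ℝ) : ℂ) * (a m n * exp_mul_exp_shift τ σ n
        + a m (n + 2) * exp_mul_exp_neg τ σ (n + 1))
    · rw [mul_zero]

lemma decay_mul_sourceOp {w : SymmWeight} (hκ : 1 < κ) {C σ τ : ℝ} (hσ : 0 < σ) (hτ : 0 ≤ τ)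
    (hστ : 0 < σ - τ) (hC0 : 0 < C) (hC : ∀ m : ℤ, ¬ 2 ≤ |m| → ∀ j, |tailCoeff κ m j| ≤ C)
    (a : Wiener w BddSeq) :
    decay w hτ * sourceOp w hκ hσ hC0 hC a = sourceOp w hκ hστ hC0 hC (decay w hτ * a) := by
  refine Wiener.ext fun m => ?_
  ext n
  rw [decay_mul_apply, sourceOp, sourceOp, siteOp_apply, siteOp_apply]
  simp only [sourceFun, decay_mul_apply]
  split_ifs with hm hn
  · rw [mul_zero]
  · obtain ⟨n, rfl⟩ := Nat.exists_eq_succ_of_ne_zero hn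
    simp only [Nat.succ_eq_add_one, Nat.add_sub_cancel]
    linear_combination (-((disp κ m)⁻¹ : ℝ) : ℂ) * (a m n * exp_mul_exp_shift τ σ n)
  · rw [mul_neg, ← tsum_mul_left]
    congr 1
    refine tsum_congr fun j => ?_
    rw [← mul_assoc, ← mul_assoc, ← Complex.ofReal_mul, ← Complex.ofReal_mul]
    congr 2
    rw [mul_left_comm, mul_assoc, ← Real.exp_add, ← Real.exp_add]
    push_cast; ring_nf

lemma decay_mul_boundaryOp {w : SymmWeight} {τ : ℝ} (hτ : 0 ≤ τ) (a : Wiener w BddSeq) :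
    decay w hτ * boundaryOp w a = boundaryOp w (decay w hτ * a) := by
  refine Wiener.ext fun m => ?_
  ext n
  rw [decay_mul_apply, boundaryOp, siteOp_apply, siteOp_apply]
  simp only [boundaryFun, decay_mul_apply]
  split_ifs with h
  · rw [h.2]
  · rw [mul_zero]

lemma decay_mul_differenceOp {w : SymmWeight} (σ : ℝ) {τ : ℝ} (hτ : 0 ≤ τ) (a : Wiener w BddSeq) :
    decay w hτ * differenceOp w σ a = differenceOp w (σ - τ) (decay w hτ * a) := by
  refine Wiener.ext fun m => ?_
  ext n
  rw [decay_mul_apply, differenceOp, differenceOp, siteOp_apply, siteOp_apply]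
  simp only [decay_mul_apply]
  linear_combination - a m (n + 1) * exp_mul_exp_neg τ σ n

lemma norm_mul_smul {A : Type*} [NormedCommRing A] [NormedAlgebra ℝ A] (r : ℝ) (a b : A) :
    ‖a * r • b‖ = ‖r‖ * ‖a * b‖ := by
  rw [mul_smul_comm, norm_smul]

theorem halfLineOperators (w : SymmWeight) (hκ : 1 < κ) {σ f₁ C : ℝ} (hf₁ : 0 < f₁)
    (hσ : 0 < σ) (hσ1 : σ ≤ 1) (hC0 : 0 < C)
    (hC : ∀ m : ℤ, ¬ 2 ≤ |m| → ∀ j, |tailCoeff κ m j| ≤ C) :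
    HalfLineOperators (decay w hσ.le) (decay w (half_pos hσ).le) (couplingOp w hκ σ)
      (f₁⁻¹ • sourceOp w hκ hσ hC0 hC) (boundaryOp w) (differenceOp w σ)
      (differenceOp w 0) (firstMode w) (2 * Real.cosh σ / disp κ 2)
      (f₁⁻¹ * ((1 + Real.exp σ) / disp κ 2 + C * (1 - Real.exp (-(σ / 2)))⁻¹)) := by
  have h2 := disp_two_pos hκ
  have hσ2 : 0 < σ / 2 := half_pos hσ
  have hsub : σ - σ / 2 = σ / 2 := by ring
  have hexp1 : Real.exp (-(σ / 2)) < 1 := by rw [Real.exp_lt_one_iff]; linarith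
  have hexp1' : 0 < 1 - Real.exp (-(σ / 2)) := by linarith
  have hexp2 : Real.exp (-σ) ≤ Real.exp (-(σ / 2)) := Real.exp_le_exp.2 (by linarith)
  have hexp3 : Real.exp (σ / 2) ≤ Real.exp σ := Real.exp_le_exp.2 (by linarith)
  have hdiff : ∀ s, 0 ≤ s → ∀ a : Wiener w BddSeq, ‖differenceOp w s a‖ ≤ 2 * ‖a‖ :=
    fun s hs a => (norm_siteOp_le a).trans (mul_le_mul_of_nonneg_right (by
      have : Real.exp (-s) ≤ 1 := by rw [Real.exp_le_one_iff]; linarith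
      linarith) (norm_nonneg _))
  refine
  { cancel := fun a b h => ?_
    norm_E := norm_decay_mul_le _
    norm_E' := norm_decay_mul_le _
    norm_Λ := fun a => norm_siteOp_le a
    weak_Λ := fun a => ?_
    norm_S := fun a => ?_
    weak_S := fun a => ?_
    norm_P₀ := fun a => (norm_siteOp_le a).trans (one_mul _).le
    weak_P₀ := fun a => ?_
    norm_D := hdiff σ hσ.le
    weak_D := fun a => ?_
    norm_D₀ := hdiff 0 le_rfl
    weak_D₀ := fun a => ?_
    norm_ℓ := fun a => ?_
    ℓ_Λ := fun a => ?_
    ℓ_P₀ := fun a => ?_ }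
  · refine Wiener.ext fun m => ?_
    ext n
    have := congrArg (fun x : Wiener w BddSeq => x m n) h
    simp only [decay_mul_apply] at this
    exact mul_left_cancel₀ (by exact_mod_cast (Real.exp_pos _).ne') this
  · rw [decay_mul_couplingOp, hsub]
    refine (norm_siteOp_le _).trans (mul_le_mul_of_nonneg_right ?_ (norm_nonneg _))
    have : Real.cosh (σ / 2) ≤ Real.cosh σ := by
      rw [Real.cosh_le_cosh, abs_of_pos hσ, abs_of_pos hσ2]; linarith
    gcongr
  · rw [LinearMap.smul_apply, norm_smul, Real.norm_of_nonneg (inv_pos.2 hf₁).le, mul_assoc]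
    refine mul_le_mul_of_nonneg_left ((norm_siteOp_le a).trans
      (mul_le_mul_of_nonneg_right ?_ (norm_nonneg _))) (inv_pos.2 hf₁).le
    gcongr
  · refine (norm_mul_smul f₁⁻¹ _ _).trans_le ?_
    rw [Real.norm_of_nonneg (inv_pos.2 hf₁).le, mul_assoc, decay_mul_sourceOp hκ hσ hσ2.le (by rw [hsub]; exact hσ2) hC0 hC]
    refine mul_le_mul_of_nonneg_left ((norm_siteOp_le _).trans
      (mul_le_mul_of_nonneg_right ?_ (norm_nonneg _))) (inv_pos.2 hf₁).le
    rw [hsub]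
    gcongr
  · rw [decay_mul_boundaryOp]
    exact (norm_siteOp_le _).trans (one_mul _).le
  · rw [decay_mul_differenceOp, hsub]
    exact hdiff _ hσ2.le _
  · rw [decay_mul_differenceOp]
    refine (norm_siteOp_le _).trans (mul_le_mul_of_nonneg_right ?_ (norm_nonneg _))
    -- Here `σ ≤ 1` is needed: it gives `e^{σ/2} ≤ 2`, hence the norm `1 + e^{σ/2} ≤ 3` of the
    -- unweighted difference conjugated by the weak weight.
    have h3 : Real.exp (σ / 2) ^ 2 ≤ 2.7182818286 := by
      rw [← Real.exp_nat_mul]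
      refine le_trans (Real.exp_le_exp.2 ?_) Real.exp_one_lt_d9.le
      push_cast; linarith
    rw [zero_sub, neg_neg]
    nlinarith
  · have h3 : a 1 0 = (decay w hσ2.le * a) 1 0 := by rw [decay_mul_apply]; simp
    rw [firstMode_apply, h3]
    exact (BoundedContinuousFunction.norm_coe_le_norm _ 0).trans (Wiener.norm_apply_le _ 1)
  · rw [firstMode_apply, couplingOp, siteOp_apply]
    simp [couplingFun]
  · rw [firstMode_apply, boundaryOp, siteOp_apply]
    simp [boundaryFun]

/-! ### The lattice equation for the decaying part -/

/-- Aligning the three sums at `g (n + 2 + j)`, the bulk cancels by `h2`. Only the leading terms `t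
0` and `t 1` remain, and the initial values are chosen so that they leave exactly `g n - g (n+1)`.
-/
lemma tail_sum_recurrence {t g : ℕ → ℂ} {d : ℂ} (h0 : t 0 = 1) (h1 : t 1 = -d - 1)
    (h2 : ∀ j, t j + d * t (j + 1) + t (j + 2) = 0)
    (hs : ∀ n, Summable fun j => t j * g (n + j)) (n : ℕ) :
    ∑' j, t j * g (n + j) + d * ∑' j, t j * g (n + 1 + j) + ∑' j, t j * g (n + 2 + j)
      = g n - g (n + 1) := by
  have s0 := (hs n).sum_add_tsum_nat_add 2
  have s1 := (hs (n + 1)).sum_add_tsum_nat_add 1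
  have t0 : Summable fun j : ℕ => t (j + 2) * g (n + (j + 2)) := (summable_nat_add_iff 2).2 (hs n)
  have t1 : Summable fun j : ℕ => t (j + 1) * g (n + 1 + (j + 1)) :=
    (summable_nat_add_iff 1).2 (hs (n + 1))
  have hz : ∑' j : ℕ, t (j + 2) * g (n + (j + 2)) + d * ∑' j : ℕ, t (j + 1) * g (n + 1 + (j + 1))
      + ∑' j : ℕ, t j * g (n + 2 + j) = 0 := by
    rw [← tsum_mul_left, ← t0.tsum_add (t1.mul_left _),
      ← (t0.add (t1.mul_left _)).tsum_add (hs (n + 2)), ← tsum_zero (β := ℕ)]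
    refine tsum_congr fun j => ?_
    rw [show n + (j + 2) = n + 2 + j by ring, show n + 1 + (j + 1) = n + 2 + j by ring]
    linear_combination g (n + 2 + j) * h2 j
  rw [← s0, ← s1]
  simp only [Finset.sum_range_succ, Finset.sum_range_zero, zero_add, add_zero, h0, h1]
  linear_combination hz

/-- For `|m| ≥ 2` the fixed-point equation at site `n + 1` is the recurrence divided by `δ_m`; for
`|m| ≤ 1` it is the tail sum solving the recurrence. -/
theorem lattice_recurrence {w : SymmWeight} {κ σ f₁ C : ℝ} (hκ : 1 < κ) (hκ4 : κ < 4) (hσ : 0 < σ)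
    (hC0 : 0 < C) (hC : ∀ m : ℤ, ¬ 2 ≤ |m| → ∀ j, |tailCoeff κ m j| ≤ C) {v G p : Wiener w BddSeq}
    (hv : v = couplingOp w hκ σ v + (f₁⁻¹ • sourceOp w hκ hσ hC0 hC) G + boundaryOp w p)
    (m : ℤ) (n : ℕ) :
    (decay w hσ.le * v) m n + disp κ m * (decay w hσ.le * v) m (n + 1)
        + (decay w hσ.le * v) m (n + 2)
      = (f₁⁻¹ : ℝ) * ((decay w hσ.le * G) m (n + 1) - (decay w hσ.le * G) m n) := by
  have hvn : ∀ n, v m n = couplingFun κ σ m (v m) n + (f₁⁻¹ : ℝ) * sourceFun κ σ m (G m) n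
      + boundaryFun m (p m) n := fun n => by
    conv_lhs => rw [hv]
    rfl
  by_cases hm : 2 ≤ |m|
  · simp only [decay_mul_apply]
    have h := hvn (n + 1)
    have hd : (disp κ m : ℂ) ≠ 0 := by
      exact_mod_cast ((disp_two_pos hκ).trans_le (disp_two_le (one_pos.trans hκ) hm)).ne'
    simp only [couplingFun, sourceFun, boundaryFun, hm, if_true, Nat.add_sub_cancel, ne_eq,
      Nat.add_eq_zero_iff, one_ne_zero, and_false, not_false_eq_true, and_self, if_false,
      add_zero] at h
    have e1 := exp_mul_exp_shift σ σ n
    have e2 := exp_mul_exp_neg σ σ (n + 1)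
    rw [sub_self, Real.exp_zero, Complex.ofReal_one, one_mul] at e1
    rw [sub_self, neg_zero, Real.exp_zero, Complex.ofReal_one, one_mul] at e2
    have h' : (disp κ m : ℂ) * v m (n + 1) = -((Real.exp σ : ℝ) * v m n
        + (Real.exp (-σ) : ℝ) * v m (n + 2)) + (f₁⁻¹ : ℝ) * (G m (n + 1)
        - (Real.exp σ : ℝ) * G m n) := by
      rw [h]; push_cast; field_simp
    linear_combination ((Real.exp (-σ * (n + 1 : ℕ)) : ℝ) : ℂ) * h' - v m n * e1
      - v m (n + 2) * e2 - (f₁⁻¹ : ℝ) * G m n * e1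
  · have hexp : ∀ n j : ℕ, ((Real.exp (-σ * n) : ℝ) : ℂ) * (((tailCoeff κ m j * Real.exp (-σ * j) : ℝ) : ℂ)
        * G m (n + j)) = tailCoeff κ m j * (decay w hσ.le * G) m (n + j) := fun n j => by
      rw [decay_mul_apply, ← mul_assoc, ← mul_assoc, ← Complex.ofReal_mul, ← Complex.ofReal_mul]
      congr 2
      rw [mul_left_comm, ← Real.exp_add]
      push_cast; ring_nf
    have hsum : ∀ n : ℕ, (decay w hσ.le * v) m n = -(f₁⁻¹ : ℝ) *
        ∑' j : ℕ, (tailCoeff κ m j : ℂ) * (decay w hσ.le * G) m (n + j) := fun n => by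
      rw [decay_mul_apply, hvn]
      simp only [couplingFun, sourceFun, boundaryFun, hm, false_and, if_false]
      rw [zero_add, add_zero, mul_left_comm, mul_neg, ← tsum_mul_left, mul_neg, ← neg_mul]
      congr 1
      exact tsum_congr (hexp n)
    have hs : ∀ n, Summable fun j : ℕ => (tailCoeff κ m j : ℂ) * (decay w hσ.le * G) m (n + j) :=
      fun n => ((summable_tail hσ (hC m hm) (G m) n).mul_left
        ((Real.exp (-σ * n) : ℝ) : ℂ)).congr (hexp n)
    have h := tail_sum_recurrence (t := fun j => (tailCoeff κ m j : ℂ))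
      (g := fun n => (decay w hσ.le * G) m n) (d := disp κ m)
      (by rw [tailCoeff_zero hκ hκ4 hm, Complex.ofReal_one])
      (by rw [tailCoeff_one hκ hκ4 hm]; push_cast; rfl)
      (fun j => by exact_mod_cast tailCoeff_add_two hκ hκ4 hm j) hs n
    rw [hsum, hsum, hsum]
    linear_combination -((f₁⁻¹ : ℝ) : ℂ) * h

lemma boundary_value {w : SymmWeight} {κ σ f₁ C : ℝ} (hκ : 1 < κ) (hσ : 0 < σ)
    (hC0 : 0 < C) (hC : ∀ m : ℤ, ¬ 2 ≤ |m| → ∀ j, |tailCoeff κ m j| ≤ C) {v G p : Wiener w BddSeq}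
    (hv : v = couplingOp w hκ σ v + (f₁⁻¹ • sourceOp w hκ hσ hC0 hC) G + boundaryOp w p)
    {m : ℤ} (hm : 2 ≤ |m|) : v m 0 = p m 0 := by
  have : v m 0 = couplingFun κ σ m (v m) 0 + (f₁⁻¹ : ℝ) * sourceFun κ σ m (G m) 0
      + boundaryFun m (p m) 0 := by
    conv_lhs => rw [hv]
    rfl
  rw [this]
  simp [couplingFun, sourceFun, boundaryFun, hm]

/-! ### The equation of motion -/

/-- The value at the site `n` and the phase `θ`. -/
noncomputable def siteValue {w : SymmWeight} (n : ℕ) (θ : ℝ) : Wiener w BddSeq →ₐ[ℝ] ℂ :=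
  Wiener.eval (siteEval n) (norm_siteEval_le n) θ

section siteValue

variable {w : SymmWeight}

lemma siteValue_apply (n : ℕ) (θ : ℝ) (a : Wiener w BddSeq) :
    siteValue n θ a = fourierSeries (fun m => a m n) θ := rfl

lemma norm_siteValue_le (n : ℕ) (θ : ℝ) (a : Wiener w BddSeq) : ‖siteValue n θ a‖ ≤ ‖a‖ :=
  Wiener.norm_eval_le _ _ _ _

lemma ofReal_re_siteValue (n : ℕ) (θ : ℝ) (a : Wiener w BddSeq) :
    ((siteValue n θ a).re : ℂ) = siteValue n θ a :=
  Wiener.conj_eval (fun _ => rfl) a θ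

lemma summable_norm_site (a : Wiener w BddSeq) (n : ℕ) : Summable fun m => ‖a m n‖ :=
  Summable.of_nonneg_of_le (fun _ => norm_nonneg _) (fun m => (a m).norm_coe_le_norm n)
    a.summable_norm

lemma siteValue_differenceOp (n : ℕ) (θ : ℝ) (a : Wiener w BddSeq) :
    siteValue n θ (differenceOp w 0 a) = siteValue n θ a - siteValue (n + 1) θ a := by
  rw [siteValue_apply, siteValue_apply, siteValue_apply,
    ← fourierSeries_sub (summable_norm_site a n) (summable_norm_site a (n + 1))]
  congr 1
  funext m
  rw [differenceOp, siteOp_apply]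
  simp

end siteValue

/-- The wave satisfies its own equation, so only the increment `V` has to be balanced: its
acceleration against the linear force of `V` plus `G`. This is the recurrence multiplied by `f₁`. -/
theorem eqOfMotion_add_of_recurrence {w : SymmWeight} {F : ℝ → ℝ} {c γ κ f₁ : ℝ} (hf₁ : f₁ ≠ 0)
    (hγκ : γ ^ 2 = f₁ * κ) (hκ : κ ≠ 0) {k : ℕ → ℝ} {C₀ R : ℝ} (hk : ∀ j, |k j| ≤ C₀ * R ^ j)
    (hR : 0 < R)
    (hF : ∀ y : ℝ, |y| * R ≤ 1 / 2 → F (-c + y) = F (-c) + f₁ * y + remainder k y)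
    {u V G : Wiener w BddSeq} (hu : IsOnePhaseWave F c γ fun n m => u m n)
    (hU : ‖differenceOp w 0 u‖ * R ≤ 1 / 2)
    (hUV : ‖differenceOp w 0 u + differenceOp w 0 V‖ * R ≤ 1 / 2)
    (hG : G = remainder k (differenceOp w 0 u + differenceOp w 0 V)
      - remainder k (differenceOp w 0 u))
    (hrec : ∀ m n, V m n + disp κ m * V m (n + 1) + V m (n + 2)
      = (f₁⁻¹ : ℝ) * (G m (n + 1) - G m n)) (s : ℝ) (n : ℕ) :
    EqOfMotion F (fun t => c * n + s + (siteValue n (γ * t) (u + V)).re)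
      (fun t => c * (n + 1 : ℕ) + s + (siteValue (n + 1) (γ * t) (u + V)).re)
      (fun t => c * (n + 2 : ℕ) + s + (siteValue (n + 2) (γ * t) (u + V)).re) := by
  obtain ⟨β, r, y, hur, hy, hmotion⟩ := hu
  have hyu : ∀ (n : ℕ) t, y n t = c * n + (siteValue n (γ * t) u).re := fun n t => by
    have h1 := hy n t
    have h2 : siteValue n (γ * t) u = fourierSeries r (β * n + γ * t) := by
      rw [siteValue_apply, ← fourierSeries_shift]
      congr 1
      funext m
      exact hur n m
    rw [Int.cast_natCast, ← h2] at h1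
    have := congrArg Complex.re h1
    simpa using this
  have hdiffre : ∀ (a : Wiener w BddSeq) (n : ℕ) t, (siteValue n (γ * t) a).re
      - (siteValue (n + 1) (γ * t) a).re = (siteValue n (γ * t) (differenceOp w 0 a)).re :=
    fun a n t => by rw [siteValue_differenceOp, Complex.sub_re]
  have hforce : ∀ (p : Wiener w BddSeq), ‖p‖ * R ≤ 1 / 2 → ∀ (n : ℕ) t,
      F (-c + (siteValue n (γ * t) p).re) = F (-c) + f₁ * (siteValue n (γ * t) p).re
        + (siteValue n (γ * t) (remainder k p)).re := fun p hp n t => by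
    have hb : |(siteValue n (γ * t) p).re| * R ≤ 1 / 2 :=
      (mul_le_mul_of_nonneg_right ((Complex.abs_re_le_norm _).trans (norm_siteValue_le _ _ _))
        hR.le).trans hp
    rw [hF _ hb]
    have := map_remainder hk hR (siteValue n (γ * t)) (norm_siteValue_le n _) hp
      (ofReal_re_siteValue n (γ * t) p).symm
    rw [this, Complex.ofReal_re]
  have hFx : ∀ (n : ℕ) t, F (c * n + s + (siteValue n (γ * t) (u + V)).re
        - (c * (n + 1 : ℕ) + s + (siteValue (n + 1) (γ * t) (u + V)).re))
      = F (y n t - y (n + 1 : ℕ) t) + (f₁ * (siteValue n (γ * t) (differenceOp w 0 V)).re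
        + (siteValue n (γ * t) G).re) := fun n t => by
    have e1 : c * n + s + (siteValue n (γ * t) (u + V)).re
        - (c * (n + 1 : ℕ) + s + (siteValue (n + 1) (γ * t) (u + V)).re)
        = -c + (siteValue n (γ * t) (differenceOp w 0 u + differenceOp w 0 V)).re := by
      rw [← map_add, ← hdiffre]; push_cast; ring
    have e2 : y n t - y (n + 1 : ℕ) t = -c + (siteValue n (γ * t) (differenceOp w 0 u)).re := by
      rw [hyu, hyu, ← hdiffre]; push_cast; ring
    rw [e1, e2, hforce _ hUV, hforce _ hU, hG, map_sub, map_add, Complex.add_re, Complex.sub_re]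
    ring
  -- Regularity in time comes for free: the recurrence expresses `κ m² V(n+1)` through absolutely
  -- summable coefficients.
  have hV2 : Summable fun m : ℤ => ‖(m : ℂ) ^ 2 * V m (n + 1)‖ := by
    have hs : Summable fun m : ℤ => |κ|⁻¹ * (‖V m n‖ + 2 * ‖V m (n + 1)‖ + ‖V m (n + 2)‖
        + |f₁⁻¹| * (‖G m (n + 1)‖ + ‖G m n‖)) :=
      ((((summable_norm_site V n).add ((summable_norm_site V (n + 1)).mul_left 2)).add
        (summable_norm_site V (n + 2))).add (((summable_norm_site G (n + 1)).add
        (summable_norm_site G n)).mul_left _)).mul_left _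
    refine Summable.of_nonneg_of_le (fun _ => norm_nonneg _) (fun m => ?_) hs
    have h1 := hrec m n
    have hκ' : (κ : ℂ) ≠ 0 := by exact_mod_cast hκ
    have e : (m : ℂ) ^ 2 * V m (n + 1) = (κ⁻¹ : ℝ) * (-V m n + 2 * V m (n + 1) - V m (n + 2)
        + (f₁⁻¹ : ℝ) * (G m (n + 1) - G m n)) := by
      rw [← h1, disp]; push_cast; field_simp; ring
    rw [e, norm_mul, Complex.norm_real, norm_inv, Real.norm_eq_abs]
    refine mul_le_mul_of_nonneg_left ((norm_add_le _ _).trans (add_le_add ?_ ?_)) (by positivity)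
    · refine (norm_sub_le _ _).trans (add_le_add ((norm_add_le _ _).trans ?_) le_rfl)
      rw [norm_neg, norm_mul, Complex.norm_ofNat]
    · rw [norm_mul, Complex.norm_real, Real.norm_eq_abs]
      exact mul_le_mul_of_nonneg_left (norm_sub_le _ _) (abs_nonneg _)
  obtain ⟨hc, hd⟩ := contDiff_re_fourierSeries (summable_norm_site V (n + 1)) hV2 0 γ s
  simp only [zero_add] at hc hd
  obtain ⟨hyc, hyd⟩ := hmotion (n + 1 : ℕ)
  have hx : (fun t => c * (n + 1 : ℕ) + s + (siteValue (n + 1) (γ * t) (u + V)).re)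
      = fun t => y (n + 1 : ℕ) t + (s + (fourierSeries (fun m => V m (n + 1)) (γ * t)).re) := by
    funext t
    rw [hyu, map_add, Complex.add_re, ← siteValue_apply]; ring
  have hcoef : ∀ t, (fourierSeries (fun m => -(((m : ℂ) * γ) ^ 2 * V m (n + 1))) (γ * t)).re
      = f₁ * (siteValue n (γ * t) (differenceOp w 0 V)).re + (siteValue n (γ * t) G).re
        - (f₁ * (siteValue (n + 1) (γ * t) (differenceOp w 0 V)).re
          + (siteValue (n + 1) (γ * t) G).re) := fun t => by
    have sD := fun j => summable_norm_site (differenceOp w 0 V) j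
    have sG := fun j => summable_norm_site G j
    have sf : ∀ j, Summable fun m => ‖(f₁ : ℂ) * differenceOp w 0 V m j‖ := fun j => by
      simpa only [norm_mul] using (sD j).mul_left ‖(f₁ : ℂ)‖
    have sfG : ∀ j, Summable fun m => ‖(f₁ : ℂ) * differenceOp w 0 V m j + G m j‖ := fun j =>
      Summable.of_nonneg_of_le (fun _ => norm_nonneg _) (fun m => norm_add_le _ _)
        ((sf j).add (sG j))
    have e : fourierSeries (fun m => -(((m : ℂ) * γ) ^ 2 * V m (n + 1))) (γ * t)
        = ((f₁ : ℂ) * siteValue n (γ * t) (differenceOp w 0 V) + siteValue n (γ * t) G)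
        - ((f₁ : ℂ) * siteValue (n + 1) (γ * t) (differenceOp w 0 V)
          + siteValue (n + 1) (γ * t) G) := by
      simp only [siteValue_apply]
      rw [← fourierSeries_const_mul, ← fourierSeries_const_mul, ← fourierSeries_add (sf _) (sG _),
        ← fourierSeries_add (sf _) (sG _), ← fourierSeries_sub (sfG _) (sfG _)]
      congr 1
      funext m
      have h1 := hrec m n
      have hf₁' : (f₁ : ℂ) ≠ 0 := by exact_mod_cast hf₁
      have h2 : ∀ j, differenceOp w 0 V m j = V m j - V m (j + 1) := fun j => by
        rw [differenceOp, siteOp_apply]; simp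
      have h3 : (f₁ : ℂ) * (V m n + disp κ m * V m (n + 1) + V m (n + 2)) = G m (n + 1) - G m n := by
        rw [h1]; push_cast; field_simp
      have h4 : (γ : ℂ) ^ 2 = f₁ * κ := by exact_mod_cast hγκ
      rw [h2, h2]
      rw [disp] at h3
      push_cast at h3
      linear_combination -h3 - (m : ℂ) ^ 2 * V m (n + 1) * h4
    rw [e]
    simp
  rw [EqOfMotion, hx]
  refine ⟨hyc.add hc, fun t => ?_⟩
  rw [iteratedDeriv_fun_add hyc.contDiffAt hc.contDiffAt, hyd, hd, hcoef]
  have i1 : ((n + 1 : ℕ) : ℤ) - 1 = n := by push_cast; ring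
  have i2 : ((n + 1 : ℕ) : ℤ) + 1 = ((n + 1 + 1 : ℕ) : ℤ) := by push_cast; ring
  rw [i1, i2]
  have e2 := congrArg₂ (· - ·) (hFx n t) (hFx (n + 1) t)
  refine Eq.trans ?_ e2.symm
  ring

/-! ### Weights and decay rate -/

/-- The symmetrization of an admissible weight. -/
noncomputable def AdmissibleWeight.symmetrize {w : ℤ → ℝ} (hw : AdmissibleWeight w) :
    SymmWeight where
  toFun m := if m = 0 then 1 else max (w m) (w (-m))
  one_le m := by
    split_ifs
    · exact le_rfl
    · exact (hw.one_le m).trans (le_max_left _ _)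
  submul m n := by
    have h1 : ∀ m, 1 ≤ if m = 0 then 1 else max (w m) (w (-m)) := fun m => by
      split_ifs
      · exact le_rfl
      · exact (hw.one_le m).trans (le_max_left _ _)
    have h0 : ∀ m, 0 ≤ w m := fun m => zero_le_one.trans (hw.one_le m)
    rcases eq_or_ne m 0 with rfl | hm
    · rw [if_pos rfl]
      exact one_le_mul_of_one_le_of_one_le (h1 _) (h1 _)
    rcases eq_or_ne n 0 with rfl | hn
    · simp
    rcases eq_or_ne (m - n) 0 with hmn | hmn
    · rw [sub_eq_zero.1 hmn]; simp
    rw [if_neg hm, if_neg hn, if_neg hmn]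
    refine max_le ?_ ?_
    · exact (hw.submul m n).trans (mul_le_mul (le_max_left _ _) (le_max_left _ _) (h0 _)
        ((h0 _).trans (le_max_left _ _)))
    · refine (hw.submul (-m) (-n)).trans ?_
      rw [show -m - -n = -(m - n) by ring]
      exact mul_le_mul (le_max_right _ _) (le_max_right _ _) (h0 _)
        ((h0 _).trans (le_max_left _ _))
  symm m := by simp only [neg_eq_zero, neg_neg, max_comm]
  zero := by simp

lemma AdmissibleWeight.symmetrize_apply {w : ℤ → ℝ} (hw : AdmissibleWeight w) (m : ℤ) :
    hw.symmetrize m = if m = 0 then 1 else max (w m) (w (-m)) := rfl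

/-- The symmetrized weight is reset to `1` at the origin, so that the algebra has a unit of norm
one; the factor `w 0` repairs the comparison there. -/
lemma AdmissibleWeight.le_symmetrize {w : ℤ → ℝ} (hw : AdmissibleWeight w) (m : ℤ) :
    w m ≤ w 0 * hw.symmetrize m := by
  rw [hw.symmetrize_apply]
  split_ifs with hm
  · rw [hm, mul_one]
  · have h1 := hw.one_le m
    exact (le_max_left _ _).trans (le_mul_of_one_le_left (by
      exact zero_le_one.trans (h1.trans (le_max_left _ _))) (hw.one_le 0))

lemma AdmissibleWeight.symmetrize_le {w : ℤ → ℝ} (hw : AdmissibleWeight w) (m : ℤ) :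
    hw.symmetrize m ≤ w m + w (-m) := by
  have h1 := hw.one_le m
  have h2 := hw.one_le (-m)
  rw [hw.symmetrize_apply]
  split_ifs with hm
  · linarith
  · exact max_le (by linarith) (by linarith)

/-- A conjugation symmetric sequence of `ℓ_{1,w}`, constant along the lattice. -/
noncomputable def driverElement {w : ℤ → ℝ} (hw : AdmissibleWeight w) {b : ℤ → ℂ}
    (hb : MemEll1 w b) (hs : ∀ m, b (-m) = (starRingEnd ℂ) (b m)) :
    Wiener hw.symmetrize BddSeq :=
  Wiener.mk (fun m => BddSeq.mk (fun _ => b m) ‖b m‖ fun _ => le_rfl)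
    (by
      -- Conjugation symmetry of `b` makes it summable against the reflected weight too, so
      -- symmetrizing loses nothing.
      have h2 : Summable fun m => w (-m) * ‖b m‖ := by
        have := (Equiv.neg ℤ).summable_iff.2 hb
        refine this.congr fun m => ?_
        simp only [Function.comp_apply, Equiv.neg_apply]
        rw [hs, Complex.norm_conj]
      refine Summable.of_nonneg_of_le
        (fun m => mul_nonneg (hw.symmetrize.nonneg m) (norm_nonneg _)) (fun m => ?_)
        (Summable.add hb h2)
      rw [← add_mul]
      exact mul_le_mul (hw.symmetrize_le m) (BddSeq.norm_mk_le _) (norm_nonneg _)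
        (by linarith [hw.one_le m, hw.one_le (-m)]))
    fun m => by ext n; exact hs m

lemma memL_decay_mul {w : ℤ → ℝ} (hw : AdmissibleWeight w) {σ : ℝ} (hσ : 0 ≤ σ)
    (a : Wiener hw.symmetrize BddSeq) :
    MemL σ w fun n m => (decay hw.symmetrize hσ * a) m n := by
  have h : ∀ (m : ℤ) (n : ℕ), Real.exp (σ * n) * ‖(decay hw.symmetrize hσ * a) m n‖ ≤ ‖a m‖ :=
    fun m n => by
    rw [decay_mul_apply, norm_mul, Complex.norm_real, Real.norm_of_nonneg (Real.exp_pos _).le,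
      ← mul_assoc, ← Real.exp_add, neg_mul, add_neg_cancel, Real.exp_zero, one_mul]
    exact (a m).norm_coe_le_norm n
  have h0 : ∀ m, 0 ≤ w m := fun m => zero_le_one.trans (hw.one_le m)
  refine ⟨fun m => ⟨‖a m‖, ?_⟩, ?_⟩
  · rintro _ ⟨n, rfl⟩
    exact h m n
  · refine Summable.of_nonneg_of_le
      (fun m => mul_nonneg (h0 m) (Real.iSup_nonneg fun n => by positivity)) (fun m => ?_)
      (a.summable.mul_left (w 0))
    rw [← mul_assoc]
    exact mul_le_mul (hw.le_symmetrize m) (ciSup_le (h m)) (Real.iSup_nonneg fun n => by positivity)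
      (mul_nonneg (h0 0) (hw.symmetrize.nonneg m))

lemma memL_zero {w : ℤ → ℝ} (hw : AdmissibleWeight w) (a : Wiener hw.symmetrize BddSeq) :
    MemL 0 w fun n m => a m n := by
  have h := memL_decay_mul hw le_rfl a
  simpa only [decay_mul_apply, neg_zero, zero_mul, Real.exp_zero, Complex.ofReal_one, one_mul]
    using h

section DecayRate

variable {F : ℝ → ℝ} {c γ : ℝ}

lemma delta_eq_disp (F : ℝ → ℝ) (c γ : ℝ) (m : ℤ) :
    delta F c γ m = disp (γ ^ 2 / deriv F (-c)) m := by
  rw [delta, disp]; ring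

lemma m0_eq_one (hF' : 0 < deriv F (-c)) (hl : deriv F (-c) < γ ^ 2)
    (hu : γ ^ 2 < 4 * deriv F (-c)) : m0 F c γ = 1 := by
  refine IsGreatest.csSup_eq ⟨⟨by positivity, ?_⟩, fun m hm => ?_⟩
  · rw [Int.cast_one, one_mul, div_le_iff₀ hF']; exact hu.le
  · by_contra! h
    have h1 := hm.2
    rw [div_le_iff₀ hF', mul_pow] at h1
    have h2 : (2 : ℝ) ≤ m := by exact_mod_cast h
    have h3 : (4 : ℝ) ≤ (m : ℝ) ^ 2 := by nlinarith
    nlinarith [mul_le_mul_of_nonneg_right h3 (sq_nonneg γ)]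

/-- The roots `-ρ` and `-1/ρ` for `m = 2` give `δ_2 = 2 cosh (ln ρ)`. Since `σ₀` is at most half of
`-ln ρ`, monotonicity of `cosh` yields a strict inequality, which is the contraction constant of the
neighbour coupling. -/
lemma sigma0_spec (hF' : 0 < deriv F (-c)) (hl : deriv F (-c) < γ ^ 2)
    (hu : γ ^ 2 < 4 * deriv F (-c)) : 0 < sigma0 F c γ ∧ sigma0 F c γ ≤ 1 ∧
      2 * Real.cosh (sigma0 F c γ) < disp (γ ^ 2 / deriv F (-c)) 2 := by
  set d := disp (γ ^ 2 / deriv F (-c)) 2 with hd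
  have hκ : 1 < γ ^ 2 / deriv F (-c) := by rwa [one_lt_div hF']
  have hd2 : 2 < d := by rw [hd, disp]; push_cast; linarith
  set s := Real.sqrt (d ^ 2 / 4 - 1) with hs
  have hs0 : 0 ≤ s := Real.sqrt_nonneg _
  have hs2 : s ^ 2 = d ^ 2 / 4 - 1 := Real.sq_sqrt (by nlinarith)
  have hsd : s < d / 2 := by nlinarith
  have hz : |zRoot F c γ (m0 F c γ + 1)| = d / 2 - s := by
    rw [m0_eq_one hF' hl hu, zRoot, delta_eq_disp, one_add_one_eq_two, ← hd, ← hs,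
      abs_of_neg (by linarith)]
    ring
  set ρ := d / 2 - s with hρ
  have hρ0 : 0 < ρ := by linarith
  have hinv : ρ * (d / 2 + s) = 1 := by rw [hρ]; nlinarith
  have hρ1 : ρ < 1 := by nlinarith
  have hlog : Real.log ρ < 0 := Real.log_neg hρ0 hρ1
  have hsig : sigma0 F c γ = min 1 (-(1 / 2) * Real.log ρ) := by rw [sigma0, hz]
  have hpos : 0 < sigma0 F c γ := by
    rw [hsig]; exact lt_min one_pos (by linarith)
  refine ⟨hpos, by rw [hsig]; exact min_le_left _ _, ?_⟩
  have hle : sigma0 F c γ ≤ -(1 / 2) * Real.log ρ := by rw [hsig]; exact min_le_right _ _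
  have hcosh : Real.cosh (Real.log ρ) = d / 2 := by
    rw [Real.cosh_log hρ0, inv_eq_of_mul_eq_one_right hinv, hρ]; ring
  have : Real.cosh (sigma0 F c γ) < Real.cosh (Real.log ρ) := by
    rw [Real.cosh_lt_cosh, abs_of_pos hpos, abs_of_neg hlog]; linarith
  linarith

end DecayRate

/-! ### Assembling the trajectories. -/

/-- The trajectories with Fourier coefficients `W`, normalized by a constant shift `s`. -/
noncomputable def trajectory {w : SymmWeight} (c γ s : ℝ) (W : Wiener w BddSeq) (n : ℕ) (t : ℝ) :
    ℝ :=
  c * n + s + (siteValue n (γ * t) W).re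

/-- Matching all modes but `m = 0` leaves a discrepancy constant in time, which the shift `s` of the
trajectories removes. -/
lemma siteValue_eq_driver {w : SymmWeight} {W : Wiener w BddSeq} {ε : ℝ} {b : ℤ → ℂ}
    (hb : Summable fun m => ‖b m‖) (hW : ∀ m, m ≠ 0 → W m 0 = ε * b m) (θ : ℝ) :
    siteValue 0 θ W = ε * fourierSeries b θ + (W 0 0 - ε * b 0) := by
  have h1 : Summable fun m => ‖(ε : ℂ) * b m‖ := by
    simpa only [norm_mul] using hb.mul_left ‖(ε : ℂ)‖
  have h := fourierSeries_sub (summable_norm_site W 0) h1 θ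
  have h2 : fourierSeries (fun m => W m 0 - ε * b m) θ = W 0 0 - ε * b 0 := by
    rw [fourierSeries, tsum_eq_single 0]
    · simp
    · intro m hm
      rw [hW m hm, sub_self, zero_mul]
  rw [h2, fourierSeries_const_mul] at h
  rw [siteValue_apply]
  linear_combination -h

lemma periodic_trajectory {w : SymmWeight} {c γ s : ℝ} (hγ : γ ≠ 0) (W : Wiener w BddSeq) (n : ℕ) :
    Function.Periodic (trajectory c γ s W n) (2 * Real.pi / γ) := fun t => by
  have e : γ * (t + 2 * Real.pi / γ) = γ * t + 2 * Real.pi := by field_simp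
  rw [trajectory, trajectory, e, siteValue_apply, siteValue_apply, fourierSeries_periodic]

lemma abs_trajectory_sub_le {w : SymmWeight} (c γ s : ℝ) (W : Wiener w BddSeq) (n : ℕ) (t : ℝ) :
    |trajectory c γ s W n t - c * n| ≤ |s| + ‖W‖ := by
  rw [trajectory, add_assoc, add_sub_cancel_left]
  exact (abs_add_le _ _).trans (add_le_add le_rfl
    ((Complex.abs_re_le_norm _).trans (norm_siteValue_le _ _ _)))

lemma norm_site_le {w : SymmWeight} (a : Wiener w BddSeq) (m : ℤ) (n : ℕ) : ‖a m n‖ ≤ ‖a‖ :=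
  ((a m).norm_coe_le_norm n).trans (a.norm_apply_le m)

end DrivenLattice

open DrivenLattice in
theorem theorem4
    (F : ℝ → ℝ) (c γ : ℝ) (b : ℤ → ℂ) (w : ℤ → ℝ)
    (hF : AnalyticAt ℝ F (-c)) (hF' : 0 < deriv F (-c))
    (hw : DrivenLattice.AdmissibleWeight w)
    (hb : DrivenLattice.MemEll1 w b) (hb_norm : DrivenLattice.ell1Norm w b = 1)
    (hb_real : ∀ m : ℤ, b (-m) = (starRingEnd ℂ) (b m))
    (hγ : 0 < γ) (hγ_lower : deriv F (-c) < γ ^ 2) (hγ_upper : γ ^ 2 < 4 * deriv F (-c)) :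
    0 < DrivenLattice.sigma0 F c γ ∧
    ∃ D ∈ 𝓝 (0 : ℝ), ∃ C : ℝ, ∀ ε ∈ D,
      ∃ (u v : ℕ → ℤ → ℂ) (x : ℕ → ℝ → ℝ),
        DrivenLattice.MemL 0 w u ∧
        DrivenLattice.MemL (DrivenLattice.sigma0 F c γ) w v ∧
        DrivenLattice.IsOnePhaseWave F c γ u ∧
        (∀ n : ℕ, 1 ≤ n → ∀ t : ℝ,
          (x n t : ℂ) = ((c * n : ℝ) : ℂ) + (ε : ℂ) * b 0 - (u 0 0 + v 0 0)
            + DrivenLattice.fourierSeries (fun m => u n m + v n m) (γ * t)) ∧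
        DrivenLattice.IsDrivenSolution F γ ε b x ∧
        (∀ n : ℕ, Function.Periodic (x n) (2 * Real.pi / γ)) ∧
        (∀ (n : ℕ) (t : ℝ), |x n t - c * n| ≤ C * |ε|) := by
  obtain ⟨hσ, hσ1, hcosh⟩ := sigma0_spec (c := c) hF' hγ_lower hγ_upper
  refine ⟨hσ, ?_⟩
  set σ := sigma0 F c γ with hσdef
  set f₁ := deriv F (-c) with hf₁
  set κ := γ ^ 2 / f₁ with hκdef
  have hκ : 1 < κ := by rwa [hκdef, one_lt_div hF']
  have hκ4 : κ < 4 := by rwa [hκdef, div_lt_iff₀ hF']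
  have hγκ : γ ^ 2 = f₁ * κ := by rw [hκdef]; field_simp
  obtain ⟨k, C₀, R, hR, hk, htaylor⟩ := exists_taylor hF
  obtain ⟨C₁, hC₁, hfirst, hsecond⟩ := exists_remainder_bounds (Wiener hw.symmetrize BddSeq) hk hR
  obtain ⟨a₀, C₂, s₀, β, u, ha₀, hC₂, hs₀, hwave⟩ := exists_travelling_waves hw.symmetrize hκ hκ4
    hF' hγκ hk hR htaylor (half_pos hσ)
  obtain ⟨C₃, hC₃, htail⟩ := exists_tailCoeff_bound hκ hκ4
  have hd2 := disp_two_pos hκ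
  have hexp : 0 < 1 - Real.exp (-(σ / 2)) := by
    have : Real.exp (-(σ / 2)) < 1 := by rw [Real.exp_lt_one_iff]; linarith
    linarith
  set f := driverElement hw hb hb_real with hf
  obtain ⟨ε₀, K, hε₀, hK, hsol⟩ := exists_halfLine_solution
    (halfLineOperators hw.symmetrize hκ hF' hσ hσ1 hC₃ htail)
    (div_nonneg (by have := Real.cosh_pos σ; positivity) hd2.le) ((div_lt_one hd2).2 hcosh)
    (by positivity) hR hC₁ ⟨hfirst, hsecond⟩ ha₀ hC₂ (fun z hz => (hwave z hz).2.1)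
    (fun z z' hz hz' => ((hwave z hz).2.2.2.2.2 z' hz').1)
    (fun z z' hz hz' => ((hwave z hz).2.2.2.2.2 z' hz').2) f
  refine ⟨Metric.closedBall 0 ε₀, Metric.closedBall_mem_nhds _ hε₀,
    -- The deviation is at most `|s| + ‖W‖` with `|s| ≤ |ε| ‖f‖ + ‖W‖`, and `‖W‖ ≤ (C₂ K + K) |ε|`.
    ‖f‖ + 2 * (C₂ * K + K), fun ε hε => ?_⟩
  rw [mem_closedBall_zero_iff, Real.norm_eq_abs] at hε
  obtain ⟨z, v, G, hz, hzε, hvε, hU, hUV, hG, hv, hzeq⟩ := hsol ε hε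
  obtain ⟨hs, huz, hu1, hu0, huw, -⟩ := hwave z hz
  set V := decay hw.symmetrize hσ.le * v with hV
  have hDV : decay hw.symmetrize hσ.le * differenceOp hw.symmetrize σ v
      = differenceOp hw.symmetrize 0 V := by
    rw [decay_mul_differenceOp, sub_self]
  rw [hDV] at hUV hG
  have hV0 : ∀ m, V m 0 = v m 0 := fun m => by rw [hV, decay_mul_apply]; simp
  set W := u z + V with hW
  have hb0 : ((b 0).re : ℂ) = b 0 := Complex.conj_eq_iff_re.1 (by simpa using (hb_real 0).symm)
  have hW00 : ((W 0 0).re : ℂ) = W 0 0 := Complex.conj_eq_iff_re.1 (by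
    have := congrArg (fun x : BddSeq => x 0) (W.apply_neg 0)
    rw [neg_zero] at this
    exact this.symm)
  set s := ε * (b 0).re - (W 0 0).re with hsdef
  have hsC : (s : ℂ) = ε * b 0 - W 0 0 := by rw [hsdef]; push_cast; rw [hb0, hW00]
  have hWnorm : ‖W‖ ≤ (C₂ * K + K) * |ε| := by
    refine (norm_add_le _ _).trans ?_
    have h1 : ‖V‖ ≤ K * |ε| := (norm_decay_mul_le _ _).trans hvε
    have h2 := huz.trans (mul_le_mul_of_nonneg_left hzε hC₂.le)
    linarith
  have hx : ∀ (n : ℕ) (t : ℝ), (trajectory c γ s W n t : ℂ)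
      = ((c * n : ℝ) : ℂ) + (ε : ℂ) * b 0 - W 0 0 + siteValue n (γ * t) W := fun n t => by
    rw [trajectory]
    push_cast
    rw [ofReal_re_siteValue, hsC]; ring
  -- the boundary values agree with the driver
  have hone : W 1 0 = ε * b 1 := by
    have h1 : W 1 0 = u z 1 0 + v 1 0 := by rw [← hV0]; rfl
    have hs' : ((2 * Real.sin (β z / 2) : ℝ) : ℂ) ≠ 0 := by
      exact_mod_cast (mul_pos two_pos (hs₀.trans_le hs)).ne'
    -- The fixed-point equation for `z`, rewritten through the explicit boundary coefficient `i z /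
    -- (2 sin (β/2))` of the wave.
    have h2 : u z 1 0 = ε * b 1 - v 1 0 := by
      rw [hu1, div_eq_iff hs']
      have h3 : firstMode hw.symmetrize f = b 1 := rfl
      rw [h3, firstMode_apply] at hzeq
      linear_combination Complex.I * hzeq
        - (2 * Real.sin (β z / 2) : ℝ) * (ε * b 1 - v 1 0) * Complex.I_sq
    rw [h1, h2]; ring
  have hbdry : ∀ m, m ≠ 0 → W m 0 = ε * b m := by
    intro m hm
    by_cases hm2 : 2 ≤ |m|
    · have h1 : W m 0 = u z m 0 + v m 0 := by rw [← hV0]; rfl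
      have h2 : v m 0 = ε * b m - u z m 0 := boundary_value hκ hσ hC₃ htail hv hm2
      rw [h1, h2]; ring
    · have : m = 1 ∨ m = -1 := by
        have := abs_lt.1 (not_le.1 hm2); omega
      rcases this with rfl | rfl
      · exact hone
      -- Mode `-1` follows from mode `1` by reality, so one complex parameter suffices.
      · have := congrArg (fun x : BddSeq => x 0) (W.apply_neg 1)
        change W (-1) 0 = (starRingEnd ℂ) (W 1 0) at this
        rw [this, hone, map_mul, Complex.conj_ofReal, hb_real]
  have hbsum : Summable fun m => ‖b m‖ := Summable.of_nonneg_of_le (fun _ => norm_nonneg _)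
    (fun m => le_mul_of_one_le_left (norm_nonneg _) (hw.one_le m)) hb
  refine ⟨fun n m => u z m n, fun n m => V m n, trajectory c γ s W, memL_zero hw _,
    memL_decay_mul hw hσ.le v, huw, fun n _ t => hx n t, ⟨fun t => ?_, fun n => ?_⟩,
    periodic_trajectory hγ.ne' W, fun n t => ?_⟩
  · rw [hx, siteValue_eq_driver hbsum hbdry]
    push_cast; ring
  · exact eqOfMotion_add_of_recurrence hF'.ne' hγκ (one_pos.trans hκ).ne' hk hR htaylor huw hU hUV
      hG (lattice_recurrence hκ hκ4 hσ hC₃ htail hv) s n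
  · refine (abs_trajectory_sub_le c γ s W n t).trans ?_
    have h1 : |s| ≤ |ε| * ‖f‖ + ‖W‖ := by
      refine (abs_sub _ _).trans (add_le_add ?_ ?_)
      · rw [abs_mul]
        refine mul_le_mul_of_nonneg_left ((Complex.abs_re_le_norm _).trans ?_) (abs_nonneg _)
        exact norm_site_le f 0 0
      · exact (Complex.abs_re_le_norm _).trans (norm_site_le W 0 0)
    nlinarith
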